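/- **Setting.** Let $V$ be a finite-dimensional real normed space, $V\otimes V$ its tensor square (with the projective norm), $J=[a,b]$ a compact interval, $t_0\in J$. For a path $A$ on $J$ put $\delta A_{st}=A_t-A_s$; for a two-parameter process $R$ on $J^2$ put $(NR)_{sut}=R_{st}-R_{ut}-R_{su}$ and $\|R\|_{\alpha,J}=\sup_{s,t\in J}|R_{st}|/|t-s|^\alpha$. $\Omega\mathcal C^\alpha(J)$ is the space of continuous processes vanishing on the diagonal with $\|R\|_{\alpha,J}<\infty$; $\mathcal C^\alpha(J)$ is the space of continuous paths $A$ with $\|A\|_{\alpha,J}:=\|\delta A\|_{\alpha,J}<\infty$. A rough path is a pair $(X,\mathbb X^2)$ with $X\in\mathcal C^\gamma(J,V)$, $\mathbb X^2\in\Omega\mathcal C^{2\gamma}(J,V\otimes V)$ and $N\mathbb X^2_{sut}=\delta X_{su}\otimes\delta X_{ut}$ for $s,u,t\in J$. For a normed space $E$, $(Z,Z')\in\mathcal D_X^{\gamma,\eta}(J,E)$ means $Z\in\mathcal C^\gamma(J,E)$, $Z'\in\mathcal C^{\eta-\gamma}(J,L(V,E))$ and $R_Z:=\delta Z-Z'\delta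 X\in\Omega\mathcal C^\eta(J,E)$, where $(Z'\delta X)_{st}=Z'_s\,\delta X_{st}$. Write $$\|Y\|_{*,J}=\|Y'\|_{\infty,J}+\|Y'\|_{\gamma,J}+\|R_Y\|_{2\gamma,J}+\|Y\|_{\gamma,J}$$ for $(Y,Y')\in\mathcal D_X^{\gamma,2\gamma}(J,V)$. For $(W,W')$ controlled by $X$ with values in $L(V,V)$, set $G_{st}=W_s\,\delta X_{st}+W'_s\,\mathbb X^2_{st}$ (where $W'_s$ contracts $u\otimes v$ to $(W'_su)v$) and $$\int_s^t W\,dX=G_{st}-(\Lambda NG)_{st},$$ where $\Lambda NG$ is the unique process in $\bigcup_{z>1}\Omega\mathcal C^z(J,V)$ with $N(\Lambda NG)=NG$. $C^{2,\delta}(V,L(V,V))$ is the space of $C^2$ maps for which $$\|\varphi\|_{2,\delta}=\|\varphi\|_\infty+\|\partial\varphi\|_\infty+\|\partial^2\varphi\|_\infty+\sup_{x,y}\frac{|\partial^2\varphi(x)-\partial^2\varphi(y)|}{|x-y|^\delta}$$ is finite. A solution of $dY=\varphi(Y)\,dX$, $Y_{t_0}=y$, based on $(X,\mathbb X^2)$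 is a pair $(Y,Y')\in\mathcal D_X^{\gamma,2\gamma}(J,V)$ such that for all $t\in J$ $$Y_t=y+\int_{t_0}^t\varphi(Y_u)\,dX_u,\qquad Y'_t=\varphi(Y_t),$$ where $\varphi(Y)$ is controlled by $X$ with derivative $\partial\varphi(Y)Y'$. **Proposition (Uniqueness $\gamma>1/3$).** Let $\gamma>1/3$ and $\delta\in(0,1)$ with $(2+\delta)\gamma>1$. 1. For every rough path $(X,\mathbb X^2)$ on $J$, every $\varphi\in C^{2,\delta}(V,L(V,V))$ and every $y\in V$, there is a unique solution $(Y,Y')=F(y,\varphi,X,\mathbb X^2)$ in $\mathcal D_X^{\gamma,2\gamma}(J,V)$. 2. Let $(X,\mathbb X^2)$, $(\widetilde X,\widetilde{\mathbb X}^2)$ be rough paths on $J$, $\varphi,\widetilde\varphi\in C^{2,\delta}(V,L(V,V))$, $y,\widetilde y\in V$, and let $Y=F(y,\varphi,X,\mathbb X^2)$, $\widetilde Y=F(\widetilde y,\widetilde\varphi,\widetilde X,\widetilde{\mathbb X}^2)$. Put $$\epsilon_{Y,J}=\|Y'-\widetilde Y'\|_{\infty,J}+\|Y'-\widetilde Y'\|_{\gamma,J}+\|R_Y-R_{\widetilde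 Y}\|_{2\gamma,J},$$ $$\rho_J=|y-\widetilde y|+\|\varphi-\widetilde\varphi\|_{2,\delta}+\|X-\widetilde X\|_{\gamma,J}+\|\mathbb X^2-\widetilde{\mathbb X}^2\|_{2\gamma,J},$$ $$C_{X,J}=1+\|X\|_{\gamma,J}+\|\widetilde X\|_{\gamma,J}+\|\mathbb X^2\|_{2\gamma,J}+\|\widetilde{\mathbb X}^2\|_{2\gamma,J},\qquad C_{Y,J}=1+\|Y\|_{*,J}+\|\widetilde Y\|_{*,J}.$$ Then there is a constant $M$ which (for given $V,\gamma,\delta,J$) depends only on $C_{X,J}$, $C_{Y,J}$, $\|\varphi\|_{2,\delta}$ and $\|\widetilde\varphi\|_{2,\delta}$ such that $$\epsilon_{Y,J}\le M\,\rho_J.$$ -/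

import Mathlib

open Set
open scoped TensorProduct

/-! ### The tensor product `V ⊗ V` of a finite-dimensional normed space, as a normed space -/

namespace TensorNorm

variable {V : Type*} [NormedAddCommGroup V] [NormedSpace ℝ V]

/-- The tensor represented by a finite family of pairs. -/
noncomputable def eval (l : List (V × V)) : V ⊗[ℝ] V :=
  (l.map (fun p => p.1 ⊗ₜ[ℝ] p.2)).sum

/-- The cost `∑ ‖aᵢ‖ ‖bᵢ‖` of a representation `∑ aᵢ ⊗ bᵢ`. -/
noncomputable def cost (l : List (V × V)) : ℝ :=
  (l.map (fun p => ‖p.1‖ * ‖p.2‖)).sum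

/-- The projective norm `inf { ∑ ‖aᵢ‖ ‖bᵢ‖ : z = ∑ aᵢ ⊗ bᵢ }`. -/
noncomputable def projNorm (z : V ⊗[ℝ] V) : ℝ :=
  sInf (cost '' {l : List (V × V) | eval l = z})

set_option linter.unusedSectionVars false in
theorem cost_nonneg (l : List (V × V)) : 0 ≤ cost l := by
  apply List.sum_nonneg
  intro x hx
  obtain ⟨p, -, rfl⟩ := List.mem_map.1 hx
  positivity

theorem exists_eval (z : V ⊗[ℝ] V) : ∃ l : List (V × V), eval l = z := by
  induction z using TensorProduct.induction_on with
  | zero => exact ⟨[], by simp [eval]⟩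
  | tmul a b => exact ⟨[(a, b)], by simp [eval]⟩
  | add x y hx hy =>
    obtain ⟨l, hl⟩ := hx
    obtain ⟨m, hm⟩ := hy
    exact ⟨l ++ m, by rw [← hl, ← hm]; simp [eval]⟩

theorem projNorm_le (l : List (V × V)) : projNorm (eval l) ≤ cost l :=
  csInf_le ⟨0, fun _ ⟨m, _, hm⟩ => hm ▸ cost_nonneg m⟩ ⟨l, rfl, rfl⟩

theorem le_projNorm {z : V ⊗[ℝ] V} {c : ℝ} (h : ∀ l : List (V × V), eval l = z → c ≤ cost l) :
    c ≤ projNorm z := by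
  obtain ⟨l, hl⟩ := exists_eval z
  refine le_csInf (Set.Nonempty.image cost ⟨l, hl⟩) ?_
  rintro _ ⟨m, hm, rfl⟩
  exact h m hm

theorem projNorm_smul_le (c : ℝ) (z : V ⊗[ℝ] V) : projNorm (c • z) ≤ ‖c‖ * projNorm z := by
  rcases eq_or_ne c 0 with rfl | hc
  · simpa [eval, cost] using projNorm_le (V := V) []
  rw [← div_le_iff₀' (norm_pos_iff.2 hc)]
  apply le_projNorm
  intro l hl
  rw [div_le_iff₀' (norm_pos_iff.2 hc)]
  have h1 : eval (l.map (fun p => (c • p.1, p.2))) = c • z := by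
    rw [← hl]
    simp [eval, List.smul_sum, Function.comp_def, TensorProduct.smul_tmul']
  have h2 : cost (l.map (fun p => (c • p.1, p.2))) = ‖c‖ * cost l := by
    simp [cost, ← List.sum_map_mul_left, Function.comp_def, norm_smul, mul_assoc]
  rw [← h1, ← h2]
  exact projNorm_le _

/-- A bounded bilinear map is bounded, with the same constant, with respect to `cost`. -/
theorem norm_lift_le {E : Type*} [NormedAddCommGroup E] [NormedSpace ℝ E]
    (B : V →ₗ[ℝ] V →ₗ[ℝ] E) {C : ℝ} (hC : ∀ a b, ‖B a b‖ ≤ C * (‖a‖ * ‖b‖))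
    (l : List (V × V)) : ‖TensorProduct.lift B (eval l)‖ ≤ C * cost l := by
  induction l with
  | nil => simp [eval, cost]
  | cons p l ih =>
    have h1 : TensorProduct.lift B (eval (p :: l))
        = B p.1 p.2 + TensorProduct.lift B (eval l) := by simp [eval]
    have h2 : cost (p :: l) = ‖p.1‖ * ‖p.2‖ + cost l := by simp [cost]
    rw [h1, h2, mul_add]
    exact (norm_add_le _ _).trans (add_le_add (hC _ _) ih)

noncomputable instance : Norm (V ⊗[ℝ] V) := ⟨projNorm⟩

theorem core [FiniteDimensional ℝ V] : NormedSpace.Core ℝ (V ⊗[ℝ] V) where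
  norm_nonneg z := le_projNorm fun l _ => cost_nonneg l
  norm_smul c z := by
    apply le_antisymm (projNorm_smul_le c z)
    rcases eq_or_ne c 0 with rfl | hc
    · simpa using le_projNorm (V := V) (z := (0 : ℝ) • z) fun l _ => cost_nonneg l
    · have := projNorm_smul_le c⁻¹ (c • z)
      rwa [smul_smul, inv_mul_cancel₀ hc, one_smul, norm_inv,
        le_inv_mul_iff₀ (norm_pos_iff.2 hc)] at this
  norm_triangle x y := by
    change projNorm (x + y) ≤ projNorm x + projNorm y
    rw [← sub_le_iff_le_add]
    apply le_projNorm
    intro l hl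
    rw [sub_le_comm]
    apply le_projNorm
    intro m hm
    have h := projNorm_le (l ++ m)
    have h1 : eval (l ++ m) = x + y := by rw [← hl, ← hm]; simp [eval]
    have h2 : cost (l ++ m) = cost l + cost m := by simp [cost]
    rw [h1, h2] at h
    linarith
  norm_eq_zero_iff z := by
    constructor
    · intro hz
      rw [← Module.forall_dual_apply_eq_zero_iff ℝ]
      intro f
      let B : V →ₗ[ℝ] V →ₗ[ℝ] ℝ := TensorProduct.curry f
      have hf : TensorProduct.lift B = f := TensorProduct.lift_mk_compr₂ f
      let C := ‖B.toContinuousBilinearMap‖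
      have hC : ∀ a b, ‖B a b‖ ≤ C * (‖a‖ * ‖b‖) := fun a b => by
        rw [← mul_assoc]
        exact B.toContinuousBilinearMap.le_opNorm₂ a b
      have key : ‖f z‖ ≤ (C + 1) * projNorm z := by
        have hC1 : 0 < C + 1 := by positivity
        rw [← div_le_iff₀' hC1]
        apply le_projNorm
        intro l hl
        rw [div_le_iff₀' hC1, ← hl, ← hf]
        apply norm_lift_le
        intro a b
        refine (hC a b).trans ?_
        gcongr
        linarith
      change projNorm z = 0 at hz
      rw [hz, mul_zero] at key
      exact norm_le_zero_iff.1 key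
    · rintro rfl
      apply le_antisymm _ (le_projNorm fun l _ => cost_nonneg l)
      simpa [eval, cost] using projNorm_le (V := V) []

noncomputable instance instNormedAddCommGroup [FiniteDimensional ℝ V] :
    NormedAddCommGroup (V ⊗[ℝ] V) :=
  NormedAddCommGroup.ofCore core

noncomputable instance instNormedSpace [FiniteDimensional ℝ V] : NormedSpace ℝ (V ⊗[ℝ] V) :=
  NormedSpace.ofCore core

end TensorNorm

namespace Rough

/-! ### Paths, processes, the operators `δ`, `N`, `Λ`

Paths on an interval `J` are functions on `ℝ` of which only the values on `J` matter; processes are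
functions of two real variables of which only the values on `J × J` matter. -/

section Processes

variable {E : Type*} [NormedAddCommGroup E] [NormedSpace ℝ E]

/-- The increment `(δA)_{st} = A_t - A_s`. -/
def incr (A : ℝ → E) (s t : ℝ) : E := A t - A s

/-- `(N R)_{sut} = R_{st} - R_{ut} - R_{su}`. -/
def opN (R : ℝ → ℝ → E) (s u t : ℝ) : E := R s t - R u t - R s u

/-- The Hölder seminorm `‖R‖_{γ,J} = sup_{s,t ∈ J} |R_{st}| / |t-s|^γ` of a process. (For `s = t`
the quotient is `0`, as it should be since processes vanish on the diagonal.) -/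
noncomputable def holderNorm (γ : ℝ) (J : Set ℝ) (R : ℝ → ℝ → E) : ℝ :=
  ⨆ p : J × J, ‖R p.1 p.2‖ / |(p.2 : ℝ) - p.1| ^ γ

/-- The sup norm of a path on `J`. -/
noncomputable def supNorm (J : Set ℝ) (A : ℝ → E) : ℝ := ⨆ t : J, ‖A t‖

/-- The space `Ω𝒞^γ(J, E)`, `γ > 0`: continuous processes on `J × J`, vanishing on the diagonal,
with finite `γ`-Hölder seminorm. -/
def IsHolderProcess (γ : ℝ) (J : Set ℝ) (R : ℝ → ℝ → E) : Prop :=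
  ContinuousOn (fun p : ℝ × ℝ => R p.1 p.2) (J ×ˢ J) ∧
  (∀ t ∈ J, R t t = 0) ∧
  ∃ C : ℝ, ∀ s ∈ J, ∀ t ∈ J, ‖R s t‖ ≤ C * |t - s| ^ γ

/-- The space `𝒞^γ(J, E)` of `γ`-Hölder paths (`J` compact, so that boundedness is automatic). -/
def IsHolderPath (γ : ℝ) (J : Set ℝ) (A : ℝ → E) : Prop :=
  ContinuousOn A J ∧ IsHolderProcess γ J (incr A)

/-- `R` is a solution of `N R = A` on `J` in `Ω𝒞^z(J, E)` for some `z > 1`; its values on `J × J`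
are uniquely determined by `A`. -/
def IsSewing (J : Set ℝ) (A : ℝ → ℝ → ℝ → E) (R : ℝ → ℝ → E) : Prop :=
  (∃ z : ℝ, 1 < z ∧ IsHolderProcess z J R) ∧
  ∀ s ∈ J, ∀ u ∈ J, ∀ t ∈ J, opN R s u t = A s u t

open Classical in
/-- The map `Λ`: `Λ A` is the unique process on `J` in `⋃_{z > 1} Ω𝒞^z` with `N (Λ A) = A`. -/
noncomputable def sewing (J : Set ℝ) (A : ℝ → ℝ → ℝ → E) : ℝ → ℝ → E :=
  if h : ∃ R, IsSewing J A R then h.choose else 0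

end Processes

/-! ### Rough paths, weakly controlled paths, the integral -/

section Controlled

variable {V : Type*} [NormedAddCommGroup V] [NormedSpace ℝ V]
variable {E : Type*} [NormedAddCommGroup E] [NormedSpace ℝ E]

/-- `(X, 𝕏²)` is a rough path of roughness `1/γ` on `J`. -/
def IsRoughPath [FiniteDimensional ℝ V] (γ : ℝ) (J : Set ℝ) (X : ℝ → V) (XX : ℝ → ℝ → V ⊗[ℝ] V) :
    Prop :=
  IsHolderPath γ J X ∧ IsHolderProcess (2 * γ) J XX ∧
  ∀ s ∈ J, ∀ u ∈ J, ∀ t ∈ J, opN XX s u t = incr X s u ⊗ₜ[ℝ] incr X u t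

/-- The remainder `R_Z = δZ - Z' δX` of a path `Z` with derivative `Z'`. -/
def remainder (X : ℝ → V) (Z : ℝ → E) (Z' : ℝ → V →L[ℝ] E) (s t : ℝ) : E :=
  incr Z s t - Z' s (incr X s t)

/-- `(Z, Z') ∈ 𝒟_X^{γ,η}(J, E)`. -/
def IsControlled (γ η : ℝ) (J : Set ℝ) (X : ℝ → V) (Z : ℝ → E) (Z' : ℝ → V →L[ℝ] E) : Prop :=
  IsHolderPath γ J Z ∧ IsHolderPath (η - γ) J Z' ∧ IsHolderProcess η J (remainder X Z Z')

/-- `‖Z‖_{D(X,γ,η),J} = ‖Z'‖_∞ + ‖Z'‖_{η-γ} + ‖R_Z‖_η + ‖Z‖_γ`. -/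
noncomputable def controlledNorm (γ η : ℝ) (J : Set ℝ) (X : ℝ → V) (Z : ℝ → E)
    (Z' : ℝ → V →L[ℝ] E) : ℝ :=
  supNorm J Z' + holderNorm (η - γ) J (incr Z') + holderNorm η J (remainder X Z Z')
    + holderNorm γ J (incr Z)

/-- The contraction `V ⊗ V → E` with `L ∈ E ⊗ V* ⊗ V*`, which maps
`a ⊗ b` to `(L a) b`. -/
noncomputable def contract (L : V →L[ℝ] V →L[ℝ] E) : V ⊗[ℝ] V →ₗ[ℝ] E :=
  TensorProduct.lift ((ContinuousLinearMap.coeLM ℝ).comp (L : V →ₗ[ℝ] V →L[ℝ] E))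

/-- The "germ" `W δX + W' 𝕏²` of the integral `∫ W dX`. -/
noncomputable def germ (X : ℝ → V) (XX : ℝ → ℝ → V ⊗[ℝ] V) (W : ℝ → V →L[ℝ] E)
    (W' : ℝ → V →L[ℝ] V →L[ℝ] E) (s t : ℝ) : E :=
  W s (incr X s t) + contract (W' s) (XX s t)

/-- The integral `∫_s^t W dX := [W δX + W' 𝕏² - Λ N (W δX + W' 𝕏²)]_{st}` of a path `W`
(with values in `E ⊗ V*`) weakly controlled by `X`, based on `(X, 𝕏²)`. -/
noncomputable def roughIntegral (J : Set ℝ) (X : ℝ → V) (XX : ℝ → ℝ → V ⊗[ℝ] V)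
    (W : ℝ → V →L[ℝ] E) (W' : ℝ → V →L[ℝ] V →L[ℝ] E) (s t : ℝ) : E :=
  germ X XX W W' s t - sewing J (opN (germ X XX W W')) s t

/-! ### Vector fields and the differential equation -/

/-- `φ ∈ C^{2,δ}(V, E)`: bounded, twice continuously differentiable, with bounded derivatives and
`δ`-Hölder second derivative. -/
def IsC2Holder (δ : ℝ) (φ : V → E) : Prop :=
  ContDiff ℝ 2 φ ∧
  (∃ C, ∀ x, ‖φ x‖ ≤ C) ∧ (∃ C, ∀ x, ‖fderiv ℝ φ x‖ ≤ C) ∧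
  (∃ C, ∀ x, ‖fderiv ℝ (fderiv ℝ φ) x‖ ≤ C) ∧
  ∃ C, ∀ x y, ‖fderiv ℝ (fderiv ℝ φ) x - fderiv ℝ (fderiv ℝ φ) y‖ ≤ C * ‖x - y‖ ^ δ

/-- `‖φ‖_{2,δ} = ‖φ‖_∞ + ‖∂φ‖_∞ + ‖∂²φ‖_∞ + ‖∂²φ‖_δ`. -/
noncomputable def c2HolderNorm (δ : ℝ) (φ : V → E) : ℝ :=
  (⨆ x, ‖φ x‖) + (⨆ x, ‖fderiv ℝ φ x‖) + (⨆ x, ‖fderiv ℝ (fderiv ℝ φ) x‖)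
    + ⨆ p : V × V,
        ‖fderiv ℝ (fderiv ℝ φ) p.1 - fderiv ℝ (fderiv ℝ φ) p.2‖ / ‖p.1 - p.2‖ ^ δ

/-- `(Y, Y') ∈ 𝒟_X^{γ,2γ}(J, V)` solves `dY = φ(Y) dX`, `Y_{t₀} = y`, based on `(X, 𝕏²)`:
it is a fixed point, as a controlled path, of
`(Y, Y') ↦ (y + ∫_{t₀}^· φ(Y) dX, φ(Y))`, where `φ(Y)` has derivative `∂φ(Y) Y'`. -/
def IsSolution (γ : ℝ) (J : Set ℝ) (t₀ : ℝ) (y : V) (φ : V → V →L[ℝ] V)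
    (X : ℝ → V) (XX : ℝ → ℝ → V ⊗[ℝ] V) (Y : ℝ → V) (Y' : ℝ → V →L[ℝ] V) : Prop :=
  IsControlled γ (2 * γ) J X Y Y' ∧
  (∀ t ∈ J, Y' t = φ (Y t)) ∧
  ∀ t ∈ J, Y t = y +
    roughIntegral J X XX (fun r => φ (Y r)) (fun r => (fderiv ℝ φ (Y r)).comp (Y' r)) t₀ t

end Controlled

end Rough

/-!
Write `G s t y = φ(y) δX_{st} + (∂φ · φ)(y) 𝕏²_{st}` for the second order Euler step (`eulerStep`).
A solution is the same thing as a path `Y` with `Y_{t₀} = y` and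
`δY_{st} = G s t Y_s + O(|t - s| ^ z)` for some `z > 1` (`IsSolution.exists_bound`,
`isSolution_of_bound`). All arguments deal with this description. Chen's relation gives an explicit
formula (`stepDefect`) for the failure of Euler steps to compose; it is of order `3γ > 1`.

*Existence.* The Euler scheme on a uniform grid is, uniformly in the grid, within `O(|t - s| ^ 3γ)`
of a single step (`norm_euler_sub_le`, a discrete sewing lemma). Since `V` is finite-dimensional, the
schemes converge pointwise along an ultrafilter, and the bound passes to the limit. This is carried
out for abstract almost flows (`IsAlmostFlow.exists_path`), because the same theorem with steps that
do not depend on the point is the sewing lemma (`exists_isSewing`). The latter is needed to know that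
the map `Λ` is applied to something in its domain for an arbitrary solution.

*Stability.* Let `Y`, `Y₁` be two solutions and `E` the difference of the errors `δY - G`. As `∂²φ` is
only `δ`-Hölder, the two defects differ by a quantity of order `(2 + δ) γ` instead of `3γ`, but
linearly in the distance of the solutions and of the data (`norm_stepDefect_sub_le`); the symmetry of
`∂²φ` enters in `C2Bound.taylor_sub_taylor_le`. Since `(2 + δ) γ > 1`, the sewing estimate
`norm_le_of_midpoint` bounds `E` by `|t - s| ^ ((2 + δ) γ)`. On an interval of length `h` this is
`h ^ (δγ)` times a quantity of order `2γ`, so for small `h`, depending on the norms of the two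
solutions only, the distance of the solutions on the interval is absorbed
(`SolutionPair.pairBound_local`). Chaining finitely many intervals gives the estimate on `[a, b]`
(`exists_pairBound`), and for equal data uniqueness.
-/

open Filter Topology

namespace Rough

/-! ### Almost flows and the Euler scheme -/

section Sewing
variable {E : Type*} [NormedAddCommGroup E]

/-- The estimate behind the sewing lemma. A process which is superlinearly small in some way (the
exponents `z₁`, `z₂`), and is additive at midpoints up to `C |t - s| ^ z` with `z > 1`, is bounded
by `|t - s| ^ z` with a constant depending on `C` and `z` only. -/
theorem norm_le_of_midpoint {I : Set ℝ} (hI : Convex ℝ I) {D : ℝ → ℝ → E}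
    {C C₁ C₂ z z₁ z₂ : ℝ} (hz : 1 < z) (hz₁ : 1 < z₁) (hz₂ : 1 < z₂)
    (hD : ∀ s ∈ I, ∀ t ∈ I, ‖D s t‖ ≤ C₁ * |t - s| ^ z₁ + C₂ * |t - s| ^ z₂)
    (hN : ∀ s ∈ I, ∀ t ∈ I,
      ‖D s t‖ ≤ ‖D s ((s + t) / 2)‖ + ‖D ((s + t) / 2) t‖ + C * |t - s| ^ z) :
    ∀ s ∈ I, ∀ t ∈ I, ‖D s t‖ ≤ C / (1 - 2 ^ (1 - z)) * |t - s| ^ z := by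
  have hq : (2 : ℝ) ^ (1 - z) < 1 := Real.rpow_lt_one_of_one_lt_of_neg (by norm_num) (by linarith)
  set q : ℝ := (2 : ℝ) ^ (1 - z) with hq_def
  set C' := C / (1 - q) with hC'
  have hC'q : C' * q + C = C' := by
    rw [hC']; field_simp [show (1 - q) ≠ 0 by linarith]; ring
  have half : ∀ (x w : ℝ), 0 ≤ x → 2 * (x / 2) ^ w = 2 ^ (1 - w) * x ^ w := by
    intro x w hx
    rw [Real.div_rpow hx (by norm_num), Real.rpow_sub (by norm_num), Real.rpow_one]
    ring
  -- After `n` bisections the a priori bound enters with the factors `2 ^ (1 - zᵢ)` to the power `n`;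
  -- the term `C' q ^ n` makes the induction an identity.
  have key : ∀ n : ℕ, ∀ s ∈ I, ∀ t ∈ I, ‖D s t‖ ≤ C' * |t - s| ^ z
      + (((2 : ℝ) ^ (1 - z₁)) ^ n * (C₁ * |t - s| ^ z₁)
      + ((2 : ℝ) ^ (1 - z₂)) ^ n * (C₂ * |t - s| ^ z₂) - C' * q ^ n * |t - s| ^ z) := by
    intro n
    induction n with
    | zero =>
      intro s hs t ht
      simpa using hD s hs t ht
    | succ n ih =>
      intro s hs t ht
      have hu : (s + t) / 2 ∈ I := by
        have := hI hs ht (a := 1 / 2) (b := 1 / 2) (by norm_num) (by norm_num) (by norm_num)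
        simpa [smul_eq_mul, add_div, div_eq_inv_mul, mul_add] using this
      have e1 : |(s + t) / 2 - s| = |t - s| / 2 := by
        rw [show (s + t) / 2 - s = (t - s) / 2 by ring, abs_div]; norm_num
      have e2 : |t - (s + t) / 2| = |t - s| / 2 := by
        rw [show t - (s + t) / 2 = (t - s) / 2 by ring, abs_div]; norm_num
      have h1 := ih s hs _ hu
      have h2 := ih _ hu t ht
      rw [e1] at h1
      rw [e2] at h2
      have h3 := hN s hs t ht
      have a0 := half |t - s| z (abs_nonneg _)
      have a1 := half |t - s| z₁ (abs_nonneg _)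
      have a2 := half |t - s| z₂ (abs_nonneg _)
      rw [← hq_def] at a0
      set x0 := (|t - s| / 2) ^ z
      set x1 := (|t - s| / 2) ^ z₁
      set x2 := (|t - s| / 2) ^ z₂
      set w0 := |t - s| ^ z
      calc ‖D s t‖ ≤ _ := h3.trans (add_le_add_left (add_le_add h1 h2) _)
        _ = C' * (2 * x0) + (((2 : ℝ) ^ (1 - z₁)) ^ n * (C₁ * (2 * x1))
            + ((2 : ℝ) ^ (1 - z₂)) ^ n * (C₂ * (2 * x2)) - C' * q ^ n * (2 * x0)) + C * w0 := by
          ring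
        _ = _ := by
          rw [a0, a1, a2]
          have : C = C' - C' * q := by linarith
          rw [this]; ring
  intro s hs t ht
  have lim : ∀ w : ℝ, 1 < w → Tendsto (fun n : ℕ => ((2 : ℝ) ^ (1 - w)) ^ n) atTop (𝓝 0) := by
    intro w hw
    exact tendsto_pow_atTop_nhds_zero_of_lt_one (by positivity)
      (Real.rpow_lt_one_of_one_lt_of_neg (by norm_num) (by linarith))
  have L := ((((lim z₁ hz₁).mul_const (C₁ * |t - s| ^ z₁)).add
    ((lim z₂ hz₂).mul_const (C₂ * |t - s| ^ z₂))).sub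
    (((lim z hz).const_mul C').mul_const (|t - s| ^ z))).const_add (C' * |t - s| ^ z)
  have := ge_of_tendsto' L (fun n => key n s hs t ht)
  simpa using this

end Sewing

section Flow
variable {V : Type*} [NormedAddCommGroup V]

/-- One-step maps `y ↦ y + G s t y`, for times `s, t ∈ J` in any order, which compose up to an error
of order `z`. The error is bounded by `C₁ l ^ z` even if the intermediate point `y'` differs by
`K l ^ z` from the one given by the first step, and `C₁` may be much smaller than `K`. -/
structure IsAlmostFlow (J : Set ℝ) (γ z h C₀ C₁ K : ℝ) (G : ℝ → ℝ → V → V) : Prop where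
  continuousOn : ContinuousOn (fun p : ℝ × ℝ × V => G p.1 p.2.1 p.2.2) (J ×ˢ J ×ˢ univ)
  norm_le : ∀ s ∈ J, ∀ t ∈ J, ∀ y, ‖G s t y‖ ≤ C₀ * |t - s| ^ γ
  defect_le : ∀ s ∈ J, ∀ u ∈ J, ∀ t ∈ J, ∀ l, |u - s| ≤ l → |t - u| ≤ l → l ≤ h → ∀ y y',
    ‖y' - y - G s u y‖ ≤ K * l ^ z → ‖G s u y + G u t y' - G s t y‖ ≤ C₁ * l ^ z

theorem IsAlmostFlow.mono {J J' : Set ℝ} {γ z h C₀ C₁ K : ℝ} {G : ℝ → ℝ → V → V}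
    (hG : IsAlmostFlow J γ z h C₀ C₁ K G) (hJ : J' ⊆ J) : IsAlmostFlow J' γ z h C₀ C₁ K G where
  continuousOn := hG.continuousOn.mono (by gcongr)
  norm_le s hs t ht := hG.norm_le s (hJ hs) t (hJ ht)
  defect_le s hs u hu t ht := hG.defect_le s (hJ hs) u (hJ hu) t (hJ ht)

theorem IsAlmostFlow.reverse {J J' : Set ℝ} {γ z h C₀ C₁ K : ℝ} {G : ℝ → ℝ → V → V}
    (hG : IsAlmostFlow J γ z h C₀ C₁ K G) (hJ : ∀ s ∈ J', -s ∈ J) :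
    IsAlmostFlow J' γ z h C₀ C₁ K (fun s t => G (-s) (-t)) where
  continuousOn := hG.continuousOn.comp
    (f := fun p : ℝ × ℝ × V => (-p.1, -p.2.1, p.2.2)) (by fun_prop)
    (fun p hp => ⟨hJ _ hp.1, hJ _ hp.2.1, trivial⟩)
  norm_le s hs t ht y := by
    have := hG.norm_le _ (hJ s hs) _ (hJ t ht) y
    rwa [show -t - -s = -(t - s) by ring, abs_neg] at this
  defect_le s hs u hu t ht l h1 h2 := by
    refine hG.defect_le _ (hJ s hs) _ (hJ u hu) _ (hJ t ht) l ?_ ?_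
    · rwa [show -u - -s = -(u - s) by ring, abs_neg]
    · rwa [show -t - -u = -(t - u) by ring, abs_neg]

theorem IsAlmostFlow.self_eq_zero {J : Set ℝ} {γ z h C₀ C₁ K : ℝ} {G : ℝ → ℝ → V → V}
    (hG : IsAlmostFlow J γ z h C₀ C₁ K G) (hγ : 0 < γ) {s : ℝ} (hs : s ∈ J) (y : V) :
    G s s y = 0 := by
  have := hG.norm_le s hs s hs y
  simpa [Real.zero_rpow hγ.ne'] using this

/-- The explicit Euler scheme with step `τ`. -/
def euler (G : ℝ → ℝ → V → V) (a τ : ℝ) (y : V) : ℕ → V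
  | 0 => y
  | i + 1 => euler G a τ y i + G (a + i * τ) (a + (i + 1 : ℕ) * τ) (euler G a τ y i)

/-- The discrete sewing lemma: the Euler scheme stays close to a single step of `G` over any number
`m` of grid steps, uniformly in the grid. -/
theorem norm_euler_sub_le {a τ : ℝ} {n : ℕ} {J : Set ℝ} {γ z h C₀ C₁ K : ℝ} {G : ℝ → ℝ → V → V}
    (hG : IsAlmostFlow J γ z h C₀ C₁ (2 * K) G) (hγ : 0 < γ) (hz : 1 < z) (hC₁ : 0 ≤ C₁)
    (hK : 2 * C₁ ≤ (1 - 2 ^ (1 - z)) * K) (hτ : 0 ≤ τ)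
    (hJ : ∀ i ≤ n, a + (i : ℕ) * τ ∈ J) (y : V) :
    ∀ m i : ℕ, i + m ≤ n → m * τ ≤ h →
      ‖euler G a τ y (i + m) - euler G a τ y i
        - G (a + i * τ) (a + (i + m : ℕ) * τ) (euler G a τ y i)‖ ≤ K * (m * τ) ^ z := by
  have hq : (2 : ℝ) ^ (1 - z) < 1 := Real.rpow_lt_one_of_one_lt_of_neg (by norm_num) (by linarith)
  have hK0 : 0 ≤ K := by
    by_contra hneg
    have : (1 - (2 : ℝ) ^ (1 - z)) * K < 0 := mul_neg_of_pos_of_neg (by linarith) (by linarith)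
    linarith
  set Y := euler G a τ y with hY
  intro m
  induction m using Nat.strong_induction_on with
  | _ m ih =>
    intro i hi hm
    rcases Nat.lt_or_ge m 2 with hm2 | hm2
    · have h0 : ‖Y (i + m) - Y i - G (a + i * τ) (a + (i + m : ℕ) * τ) (Y i)‖ = 0 := by
        interval_cases m
        · simpa using hG.self_eq_zero hγ (hJ i hi) _
        · simp [hY, euler]
      rw [h0]
      positivity
    -- Split `m` grid steps into `k`, one, and `k'` steps with `k, k' ≤ m / 2`: the single step
    -- contributes nothing, and two defects arise.
    · obtain ⟨k, hk⟩ : ∃ k, k = m / 2 := ⟨_, rfl⟩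
      obtain ⟨k', hk'⟩ : ∃ k', k' + k + 1 = m := ⟨m - k - 1, by omega⟩
      have hkm : (k : ℝ) ≤ m / 2 := by
        rw [le_div_iff₀ (by norm_num)]; exact_mod_cast (by omega : k * 2 ≤ m)
      have hkm' : (k' : ℝ) ≤ m / 2 := by
        rw [le_div_iff₀ (by norm_num)]; exact_mod_cast (by omega : k' * 2 ≤ m)
      have hmτ : (0 : ℝ) ≤ m * τ := by positivity
      have hpiece : ∀ p : ℕ, (p : ℝ) ≤ m / 2 → ((p : ℝ) * τ) ^ z ≤ 2 ^ (1 - z) / 2 * (m * τ) ^ z := by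
        intro p hp
        have : (p : ℝ) * τ ≤ m * τ / 2 := by
          rw [mul_div_right_comm]; gcongr
        calc ((p : ℝ) * τ) ^ z ≤ (m * τ / 2) ^ z := by
              gcongr
          _ = _ := by
              rw [Real.div_rpow hmτ (by norm_num), Real.rpow_sub (by norm_num), Real.rpow_one]
              ring
      have hsub : ∀ p : ℕ, (p : ℝ) ≤ m / 2 → (p : ℝ) * τ ≤ h := by
        intro p hp
        refine le_trans (mul_le_mul_of_nonneg_right ?_ hτ) hm
        linarith [(Nat.cast_nonneg m : (0 : ℝ) ≤ m)]
      have hle : ∀ p : ℕ, (p : ℝ) ≤ m / 2 → ((p : ℝ) * τ) ^ z ≤ (m * τ) ^ z := by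
        intro p hp
        refine Real.rpow_le_rpow (by positivity) (mul_le_mul_of_nonneg_right ?_ hτ) (by linarith)
        linarith [(Nat.cast_nonneg m : (0 : ℝ) ≤ m)]
      have I1 := ih k (by omega) i (by omega) (hsub k hkm)
      have I2 := ih k' (by omega) (i + k + 1) (by omega) (hsub k' hkm')
      have absr : ∀ p q r : ℕ, r = p + q → q ≤ m →
          |(a + (r : ℝ) * τ) - (a + (p : ℝ) * τ)| ≤ m * τ := by
        intro p q r hr hq'
        rw [hr]; push_cast
        rw [show a + ((p : ℝ) + q) * τ - (a + p * τ) = q * τ by ring,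
          abs_of_nonneg (by positivity)]
        gcongr
      have D1 := hG.defect_le (a + i * τ) (hJ i (by omega)) (a + (i + k : ℕ) * τ)
        (hJ _ (by omega)) (a + (i + m : ℕ) * τ) (hJ _ (by omega)) (m * τ)
        (absr _ k _ rfl (by omega)) (absr _ (m - k) _ (by omega) (by omega)) hm (Y i) (Y (i + k))
        (I1.trans (by
          have := hle k hkm
          have h1 : K * ((k : ℝ) * τ) ^ z ≤ K * (m * τ) ^ z := by gcongr
          have h2 : 0 ≤ K * (m * τ) ^ z := by positivity
          linarith))
      have e1 : Y (i + k + 1) - Y (i + k) - G (a + (i + k : ℕ) * τ) (a + (i + k + 1 : ℕ) * τ)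
          (Y (i + k)) = 0 := by simp [hY, euler]
      have D2 := hG.defect_le (a + (i + k : ℕ) * τ) (hJ _ (by omega)) (a + (i + k + 1 : ℕ) * τ)
        (hJ _ (by omega)) (a + (i + m : ℕ) * τ) (hJ _ (by omega)) (m * τ)
        (absr _ 1 _ rfl (by omega)) (absr _ k' _ (by omega) (by omega)) hm
        (Y (i + k)) (Y (i + k + 1))
        (by rw [e1, norm_zero]; positivity)
      rw [show i + k + 1 + k' = i + m by omega] at I2
      have split : Y (i + m) - Y i - G (a + i * τ) (a + (i + m : ℕ) * τ) (Y i)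
          = (Y (i + k) - Y i - G (a + i * τ) (a + (i + k : ℕ) * τ) (Y i))
          + (Y (i + m) - Y (i + k + 1)
              - G (a + (i + k + 1 : ℕ) * τ) (a + (i + m : ℕ) * τ) (Y (i + k + 1)))
          + (G (a + i * τ) (a + (i + k : ℕ) * τ) (Y i)
              + G (a + (i + k : ℕ) * τ) (a + (i + m : ℕ) * τ) (Y (i + k))
              - G (a + i * τ) (a + (i + m : ℕ) * τ) (Y i))
          + (G (a + (i + k : ℕ) * τ) (a + (i + k + 1 : ℕ) * τ) (Y (i + k))
              + G (a + (i + k + 1 : ℕ) * τ) (a + (i + m : ℕ) * τ) (Y (i + k + 1))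
              - G (a + (i + k : ℕ) * τ) (a + (i + m : ℕ) * τ) (Y (i + k)))
          + (Y (i + k + 1) - Y (i + k) - G (a + (i + k : ℕ) * τ) (a + (i + k + 1 : ℕ) * τ)
          (Y (i + k))) := by abel
      rw [split, e1, add_zero]
      refine (norm_add₄_le).trans ?_
      have J1 : K * ((k : ℝ) * τ) ^ z ≤ K * (2 ^ (1 - z) / 2 * (m * τ) ^ z) := by
        gcongr; exact hpiece k hkm
      have J2 : K * ((k' : ℝ) * τ) ^ z ≤ K * (2 ^ (1 - z) / 2 * (m * τ) ^ z) := by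
        gcongr; exact hpiece k' hkm'
      have J3 := mul_le_mul_of_nonneg_right hK (by positivity : (0 : ℝ) ≤ (m * τ) ^ z)
      linarith

end Flow

section Flow
variable {V : Type*} [NormedAddCommGroup V]

/-- Points of the Euler scheme stay in a ball whose radius does not depend on the step. -/
theorem norm_euler_sub_initial_le {a τ : ℝ} {n : ℕ} {J : Set ℝ} {γ z h C₀ C₁ K : ℝ}
    {G : ℝ → ℝ → V → V}
    (hG : IsAlmostFlow J γ z h C₀ C₁ (2 * K) G) (hγ : 0 < γ) (hz : 1 < z) (hC₀ : 0 ≤ C₀)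
    (hC₁ : 0 ≤ C₁)
    (hK0 : 0 ≤ K) (hK : 2 * C₁ ≤ (1 - 2 ^ (1 - z)) * K) (hτ : 0 < τ) (hτh : τ ≤ h / 2)
    (hJ : ∀ i ≤ n, a + (i : ℕ) * τ ∈ J) (y : V) :
    ∀ p j : ℕ, j ≤ n → j * τ ≤ p * (h / 2) →
      ‖euler G a τ y j - y‖ ≤ p * (C₀ * h ^ γ + K * h ^ z) := by
  set B := C₀ * h ^ γ + K * h ^ z with hB
  have hh : 0 < h := by linarith
  have hB0 : 0 ≤ B := by positivity
  have step : ∀ m i : ℕ, i + m ≤ n → m * τ ≤ h → ‖euler G a τ y (i + m) - euler G a τ y i‖ ≤ B := by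
    intro m i hi hm
    have h1 := norm_euler_sub_le hG hγ hz hC₁ hK hτ.le hJ y m i hi hm
    have h2 := hG.norm_le (a + i * τ) (hJ i (by omega)) (a + (i + m : ℕ) * τ) (hJ _ hi)
      (euler G a τ y i)
    have h3 : |a + (i + m : ℕ) * τ - (a + i * τ)| = m * τ := by
      push_cast
      rw [show a + ((i : ℝ) + m) * τ - (a + i * τ) = m * τ by ring, abs_of_nonneg (by positivity)]
    rw [h3] at h2
    have h4 : C₀ * (m * τ) ^ γ ≤ C₀ * h ^ γ := by gcongr
    have h5 : K * (m * τ) ^ z ≤ K * h ^ z := by gcongr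
    have h6 := norm_add_le (euler G a τ y (i + m) - euler G a τ y i
        - G (a + i * τ) (a + (i + m : ℕ) * τ) (euler G a τ y i))
        (G (a + i * τ) (a + (i + m : ℕ) * τ) (euler G a τ y i))
    rw [sub_add_cancel] at h6
    linarith
  intro p
  induction p with
  | zero =>
    intro j hj hjp
    have : j = 0 := by
      by_contra h0
      have : (0 : ℝ) < j := by exact_mod_cast Nat.pos_of_ne_zero h0
      have : 0 < j * τ := by positivity
      simp at hjp
      linarith
    simp [this, euler]
  | succ p ih =>
    intro j hj hjp
    set q := ⌊h / τ⌋₊ with hq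
    have hq1 : q * τ ≤ h := by
      rw [← le_div_iff₀ hτ]; exact Nat.floor_le (by positivity)
    have hq2 : h < (q + 1) * τ := by
      rw [← div_lt_iff₀ hτ]; exact Nat.lt_floor_add_one _
    rcases le_or_gt j q with hjq | hjq
    · have := step j 0 (by omega) (le_trans (by gcongr) hq1)
      simp only [zero_add] at this
      refine this.trans ?_
      push_cast
      have : 0 ≤ (p : ℝ) * B := by positivity
      linarith
    · obtain ⟨i, rfl⟩ : ∃ i, j = i + q := ⟨j - q, by omega⟩
      have h1 := step q i hj hq1
      have h2 := ih i (by omega) (by push_cast at hjp; linarith)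
      have h3 := norm_add_le (euler G a τ y (i + q) - euler G a τ y i) (euler G a τ y i - y)
      rw [sub_add_sub_cancel] at h3
      push_cast
      linarith

variable [ProperSpace V]

/-- The Euler scheme converges, along an ultrafilter of grids, to a path whose increments are given
by `G` up to an error of order `z`. -/
theorem IsAlmostFlow.exists_forward {a b : ℝ} {γ z h C₀ C₁ K : ℝ}
    {G : ℝ → ℝ → V → V}
    (hG : IsAlmostFlow (Icc a b) γ z h C₀ C₁ (2 * K) G) (hγ : 0 < γ) (hz : 1 < z) (hh : 0 < h)
    (hC₀ : 0 ≤ C₀) (hC₁ : 0 ≤ C₁) (hK0 : 0 ≤ K) (hK : 2 * C₁ ≤ (1 - 2 ^ (1 - z)) * K) (y : V) :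
    ∃ Y : ℝ → V, Y a = y ∧ ∀ s ∈ Icc a b, ∀ t ∈ Icc a b, s ≤ t → t - s < h →
      ‖Y t - Y s - G s t (Y s)‖ ≤ K * (t - s) ^ z := by
  rcases le_or_gt b a with hab | hab
  · refine ⟨fun _ => y, rfl, fun s hs t ht hst _ => ?_⟩
    obtain rfl : s = t := by linarith [hs.1, hs.2, ht.1, ht.2]
    simp [hG.self_eq_zero hγ hs, Real.zero_rpow (by linarith : z ≠ 0)]
  set τ : ℕ → ℝ := fun n => (b - a) / (n + 1) with hτ
  have hτ0 : ∀ n, 0 < τ n := fun n => by have : 0 < b - a := by linarith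
                                         positivity
  have hτlim : Tendsto τ atTop (𝓝 0) := by
    have := (tendsto_one_div_add_atTop_nhds_zero_nat (𝕜 := ℝ)).const_mul (b - a)
    simpa [hτ, div_eq_mul_inv] using this
  set k : ℕ → ℝ → ℕ := fun n t => ⌊(t - a) / τ n⌋₊ with hk
  set T : ℕ → ℝ → ℝ := fun n t => a + k n t * τ n with hT
  have hgrid : ∀ n, ∀ i ≤ n + 1, a + (i : ℕ) * τ n ∈ Icc a b := by
    intro n i hi
    have h1 : (0 : ℝ) ≤ i * τ n := mul_nonneg (by positivity) (hτ0 n).le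
    have h2 : (i : ℝ) * τ n ≤ (n + 1) * τ n :=
      mul_le_mul_of_nonneg_right (by exact_mod_cast hi) (hτ0 n).le
    have h3 : ((n : ℝ) + 1) * τ n = b - a := by simp only [hτ]; field_simp
    exact ⟨by linarith, by linarith⟩
  have hkn : ∀ n, ∀ t ∈ Icc a b, k n t ≤ n + 1 := by
    intro n t ht
    refine Nat.floor_le_of_le ?_
    rw [div_le_iff₀ (hτ0 n)]
    have h3 : ((n : ℝ) + 1) * τ n = b - a := by simp only [hτ]; field_simp
    push_cast
    linarith [ht.2]
  have hT1 : ∀ n, ∀ t ∈ Icc a b, T n t ∈ Icc a b := fun n t ht => hgrid n _ (hkn n t ht)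
  have hTle : ∀ n, ∀ t ∈ Icc a b, T n t ≤ t := by
    intro n t ht
    have : k n t * τ n ≤ t - a := by
      rw [← le_div_iff₀ (hτ0 n)]
      exact Nat.floor_le (div_nonneg (by linarith [ht.1]) (hτ0 n).le)
    simp only [hT]; linarith
  have hTge : ∀ n, ∀ t ∈ Icc a b, t - τ n ≤ T n t := by
    intro n t ht
    have : t - a < (k n t + 1) * τ n := by
      rw [← div_lt_iff₀ (hτ0 n)]
      exact Nat.lt_floor_add_one _
    simp only [hT]; linarith
  have hTlim : ∀ t ∈ Icc a b, Tendsto (fun n => T n t) atTop (𝓝 t) := by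
    intro t ht
    refine tendsto_of_tendsto_of_tendsto_of_le_of_le (g := fun n => t - τ n) ?_
      tendsto_const_nhds (fun n => hTge n t ht) (fun n => hTle n t ht)
    simpa using hτlim.const_sub t
  set Z : ℕ → ℝ → V := fun n t => euler G a (τ n) y (k n t) with hZ
  obtain ⟨p, hp⟩ : ∃ p : ℕ, b - a ≤ p * (h / 2) := by
    obtain ⟨p, hp⟩ := exists_nat_ge ((b - a) / (h / 2))
    exact ⟨p, by rwa [div_le_iff₀ (by linarith)] at hp⟩
  set R := p * (C₀ * h ^ γ + K * h ^ z) with hR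
  have hbdd : ∀ t ∈ Icc a b, ∀ᶠ n in atTop, Z n t ∈ Metric.closedBall y R := by
    intro t ht
    filter_upwards [hτlim.eventually (ge_mem_nhds (by linarith : 0 < h / 2))] with n hn
    rw [mem_closedBall_iff_norm]
    refine norm_euler_sub_initial_le hG hγ hz hC₀ hC₁ hK0 hK (hτ0 n) hn (hgrid n) y p _
      (hkn n t ht) ?_
    have := (hT1 n t ht).2
    simp only [hT] at this
    linarith
  -- A pointwise limit along an ultrafilter replaces the extraction of a subsequence.
  have hlim : ∀ t : ℝ, ∃ x : V, t ∈ Icc a b → Tendsto (fun n => Z n t) (hyperfilter ℕ) (𝓝 x) := by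
    intro t
    by_cases ht : t ∈ Icc a b
    · have h1 : ((hyperfilter ℕ).map fun n => Z n t : Ultrafilter V) ≤
          𝓟 (Metric.closedBall y R) := by
        rw [le_principal_iff]
        exact Nat.hyperfilter_le_atTop (hbdd t ht)
      obtain ⟨x, -, hx⟩ := (isCompact_closedBall y R).ultrafilter_le_nhds _ h1
      exact ⟨x, fun _ => hx⟩
    · exact ⟨y, fun h => absurd h ht⟩
  choose Y hY using hlim
  refine ⟨Y, ?_, ?_⟩
  · have h1 := hY a ⟨le_rfl, hab.le⟩
    have h2 : ∀ n, Z n a = y := fun n => by simp [hZ, hk, euler]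
    simp only [h2] at h1
    exact tendsto_nhds_unique h1 tendsto_const_nhds
  · intro s hs t ht hst hsth
    have lims := (hTlim s hs).mono_left Nat.hyperfilter_le_atTop
    have limt := (hTlim t ht).mono_left Nat.hyperfilter_le_atTop
    have limG : Tendsto (fun n => G (T n s) (T n t) (Z n s)) (hyperfilter ℕ)
        (𝓝 (G s t (Y s))) := by
      have hc := hG.continuousOn (s, t, Y s) ⟨hs, ht, trivial⟩
      refine Tendsto.comp (f := fun n => (T n s, T n t, Z n s)) hc ?_
      refine tendsto_nhdsWithin_iff.2 ⟨?_, Eventually.of_forall fun n =>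
        ⟨hT1 n s hs, hT1 n t ht, trivial⟩⟩
      exact lims.prodMk_nhds (limt.prodMk_nhds (hY s hs))
    have limL := (((hY t ht).sub (hY s hs)).sub limG).norm
    have limR : Tendsto (fun n => K * (T n t - T n s) ^ z) (hyperfilter ℕ)
        (𝓝 (K * (t - s) ^ z)) :=
      ((limt.sub lims).rpow_const (Or.inr (by linarith))).const_mul K
    refine le_of_tendsto_of_tendsto limL limR ?_
    filter_upwards [(limt.sub lims).eventually (gt_mem_nhds hsth)] with n hn
    have hkk : k n s ≤ k n t := by
      refine Nat.floor_le_floor ?_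
      exact div_le_div_of_nonneg_right (by linarith) (hτ0 n).le
    obtain ⟨m, hm⟩ := Nat.exists_eq_add_of_le hkk
    have e : T n t - T n s = m * τ n := by simp only [hT, hm]; push_cast; ring
    have := norm_euler_sub_le hG hγ hz hC₁ hK (hτ0 n).le (hgrid n) y m (k n s)
      (by rw [← hm]; exact hkn n t ht) (by rw [← e]; exact hn.le)
    rw [← hm, ← e] at this
    exact this

/-- The path of `IsAlmostFlow.exists_forward` on both sides of an initial time, with a bound for
times in any order: solve forward on `[t₀, b]`, forward for the reversed time on `[a, t₀]`, and
compare at `t₀`. -/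
theorem IsAlmostFlow.exists_path {a b t₀ : ℝ} (ht₀ : t₀ ∈ Icc a b) {γ z h C₀ C₁ K : ℝ}
    {G : ℝ → ℝ → V → V}
    (hG : IsAlmostFlow (Icc a b) γ z h C₀ C₁ (2 * K) G) (hγ : 0 < γ) (hz : 1 < z) (hh : 0 < h)
    (hC₀ : 0 ≤ C₀) (hC₁ : 0 ≤ C₁) (hK0 : 0 ≤ K) (hK : 2 * C₁ ≤ (1 - 2 ^ (1 - z)) * K) (y : V) :
    ∃ Y : ℝ → V, Y t₀ = y ∧ ∀ s ∈ Icc a b, ∀ t ∈ Icc a b, |t - s| < h →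
      ‖Y t - Y s - G s t (Y s)‖ ≤ 5 * K * |t - s| ^ z := by
  have hCK : C₁ ≤ K := by
    have : (1 - (2 : ℝ) ^ (1 - z)) * K ≤ 1 * K := by
      gcongr
      linarith [Real.rpow_nonneg (by norm_num : (0 : ℝ) ≤ 2) (1 - z)]
    linarith
  obtain ⟨Yr, hYr0, hYr⟩ := (hG.mono (J' := Icc t₀ b) (Icc_subset_Icc ht₀.1 le_rfl)).exists_forward
    hγ hz hh hC₀ hC₁ hK0 hK y
  obtain ⟨Yl, hYl0, hYl⟩ := (hG.reverse (J' := Icc (-t₀) (-a)) (fun s hs =>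
    ⟨by linarith [hs.2], by linarith [hs.1, ht₀.2]⟩)).exists_forward hγ hz hh hC₀ hC₁ hK0 hK y
  set Y : ℝ → V := fun t => if t₀ ≤ t then Yr t else Yl (-t) with hYdef
  have eqr : ∀ t, t₀ ≤ t → Y t = Yr t := fun t ht => by simp [hYdef, ht]
  have eql : ∀ t, t ≤ t₀ → Y t = Yl (-t) := by
    intro t ht
    rcases ht.eq_or_lt with rfl | h
    · rw [eqr _ le_rfl, hYr0, hYl0]
    · simp [hYdef, not_le.2 h]
  -- Reversing the order of two times costs one defect of the flow.
  have flip : ∀ s ∈ Icc a b, ∀ t ∈ Icc a b, |t - s| < h →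
      ‖Y s - Y t - G t s (Y t)‖ ≤ K * |t - s| ^ z →
      ‖Y t - Y s - G s t (Y s)‖ ≤ 2 * K * |t - s| ^ z := by
    intro s hs t ht hst hD
    have h1 := hG.defect_le t ht s hs t ht |t - s| (by rw [abs_sub_comm]) le_rfl hst.le (Y t) (Y s)
      (hD.trans (by have : 0 ≤ K * |t - s| ^ z := by positivity
                    linarith))
    rw [hG.self_eq_zero hγ ht, sub_zero] at h1
    have e : Y t - Y s - G s t (Y s)
        = -(Y s - Y t - G t s (Y t)) - (G t s (Y t) + G s t (Y s)) := by abel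
    rw [e]
    have h2 := norm_sub_le (-(Y s - Y t - G t s (Y t))) (G t s (Y t) + G s t (Y s))
    rw [norm_neg] at h2
    have h3 : C₁ * |t - s| ^ z ≤ K * |t - s| ^ z := by gcongr
    linarith
  have right : ∀ s ∈ Icc a b, ∀ t ∈ Icc a b, t₀ ≤ s → s ≤ t → |t - s| < h →
      ‖Y t - Y s - G s t (Y s)‖ ≤ K * |t - s| ^ z := by
    intro s hs t ht h0 hst hh'
    rw [eqr t (h0.trans hst), eqr s h0]
    rw [abs_of_nonneg (by linarith)] at hh' ⊢
    exact hYr s ⟨h0, hs.2⟩ t ⟨h0.trans hst, ht.2⟩ hst hh'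
  have left : ∀ s ∈ Icc a b, ∀ t ∈ Icc a b, t ≤ t₀ → s ≤ t → |t - s| < h →
      ‖Y s - Y t - G t s (Y t)‖ ≤ K * |t - s| ^ z := by
    intro s hs t ht h0 hst hh'
    rw [eql t h0, eql s (hst.trans h0)]
    rw [abs_of_nonneg (by linarith)] at hh' ⊢
    have := hYl (-t) ⟨by linarith, by linarith [ht.1]⟩ (-s) ⟨by linarith, by linarith [hs.1]⟩
      (by linarith) (by linarith)
    simpa [neg_neg, add_comm, sub_eq_add_neg] using this
  have forward : ∀ s ∈ Icc a b, ∀ t ∈ Icc a b, s ≤ t → |t - s| < h →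
      ‖Y t - Y s - G s t (Y s)‖ ≤ 4 * K * |t - s| ^ z ∧
      ‖Y s - Y t - G t s (Y t)‖ ≤ 5 * K * |t - s| ^ z := by
    intro s hs t ht hst hsth
    have hP : 0 ≤ K * |t - s| ^ z := by positivity
    have hsth' := hsth
    rw [abs_sub_comm] at hsth'
    rcases le_total t₀ s with h0 | h0
    · have h1 := right s hs t ht h0 hst hsth
      have h2 := flip t ht s hs hsth' (by rwa [abs_sub_comm])
      rw [abs_sub_comm] at h2
      exact ⟨by linarith, by linarith⟩
    rcases le_total t t₀ with h0' | h0'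
    · have h1 := left s hs t ht h0' hst hsth
      have h2 := flip s hs t ht hsth h1
      exact ⟨by linarith, by linarith⟩
    have a1 : |t₀ - s| ≤ |t - s| := by
      rw [abs_of_nonneg (by linarith), abs_of_nonneg (by linarith)]; linarith
    have a2 : |t - t₀| ≤ |t - s| := by
      rw [abs_of_nonneg (by linarith), abs_of_nonneg (by linarith)]; linarith
    have p1 : |t₀ - s| ^ z ≤ |t - s| ^ z := by gcongr
    have p2 : |t - t₀| ^ z ≤ |t - s| ^ z := by gcongr
    have q1 := mul_le_mul_of_nonneg_left p1 hK0
    have q2 := mul_le_mul_of_nonneg_left p2 hK0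
    have l1 := left s hs t₀ ht₀ le_rfl h0 (a1.trans_lt hsth)
    have l2 := flip s hs t₀ ht₀ (a1.trans_lt hsth) l1
    have r1 := right t₀ ht₀ t ht le_rfl h0' (a2.trans_lt hsth)
    have r2 := flip t ht t₀ ht₀ (by rw [abs_sub_comm]; exact a2.trans_lt hsth)
      (by rwa [abs_sub_comm])
    rw [abs_sub_comm t₀ t] at r2
    have d1 := hG.defect_le s hs t₀ ht₀ t ht |t - s| a1 a2 hsth.le (Y s) (Y t₀) (by linarith)
    have d2 := hG.defect_le t ht t₀ ht₀ s hs |t - s| (by rwa [abs_sub_comm])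
      (by rwa [abs_sub_comm]) hsth.le (Y t) (Y t₀) (by linarith)
    have h3 : C₁ * |t - s| ^ z ≤ K * |t - s| ^ z := by gcongr
    constructor
    · have e : Y t - Y s - G s t (Y s) = (Y t₀ - Y s - G s t₀ (Y s)) + (Y t - Y t₀ - G t₀ t (Y t₀))
          + (G s t₀ (Y s) + G t₀ t (Y t₀) - G s t (Y s)) := by abel
      rw [e]
      refine norm_add₃_le.trans ?_
      linarith
    · have e : Y s - Y t - G t s (Y t) = (Y t₀ - Y t - G t t₀ (Y t)) + (Y s - Y t₀ - G t₀ s (Y t₀))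
          + (G t t₀ (Y t) + G t₀ s (Y t₀) - G t s (Y t)) := by abel
      rw [e]
      refine norm_add₃_le.trans ?_
      linarith
  refine ⟨Y, by rw [eqr _ le_rfl, hYr0], fun s hs t ht hst => ?_⟩
  rcases le_total s t with h | h
  · have := (forward s hs t ht h hst).1
    have hP : 0 ≤ K * |t - s| ^ z := by positivity
    linarith
  · have := (forward t ht s hs h (by rwa [abs_sub_comm])).2
    rwa [abs_sub_comm] at this

end Flow

/-! ### Contractions and estimates for `C²` maps -/

section Contract
variable {V : Type*} [NormedAddCommGroup V] [NormedSpace ℝ V]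
variable {E : Type*} [NormedAddCommGroup E] [NormedSpace ℝ E]

theorem contract_tmul (L : V →L[ℝ] V →L[ℝ] E) (v w : V) : contract L (v ⊗ₜ[ℝ] w) = L v w := by
  simp [contract]

theorem contract_add (L M : V →L[ℝ] V →L[ℝ] E) : contract (L + M) = contract L + contract M :=
  TensorProduct.ext' fun v w => by simp [contract_tmul]

theorem contract_smul (c : ℝ) (L : V →L[ℝ] V →L[ℝ] E) : contract (c • L) = c • contract L :=
  TensorProduct.ext' fun v w => by simp [contract_tmul]

theorem contract_sub (L M : V →L[ℝ] V →L[ℝ] E) : contract (L - M) = contract L - contract M :=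
  TensorProduct.ext' fun v w => by simp [contract_tmul]

theorem norm_contract_le [FiniteDimensional ℝ V] (L : V →L[ℝ] V →L[ℝ] E) (z : V ⊗[ℝ] V) :
    ‖contract L z‖ ≤ ‖L‖ * ‖z‖ := by
  have key : ∀ l : List (V × V), TensorNorm.eval l = z →
      ‖contract L z‖ ≤ ‖L‖ * TensorNorm.cost l := by
    rintro l rfl
    refine TensorNorm.norm_lift_le _ (fun a b => ?_) l
    rw [← mul_assoc]
    exact L.le_opNorm₂ a b
  rcases (norm_nonneg L).eq_or_lt with h | h
  · obtain ⟨l, hl⟩ := TensorNorm.exists_eval z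
    have := key l hl
    rw [← h, zero_mul] at this ⊢
    exact this
  · rw [← div_le_iff₀' h]
    refine TensorNorm.le_projNorm fun l hl => ?_
    rw [div_le_iff₀' h]
    exact key l hl

/-- The contraction as a continuous bilinear map. -/
noncomputable def contractL [FiniteDimensional ℝ V] :
    (V →L[ℝ] V →L[ℝ] E) →L[ℝ] V ⊗[ℝ] V →L[ℝ] E :=
  LinearMap.mkContinuous₂
    (LinearMap.mk₂ ℝ (fun (L : V →L[ℝ] V →L[ℝ] E) (z : V ⊗[ℝ] V) => contract L z)
      (fun L M z => by rw [contract_add]; rfl) (fun c L z => by rw [contract_smul]; rfl)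
      (fun L z w => map_add _ z w) (fun c L z => map_smul _ c z)) 1
    (fun L z => by rw [one_mul]; exact norm_contract_le L z)

theorem norm_contract_sub_contract_le [FiniteDimensional ℝ V] (L M : V →L[ℝ] V →L[ℝ] E)
    (z w : V ⊗[ℝ] V) :
    ‖contract L z - contract M w‖ ≤ ‖L - M‖ * ‖z‖ + ‖M‖ * ‖z - w‖ := by
  have e : contract L z - contract M w = contract (L - M) z + contract M (z - w) := by
    rw [contract_sub, map_sub, LinearMap.sub_apply]; abel
  rw [e]
  exact (norm_add_le _ _).trans (add_le_add (norm_contract_le _ _) (norm_contract_le _ _))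

theorem norm_apply_sub_apply_le (L M : V →L[ℝ] E) (v w : V) :
    ‖L v - M w‖ ≤ ‖L - M‖ * ‖v‖ + ‖M‖ * ‖v - w‖ := by
  have e : L v - M w = (L - M) v + M (v - w) := by
    rw [map_sub, sub_apply]; abel
  rw [e]
  exact (norm_add_le _ _).trans
    (add_le_add (ContinuousLinearMap.le_opNorm _ _) (ContinuousLinearMap.le_opNorm _ _))

theorem norm_comp_sub_comp_le {F G : Type*} [NormedAddCommGroup F] [NormedSpace ℝ F]
    [NormedAddCommGroup G] [NormedSpace ℝ G] (P P₁ : F →L[ℝ] G) (p p₁ : E →L[ℝ] F) :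
    ‖P.comp p - P₁.comp p₁‖ ≤ ‖P - P₁‖ * ‖p‖ + ‖P₁‖ * ‖p - p₁‖ := by
  have e : P.comp p - P₁.comp p₁ = (P - P₁).comp p + P₁.comp (p - p₁) := by
    ext; simp
  rw [e]
  exact (norm_add_le _ _).trans (add_le_add (ContinuousLinearMap.opNorm_comp_le _ _)
    (ContinuousLinearMap.opNorm_comp_le _ _))

end Contract

section Fields
variable {V : Type*} [NormedAddCommGroup V] [NormedSpace ℝ V]
variable {E : Type*} [NormedAddCommGroup E] [NormedSpace ℝ E]

/-- `φ` is of class `C²`, and each of the four terms of the norm `‖φ‖_{2,δ}` is at most `L`. -/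
structure C2Bound (δ L : ℝ) (φ : V → E) : Prop where
  contDiff : ContDiff ℝ 2 φ
  norm_le : ∀ x, ‖φ x‖ ≤ L
  norm_fderiv_le : ∀ x, ‖fderiv ℝ φ x‖ ≤ L
  norm_fderiv2_le : ∀ x, ‖fderiv ℝ (fderiv ℝ φ) x‖ ≤ L
  holder_le : ∀ x y, ‖fderiv ℝ (fderiv ℝ φ) x - fderiv ℝ (fderiv ℝ φ) y‖ ≤ L * ‖x - y‖ ^ δ

theorem C2Bound.mono {δ L M : ℝ} {φ : V → E} (h : C2Bound δ L φ) (hLM : L ≤ M) :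
    C2Bound δ M φ where
  contDiff := h.contDiff
  norm_le x := (h.norm_le x).trans hLM
  norm_fderiv_le x := (h.norm_fderiv_le x).trans hLM
  norm_fderiv2_le x := (h.norm_fderiv2_le x).trans hLM
  holder_le x y := (h.holder_le x y).trans (by gcongr)

theorem C2Bound.zero {δ : ℝ} : C2Bound δ 0 fun _ : V => (0 : E) := by
  have h1 : fderiv ℝ (fun _ : V => (0 : E)) = fun _ => 0 :=
    funext fun x => fderiv_const_apply _
  have h2 : fderiv ℝ (fun _ : V => (0 : V →L[ℝ] E)) = fun _ => 0 :=
    funext fun x => fderiv_const_apply _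
  refine ⟨contDiff_const, fun x => norm_zero.le, fun x => ?_, fun x => ?_, fun x z => ?_⟩
  · rw [h1]; exact (norm_zero (E := V →L[ℝ] E)).le
  · rw [h1, h2]; exact (norm_zero (E := V →L[ℝ] V →L[ℝ] E)).le
  · rw [h1, h2, sub_self, zero_mul]; exact (norm_zero (E := V →L[ℝ] V →L[ℝ] E)).le

theorem C2Bound.nonneg {δ L : ℝ} {φ : V → E} (h : C2Bound δ L φ) : 0 ≤ L :=
  (norm_nonneg _).trans (h.norm_le 0)

theorem C2Bound.differentiable {δ L : ℝ} {φ : V → E} (h : C2Bound δ L φ) : Differentiable ℝ φ :=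
  h.contDiff.differentiable (by norm_num)

theorem C2Bound.contDiff_fderiv {δ L : ℝ} {φ : V → E} (h : C2Bound δ L φ) :
    ContDiff ℝ 1 (fderiv ℝ φ) :=
  h.contDiff.fderiv_right (by norm_num)

theorem C2Bound.differentiable_fderiv {δ L : ℝ} {φ : V → E} (h : C2Bound δ L φ) :
    Differentiable ℝ (fderiv ℝ φ) :=
  h.contDiff_fderiv.differentiable (by norm_num)

theorem norm_sub_le_of_fderiv {f : V → E} {L : ℝ} (hf : Differentiable ℝ f)
    (hL : ∀ x, ‖fderiv ℝ f x‖ ≤ L) (x y : V) : ‖f y - f x‖ ≤ L * ‖y - x‖ :=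
  convex_univ.norm_image_sub_le_of_norm_fderiv_le (fun z _ => hf z) (fun z _ => hL z)
    (mem_univ x) (mem_univ y)

theorem C2Bound.sub_le {δ L : ℝ} {φ : V → E} (h : C2Bound δ L φ) (x y : V) :
    ‖φ y - φ x‖ ≤ L * ‖y - x‖ := norm_sub_le_of_fderiv h.differentiable h.norm_fderiv_le x y

theorem C2Bound.fderiv_sub_le {δ L : ℝ} {φ : V → E} (h : C2Bound δ L φ) (x y : V) :
    ‖fderiv ℝ φ y - fderiv ℝ φ x‖ ≤ L * ‖y - x‖ :=
  norm_sub_le_of_fderiv h.differentiable_fderiv h.norm_fderiv2_le x y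

/-- First order Taylor estimate for a function with `α`-Hölder derivative. -/
theorem norm_taylor_le {f : V → E} {L α : ℝ} (hα : 0 ≤ α) (hL0 : 0 ≤ L) (hf : Differentiable ℝ f)
    (hL : ∀ x y, ‖fderiv ℝ f x - fderiv ℝ f y‖ ≤ L * ‖x - y‖ ^ α) (x y : V) :
    ‖f y - f x - fderiv ℝ f x (y - x)‖ ≤ L * ‖y - x‖ ^ α * ‖y - x‖ := by
  refine (convex_segment x y).norm_image_sub_le_of_norm_fderiv_le' (fun z _ => hf z) ?_
    (left_mem_segment ℝ x y) (right_mem_segment ℝ x y)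
  intro z hz
  refine (hL z x).trans ?_
  have : ‖z - x‖ ≤ ‖y - x‖ := by
    rw [segment_eq_image'] at hz
    obtain ⟨θ, hθ, rfl⟩ := hz
    simp only [add_sub_cancel_left, norm_smul]
    rw [Real.norm_of_nonneg hθ.1]
    exact mul_le_of_le_one_left (norm_nonneg _) hθ.2
  gcongr

theorem norm_lineMap_sub_lineMap_le {x x₁ y y₁ : V} {d θ : ℝ} (hd : ‖y - x‖ ≤ d)
    (hd₁ : ‖y₁ - x₁‖ ≤ d) (hθ : θ ∈ Icc (0 : ℝ) 1) :
    ‖AffineMap.lineMap y₁ y θ - AffineMap.lineMap x₁ x θ‖ ≤ d := by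
  have e : (AffineMap.lineMap y₁ y θ : V) - AffineMap.lineMap x₁ x θ
      = (1 - θ) • (y₁ - x₁) + θ • (y - x) := by
    simp only [AffineMap.lineMap_apply_module]; module
  rw [e]
  refine (norm_add_le _ _).trans ?_
  rw [norm_smul, norm_smul, Real.norm_of_nonneg hθ.1, Real.norm_of_nonneg (by linarith [hθ.2])]
  have h1 := mul_le_mul_of_nonneg_left hd hθ.1
  have h2 := mul_le_mul_of_nonneg_left hd₁ (by linarith [hθ.2] : 0 ≤ 1 - θ)
  linarith

/-- Four-point estimate for a function with `α`-Hölder derivative. -/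
theorem norm_four_point_le {f : V → E} {L L' α d : ℝ} (hα : 0 ≤ α) (hL' : 0 ≤ L')
    (hf : Differentiable ℝ f) (hL : ∀ x, ‖fderiv ℝ f x‖ ≤ L)
    (hH : ∀ x y, ‖fderiv ℝ f x - fderiv ℝ f y‖ ≤ L' * ‖x - y‖ ^ α) {x y x₁ y₁ : V}
    (hd : ‖y - x‖ ≤ d) (hd₁ : ‖y₁ - x₁‖ ≤ d) :
    ‖f y - f x - (f y₁ - f x₁)‖ ≤ L' * d ^ α * ‖y - y₁‖ + L * ‖(y - y₁) - (x - x₁)‖ := by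
  have der : ∀ (p p₁ : V) (θ : ℝ), HasDerivAt (fun θ => f (AffineMap.lineMap p₁ p θ))
      (fderiv ℝ f (AffineMap.lineMap p₁ p θ) (p - p₁)) θ := fun p p₁ θ =>
    ((hf _).hasFDerivAt).comp_hasDerivAt θ AffineMap.hasDerivAt_lineMap
  have := norm_image_sub_le_of_norm_deriv_le_segment_01'
    (f := fun θ => f (AffineMap.lineMap y₁ y θ) - f (AffineMap.lineMap x₁ x θ))
    (C := L' * d ^ α * ‖y - y₁‖ + L * ‖(y - y₁) - (x - x₁)‖)
    (fun θ _ => ((der y y₁ θ).sub (der x x₁ θ)).hasDerivWithinAt) ?_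
  · simp only [AffineMap.lineMap_apply_one, AffineMap.lineMap_apply_zero] at this
    exact this
  intro θ hθ
  set p := (AffineMap.lineMap y₁ y θ : V)
  set q := (AffineMap.lineMap x₁ x θ : V)
  have e : fderiv ℝ f p (y - y₁) - fderiv ℝ f q (x - x₁)
      = (fderiv ℝ f p - fderiv ℝ f q) (y - y₁) + fderiv ℝ f q ((y - y₁) - (x - x₁)) := by
    simp only [map_sub, sub_apply]; abel
  have hpq : ‖p - q‖ ≤ d := norm_lineMap_sub_lineMap_le hd hd₁ ⟨hθ.1, hθ.2.le⟩
  rw [e]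
  refine (norm_add_le _ _).trans (add_le_add ?_ ?_)
  · refine (ContinuousLinearMap.le_opNorm _ _).trans ?_
    gcongr
    exact (hH p q).trans (by gcongr)
  · exact (ContinuousLinearMap.le_opNorm _ _).trans (by gcongr; exact hL q)

/-- The first order Taylor remainder depends on the pair of points in a Lipschitz way, with a
constant of order `1 + δ` in the distance of the two points. -/
theorem C2Bound.taylor_sub_taylor_le {φ : V → E} {δ L d : ℝ} (hφ : C2Bound δ L φ) (hδ : 0 ≤ δ)
    {x y x₁ y₁ : V} (hd : ‖y - x‖ ≤ d) (hd₁ : ‖y₁ - x₁‖ ≤ d) :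
    ‖(φ y - φ x - fderiv ℝ φ x (y - x)) - (φ y₁ - φ x₁ - fderiv ℝ φ x₁ (y₁ - x₁))‖
      ≤ L * d ^ δ * d * ‖y - y₁‖ + L * d * ‖(y - y₁) - (x - x₁)‖ := by
  have hL0 := hφ.nonneg
  have hd0 : 0 ≤ d := (norm_nonneg _).trans hd
  have der : ∀ (p p₁ : V) (θ : ℝ), HasDerivAt (fun θ => φ (AffineMap.lineMap p₁ p θ))
      (fderiv ℝ φ (AffineMap.lineMap p₁ p θ) (p - p₁)) θ := fun p p₁ θ =>
    ((hφ.differentiable _).hasFDerivAt).comp_hasDerivAt θ AffineMap.hasDerivAt_lineMap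
  have der2 : ∀ (p p₁ : V) (θ : ℝ), HasDerivAt (fun θ => fderiv ℝ φ (AffineMap.lineMap p₁ p θ))
      (fderiv ℝ (fderiv ℝ φ) (AffineMap.lineMap p₁ p θ) (p - p₁)) θ := fun p p₁ θ =>
    ((hφ.differentiable_fderiv _).hasFDerivAt).comp_hasDerivAt θ AffineMap.hasDerivAt_lineMap
  have derl : ∀ θ : ℝ, HasDerivAt
      (fun θ => (AffineMap.lineMap y₁ y θ : V) - AffineMap.lineMap x₁ x θ)
      ((y - y₁) - (x - x₁)) θ := fun θ =>
    AffineMap.hasDerivAt_lineMap.sub AffineMap.hasDerivAt_lineMap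
  have := norm_image_sub_le_of_norm_deriv_le_segment_01'
    (f := fun θ => φ (AffineMap.lineMap y₁ y θ) - φ (AffineMap.lineMap x₁ x θ)
      - fderiv ℝ φ (AffineMap.lineMap x₁ x θ)
        (AffineMap.lineMap y₁ y θ - AffineMap.lineMap x₁ x θ))
    (C := L * d ^ δ * d * ‖y - y₁‖ + L * d * ‖(y - y₁) - (x - x₁)‖)
    (fun θ _ => (((der y y₁ θ).sub (der x x₁ θ)).sub
      ((der2 x x₁ θ).clm_apply (derl θ))).hasDerivWithinAt) ?_
  · simp only [AffineMap.lineMap_apply_one, AffineMap.lineMap_apply_zero] at this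
    exact this
  intro θ hθ
  set p := (AffineMap.lineMap y₁ y θ : V)
  set q := (AffineMap.lineMap x₁ x θ : V)
  have sym : fderiv ℝ (fderiv ℝ φ) q (x - x₁) (p - q) = fderiv ℝ (fderiv ℝ φ) q (p - q) (x - x₁) :=
    (hφ.contDiff.contDiffAt.isSymmSndFDerivAt (by simp)) _ _
  -- By symmetry of `∂²φ` the first order part in `p - q` only sees the increment of the difference.
  have e : fderiv ℝ φ p (y - y₁) - fderiv ℝ φ q (x - x₁)
      - (fderiv ℝ (fderiv ℝ φ) q (x - x₁) (p - q) + fderiv ℝ φ q ((y - y₁) - (x - x₁)))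
      = (fderiv ℝ φ p - fderiv ℝ φ q - fderiv ℝ (fderiv ℝ φ) q (p - q)) (y - y₁)
        + fderiv ℝ (fderiv ℝ φ) q (p - q) ((y - y₁) - (x - x₁)) := by
    rw [sym]
    simp only [map_sub, sub_apply]
    abel
  have hpq : ‖p - q‖ ≤ d := norm_lineMap_sub_lineMap_le hd hd₁ ⟨hθ.1, hθ.2.le⟩
  rw [e]
  refine (norm_add_le _ _).trans (add_le_add ?_ ?_)
  · refine (ContinuousLinearMap.le_opNorm _ _).trans ?_
    gcongr
    exact (norm_taylor_le hδ hL0 hφ.differentiable_fderiv hφ.holder_le q p).trans (by gcongr)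
  · refine (ContinuousLinearMap.le_opNorm₂ _ _ _).trans ?_
    gcongr
    exact hφ.norm_fderiv2_le q

theorem C2Bound.taylor_le {φ : V → E} {δ L : ℝ} (hφ : C2Bound δ L φ) (x y : V) :
    ‖φ y - φ x - fderiv ℝ φ x (y - x)‖ ≤ L * ‖y - x‖ * ‖y - x‖ := by
  have := norm_taylor_le (α := 1) zero_le_one hφ.nonneg hφ.differentiable
    (fun x y => by simpa using hφ.fderiv_sub_le y x) x y
  simpa using this

theorem IsC2Holder.bddAbove_holder {δ : ℝ} {φ : V → E} (h : IsC2Holder δ φ) :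
    BddAbove (range fun p : V × V =>
      ‖fderiv ℝ (fderiv ℝ φ) p.1 - fderiv ℝ (fderiv ℝ φ) p.2‖ / ‖p.1 - p.2‖ ^ δ) := by
  obtain ⟨-, -, -, -, C, hC⟩ := h
  refine ⟨max C 0, ?_⟩
  rintro _ ⟨p, rfl⟩
  refine div_le_of_le_mul₀ (by positivity) (le_max_right _ _) ((hC _ _).trans ?_)
  gcongr
  exact le_max_left _ _

theorem bddAbove_range_norm {ι F : Type*} [Norm F] {f : ι → F} (h : ∃ C, ∀ x, ‖f x‖ ≤ C) :
    BddAbove (range fun x => ‖f x‖) := by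
  obtain ⟨C, hC⟩ := h
  exact ⟨C, by rintro _ ⟨x, rfl⟩; exact hC x⟩

theorem IsC2Holder.c2Bound {δ : ℝ} (hδ : 0 < δ) {φ : V → E} (h : IsC2Holder δ φ) :
    C2Bound δ (c2HolderNorm δ φ) φ := by
  have b0 := bddAbove_range_norm h.2.1
  have b1 := bddAbove_range_norm h.2.2.1
  have b2 := bddAbove_range_norm h.2.2.2.1
  have b3 := h.bddAbove_holder
  have n0 : 0 ≤ ⨆ x, ‖φ x‖ := Real.iSup_nonneg fun _ => norm_nonneg _
  have n1 : 0 ≤ ⨆ x, ‖fderiv ℝ φ x‖ := Real.iSup_nonneg fun _ => norm_nonneg _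
  have n2 : 0 ≤ ⨆ x, ‖fderiv ℝ (fderiv ℝ φ) x‖ :=
    Real.iSup_nonneg fun x => norm_nonneg (fderiv ℝ (fderiv ℝ φ) x)
  have n3 : 0 ≤ ⨆ p : V × V,
      ‖fderiv ℝ (fderiv ℝ φ) p.1 - fderiv ℝ (fderiv ℝ φ) p.2‖ / ‖p.1 - p.2‖ ^ δ :=
    Real.iSup_nonneg fun _ => by positivity
  refine ⟨h.1, fun x => ?_, fun x => ?_, fun x => ?_, fun x y => ?_⟩
  · have := le_ciSup b0 x
    unfold c2HolderNorm; linarith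
  · have := le_ciSup b1 x
    unfold c2HolderNorm; linarith
  · have := le_ciSup b2 x
    unfold c2HolderNorm; linarith
  · rcases eq_or_ne x y with rfl | hxy
    · refine le_of_eq_of_le (b := 0) ?_ (by simp [Real.zero_rpow hδ.ne'])
      rw [sub_self]
      exact norm_zero (E := V →L[ℝ] V →L[ℝ] E)
    have hpos : 0 < ‖x - y‖ ^ δ := Real.rpow_pos_of_pos (norm_pos_iff.2 (sub_ne_zero.2 hxy)) _
    rw [← div_le_iff₀ hpos]
    have := le_ciSup b3 (x, y)
    simp only at this
    unfold c2HolderNorm; linarith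

theorem C2Bound.isC2Holder {δ L : ℝ} {φ : V → E} (h : C2Bound δ L φ) : IsC2Holder δ φ :=
  ⟨h.contDiff, ⟨L, h.norm_le⟩, ⟨L, h.norm_fderiv_le⟩, ⟨L, h.norm_fderiv2_le⟩, ⟨L, h.holder_le⟩⟩

theorem C2Bound.fderiv_sub {δ L L₁ : ℝ} {φ φ₁ : V → E} (h : C2Bound δ L φ) (h₁ : C2Bound δ L₁ φ₁) :
    fderiv ℝ (fun x => φ x - φ₁ x) = fun x => fderiv ℝ φ x - fderiv ℝ φ₁ x :=
  funext fun x => fderiv_fun_sub (h.differentiable x) (h₁.differentiable x)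

theorem C2Bound.sub {δ L L₁ : ℝ} {φ φ₁ : V → E} (h : C2Bound δ L φ) (h₁ : C2Bound δ L₁ φ₁) :
    C2Bound δ (L + L₁) (fun x => φ x - φ₁ x) := by
  have e1 := h.fderiv_sub h₁
  have e2 : fderiv ℝ (fderiv ℝ (fun x => φ x - φ₁ x))
      = fun x => fderiv ℝ (fderiv ℝ φ) x - fderiv ℝ (fderiv ℝ φ₁) x := by
    rw [e1]
    exact funext fun x => fderiv_fun_sub (h.differentiable_fderiv x) (h₁.differentiable_fderiv x)
  refine ⟨h.contDiff.sub h₁.contDiff, fun x => ?_, fun x => ?_, fun x => ?_, fun x y => ?_⟩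
  · exact (norm_sub_le _ _).trans (add_le_add (h.norm_le x) (h₁.norm_le x))
  · rw [e1]
    exact (norm_sub_le _ _).trans (add_le_add (h.norm_fderiv_le x) (h₁.norm_fderiv_le x))
  · rw [e2]
    exact (norm_sub_le (fderiv ℝ (fderiv ℝ φ) x) _).trans
      (add_le_add (h.norm_fderiv2_le x) (h₁.norm_fderiv2_le x))
  · rw [e2, sub_sub_sub_comm, add_mul]
    exact (norm_sub_le (fderiv ℝ (fderiv ℝ φ) x - fderiv ℝ (fderiv ℝ φ) y) _).trans
      (add_le_add (h.holder_le x y) (h₁.holder_le x y))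

theorem IsC2Holder.sub {δ : ℝ} (hδ : 0 < δ) {φ φ₁ : V → E} (h : IsC2Holder δ φ)
    (h₁ : IsC2Holder δ φ₁) : IsC2Holder δ (fun x => φ x - φ₁ x) :=
  ((h.c2Bound hδ).sub (h₁.c2Bound hδ)).isC2Holder

end Fields

/-! ### Second order Euler steps -/

section Step
variable {V : Type*} [NormedAddCommGroup V] [NormedSpace ℝ V]

/-- The vector field `∂φ · φ` which multiplies `𝕏²` in the second order expansion of a solution. -/
noncomputable def fieldDeriv (φ : V → V →L[ℝ] V) (y : V) : V →L[ℝ] V →L[ℝ] V :=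
  (fderiv ℝ φ y).comp (φ y)

/-- One step from time `s` to time `t` of the second order Euler scheme. -/
noncomputable def eulerStep (φ : V → V →L[ℝ] V) (X : ℝ → V) (XX : ℝ → ℝ → V ⊗[ℝ] V) (s t : ℝ)
    (y : V) : V :=
  φ y (incr X s t) + contract (fieldDeriv φ y) (XX s t)

/-- The defect of two consecutive Euler steps from `x` and `y`, compared with one step from `x`;
`v`, `w` are the increments of `X` in the two steps and `ω` is the second step of `𝕏²`. -/
noncomputable def stepDefect (φ : V → V →L[ℝ] V) (x y v w : V) (ω : V ⊗[ℝ] V) : V :=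
  (φ y - φ x - fderiv ℝ φ x (φ x v)) w + contract (fieldDeriv φ y - fieldDeriv φ x) ω

/-- Chen's relation turns the failure of Euler steps to compose into `stepDefect`, whatever the order
of the three times. -/
theorem eulerStep_add_eulerStep_sub [FiniteDimensional ℝ V] {φ : V → V →L[ℝ] V} {X : ℝ → V}
    {XX : ℝ → ℝ → V ⊗[ℝ] V} {s u t : ℝ} (h : opN XX s u t = incr X s u ⊗ₜ[ℝ] incr X u t) (x y : V) :
    eulerStep φ X XX s u x + eulerStep φ X XX u t y - eulerStep φ X XX s t x
      = stepDefect φ x y (incr X s u) (incr X u t) (XX u t) := by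
  have h1 : XX s t = incr X s u ⊗ₜ[ℝ] incr X u t + XX u t + XX s u := by
    rw [← h, opN]; abel
  have h2 : incr X s t = incr X s u + incr X u t := by simp [incr]
  simp only [eulerStep, stepDefect, h1, h2, map_add, contract_tmul, contract_sub, fieldDeriv,
    sub_apply, LinearMap.sub_apply, ContinuousLinearMap.comp_apply]
  abel

variable {δ K : ℝ} {φ φ₁ : V → V →L[ℝ] V}

theorem C2Bound.norm_fieldDeriv_le (hφ : C2Bound δ K φ) (x : V) : ‖fieldDeriv φ x‖ ≤ K * K :=
  (ContinuousLinearMap.opNorm_comp_le _ _).trans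
    (mul_le_mul (hφ.norm_fderiv_le x) (hφ.norm_le x) (norm_nonneg _) hφ.nonneg)

theorem C2Bound.norm_fieldDeriv_sub_le (hφ : C2Bound δ K φ) (x y : V) :
    ‖fieldDeriv φ y - fieldDeriv φ x‖ ≤ 2 * K * K * ‖y - x‖ := by
  have h0 := hφ.nonneg
  calc ‖fieldDeriv φ y - fieldDeriv φ x‖
      ≤ ‖fderiv ℝ φ y - fderiv ℝ φ x‖ * ‖φ y‖ + ‖fderiv ℝ φ x‖ * ‖φ y - φ x‖ :=
        norm_comp_sub_comp_le _ _ _ _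
    _ ≤ K * ‖y - x‖ * K + K * (K * ‖y - x‖) := by
        gcongr
        exacts [hφ.fderiv_sub_le x y, hφ.norm_le y, hφ.norm_fderiv_le x, hφ.sub_le x y]
    _ = _ := by ring

theorem C2Bound.norm_eulerStep_le [FiniteDimensional ℝ V] (hφ : C2Bound δ K φ) (X : ℝ → V)
    (XX : ℝ → ℝ → V ⊗[ℝ] V) (s t : ℝ) (y : V) :
    ‖eulerStep φ X XX s t y‖ ≤ K * ‖incr X s t‖ + K * K * ‖XX s t‖ := by
  refine (norm_add_le _ _).trans (add_le_add ?_ ?_)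
  · exact (ContinuousLinearMap.le_opNorm _ _).trans (by gcongr; exact hφ.norm_le y)
  · exact (norm_contract_le _ _).trans (by gcongr; exact hφ.norm_fieldDeriv_le y)

/-- If `X` moves by at most `A r` and `y` is the Euler step from `x` up to second order, then the
defect is of third order in `r`. -/
theorem C2Bound.norm_stepDefect_le [FiniteDimensional ℝ V] (hφ : C2Bound δ K φ)
    {x y v w : V} {ω : V ⊗[ℝ] V} {A B r : ℝ}
    (hA : 0 ≤ A) (hr : 0 ≤ r) (hr1 : r ≤ 1) (hB : 0 ≤ B) (hv : ‖v‖ ≤ A * r) (hw : ‖w‖ ≤ A * r)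
    (hω : ‖ω‖ ≤ A * r ^ 2) (hy : ‖y - x - φ x v‖ ≤ B * r ^ 2) :
    ‖stepDefect φ x y v w ω‖
      ≤ ((K * (K * A + B) ^ 2 + K * B) * A + 2 * K * K * (K * A + B) * A) * r ^ 3 := by
  have h0 := hφ.nonneg
  have hyx : ‖y - x‖ ≤ (K * A + B) * r := by
    have e : y - x = φ x v + (y - x - φ x v) := by abel
    have h1 : ‖φ x v‖ ≤ K * (A * r) :=
      (ContinuousLinearMap.le_opNorm _ _).trans
        (mul_le_mul (hφ.norm_le x) hv (norm_nonneg _) h0)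
    have h2 : B * r ^ 2 ≤ B * r := by
      have : r ^ 2 ≤ r := by nlinarith
      gcongr
    rw [e]
    refine (norm_add_le _ _).trans ?_
    linarith
  have h1 : ‖φ y - φ x - fderiv ℝ φ x (φ x v)‖ ≤ (K * (K * A + B) ^ 2 + K * B) * r ^ 2 := by
    have e : φ y - φ x - fderiv ℝ φ x (φ x v)
        = (φ y - φ x - fderiv ℝ φ x (y - x)) + fderiv ℝ φ x (y - x - φ x v) := by
      simp only [map_sub]; abel
    rw [e]
    calc _ ≤ ‖φ y - φ x - fderiv ℝ φ x (y - x)‖ + ‖fderiv ℝ φ x (y - x - φ x v)‖ :=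
          norm_add_le _ _
      _ ≤ K * ‖y - x‖ * ‖y - x‖ + K * (B * r ^ 2) := add_le_add (hφ.taylor_le x y)
          ((ContinuousLinearMap.le_opNorm _ _).trans
            (mul_le_mul (hφ.norm_fderiv_le x) hy (norm_nonneg _) h0))
      _ ≤ K * ((K * A + B) * r) * ((K * A + B) * r) + K * (B * r ^ 2) := by gcongr
      _ = _ := by ring
  have h2 : ‖fieldDeriv φ y - fieldDeriv φ x‖ ≤ 2 * K * K * ((K * A + B) * r) :=
    (hφ.norm_fieldDeriv_sub_le x y).trans (by gcongr)
  calc ‖stepDefect φ x y v w ω‖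
      ≤ ‖φ y - φ x - fderiv ℝ φ x (φ x v)‖ * ‖w‖ + ‖fieldDeriv φ y - fieldDeriv φ x‖ * ‖ω‖ :=
        (norm_add_le _ _).trans (add_le_add (ContinuousLinearMap.le_opNorm _ _)
          (norm_contract_le _ _))
    _ ≤ (K * (K * A + B) ^ 2 + K * B) * r ^ 2 * (A * r)
        + 2 * K * K * ((K * A + B) * r) * (A * r ^ 2) := by gcongr
    _ = _ := by ring

section Difference
variable {S : ℝ} {x x₁ y y₁ : V}

theorem norm_field_sub_le (hφ : C2Bound δ K φ) (hψ : C2Bound δ S fun x => φ x - φ₁ x)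
    (hK : 1 ≤ K) (hx : ‖x - x₁‖ ≤ S) : ‖φ x - φ₁ x₁‖ ≤ 2 * K * S := by
  have e : φ x - φ₁ x₁ = (φ x - φ x₁) + (φ x₁ - φ₁ x₁) := by abel
  rw [e]
  have hS := hψ.nonneg
  calc _ ≤ ‖φ x - φ x₁‖ + ‖φ x₁ - φ₁ x₁‖ := norm_add_le _ _
    _ ≤ K * S + S := add_le_add ((hφ.sub_le x₁ x).trans (by gcongr)) (hψ.norm_le x₁)
    _ ≤ 2 * K * S := by nlinarith

theorem norm_fderiv_field_sub_le (hφ : C2Bound δ K φ) (hφ₁ : C2Bound δ K φ₁)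
    (hψ : C2Bound δ S fun x => φ x - φ₁ x)
    (hK : 1 ≤ K) (hx : ‖x - x₁‖ ≤ S) : ‖fderiv ℝ φ x - fderiv ℝ φ₁ x₁‖ ≤ 2 * K * S := by
  have e : fderiv ℝ φ x - fderiv ℝ φ₁ x₁
      = (fderiv ℝ φ x - fderiv ℝ φ x₁) + (fderiv ℝ φ x₁ - fderiv ℝ φ₁ x₁) := by abel
  have h1 := hψ.norm_fderiv_le x₁
  rw [hφ.fderiv_sub hφ₁] at h1
  rw [e]
  have hS := hψ.nonneg
  calc _ ≤ ‖fderiv ℝ φ x - fderiv ℝ φ x₁‖ + ‖fderiv ℝ φ x₁ - fderiv ℝ φ₁ x₁‖ :=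
        norm_add_le (fderiv ℝ φ x - fderiv ℝ φ x₁) _
    _ ≤ K * S + S := add_le_add ((hφ.fderiv_sub_le x₁ x).trans (by gcongr)) h1
    _ ≤ 2 * K * S := by nlinarith

theorem norm_fieldDeriv_field_sub_le (hφ : C2Bound δ K φ) (hφ₁ : C2Bound δ K φ₁)
    (hψ : C2Bound δ S fun x => φ x - φ₁ x)
    (hK : 1 ≤ K) (hx : ‖x - x₁‖ ≤ S) : ‖fieldDeriv φ x - fieldDeriv φ₁ x₁‖ ≤ 4 * K ^ 2 * S := by
  have hS := hψ.nonneg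
  calc _ ≤ ‖fderiv ℝ φ x - fderiv ℝ φ₁ x₁‖ * ‖φ x‖ + ‖fderiv ℝ φ₁ x₁‖ * ‖φ x - φ₁ x₁‖ :=
        norm_comp_sub_comp_le _ _ _ _
    _ ≤ 2 * K * S * K + K * (2 * K * S) := by
        gcongr
        exacts [norm_fderiv_field_sub_le hφ hφ₁ hψ hK hx, hφ.norm_le x, hφ₁.norm_fderiv_le x₁,
          norm_field_sub_le hφ hψ hK hx]
    _ = _ := by ring

variable {r : ℝ}

/-- The increments of `φ` along two pairs of points. -/
theorem norm_field_incr_sub_le (hφ : C2Bound δ K φ)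
    (hψ : C2Bound δ S fun x => φ x - φ₁ x) (hK : 1 ≤ K) (hr : 0 ≤ r) (hy : ‖y - y₁‖ ≤ S)
    (hxy : ‖(y - y₁) - (x - x₁)‖ ≤ S * r) (hd : ‖y - x‖ ≤ K * r) (hd₁ : ‖y₁ - x₁‖ ≤ K * r) :
    ‖φ y - φ x - (φ₁ y₁ - φ₁ x₁)‖ ≤ 3 * K ^ 2 * S * r := by
  have hS := hψ.nonneg
  have h1 := norm_four_point_le zero_le_one hφ.nonneg hφ.differentiable hφ.norm_fderiv_le
    (fun x y => by simpa using hφ.fderiv_sub_le y x) hd hd₁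
  have h2 := hψ.sub_le x₁ y₁
  rw [Real.rpow_one] at h1
  have e : φ y - φ x - (φ₁ y₁ - φ₁ x₁)
      = (φ y - φ x - (φ y₁ - φ x₁)) + ((φ y₁ - φ₁ y₁) - (φ x₁ - φ₁ x₁)) := by abel
  rw [e]
  have hKK : K ≤ K ^ 2 := by nlinarith
  have hSr : 0 ≤ S * r := by positivity
  calc _ ≤ ‖φ y - φ x - (φ y₁ - φ x₁)‖ + ‖(φ y₁ - φ₁ y₁) - (φ x₁ - φ₁ x₁)‖ := norm_add_le _ _
    _ ≤ (K * (K * r) * S + K * (S * r)) + S * (K * r) :=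
      add_le_add (h1.trans (by have := hφ.nonneg; gcongr)) (h2.trans (by gcongr))
    _ = (K ^ 2 + 2 * K) * (S * r) := by ring
    _ ≤ (3 * K ^ 2) * (S * r) := by gcongr; linarith
    _ = _ := by ring

/-- The increments of `∂φ` along two pairs of points; here only the `δ`-Hölder continuity of `∂²φ`
is available. -/
theorem norm_fderiv_incr_sub_le (hδ₀ : 0 ≤ δ) (hδ₁ : δ ≤ 1) (hφ : C2Bound δ K φ)
    (hφ₁ : C2Bound δ K φ₁)
    (hψ : C2Bound δ S fun x => φ x - φ₁ x) (hK : 1 ≤ K) (hr : 0 ≤ r) (hr1 : r ≤ 1)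
    (hy : ‖y - y₁‖ ≤ S)
    (hxy : ‖(y - y₁) - (x - x₁)‖ ≤ S * r) (hd : ‖y - x‖ ≤ K * r) (hd₁ : ‖y₁ - x₁‖ ≤ K * r) :
    ‖fderiv ℝ φ y - fderiv ℝ φ x - (fderiv ℝ φ₁ y₁ - fderiv ℝ φ₁ x₁)‖
      ≤ 3 * K ^ 2 * S * r ^ δ := by
  have hS := hψ.nonneg
  have h1 := norm_four_point_le hδ₀ hφ.nonneg hφ.differentiable_fderiv hφ.norm_fderiv2_le
    hφ.holder_le hd hd₁
  have h2 := hψ.fderiv_sub_le x₁ y₁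
  rw [hφ.fderiv_sub hφ₁] at h2
  have e : fderiv ℝ φ y - fderiv ℝ φ x - (fderiv ℝ φ₁ y₁ - fderiv ℝ φ₁ x₁)
      = (fderiv ℝ φ y - fderiv ℝ φ x - (fderiv ℝ φ y₁ - fderiv ℝ φ x₁))
        + ((fderiv ℝ φ y₁ - fderiv ℝ φ₁ y₁) - (fderiv ℝ φ x₁ - fderiv ℝ φ₁ x₁)) := by abel
  rw [e]
  have hKK : K ≤ K ^ 2 := by nlinarith
  have hμ : 0 ≤ r ^ δ := by positivity
  have hrμ : r ≤ r ^ δ := by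
    simpa using Real.rpow_le_rpow_of_exponent_ge_of_imp hr hr1 hδ₁ (by simp)
  have hKδ : K ^ δ ≤ K := by
    simpa using Real.rpow_le_rpow_of_exponent_le hK hδ₁
  have hK0 : 0 ≤ K := by linarith
  calc _ ≤ ‖fderiv ℝ φ y - fderiv ℝ φ x - (fderiv ℝ φ y₁ - fderiv ℝ φ x₁)‖
        + ‖(fderiv ℝ φ y₁ - fderiv ℝ φ₁ y₁) - (fderiv ℝ φ x₁ - fderiv ℝ φ₁ x₁)‖ :=
        norm_add_le (fderiv ℝ φ y - fderiv ℝ φ x - (fderiv ℝ φ y₁ - fderiv ℝ φ x₁)) _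
    _ ≤ (K * (K * r ^ δ) * S + K * (S * r ^ δ)) + S * (K * r ^ δ) := by
      refine add_le_add (h1.trans ?_) (h2.trans ?_)
      · rw [Real.mul_rpow hK0 hr]
        gcongr
        exact hxy.trans (by gcongr)
      · gcongr
        exact hd₁.trans (by gcongr)
    _ = (K ^ 2 + 2 * K) * (S * r ^ δ) := by ring
    _ ≤ (3 * K ^ 2) * (S * r ^ δ) := by gcongr; linarith
    _ = _ := by ring

/-- The increments of `∂φ · φ` along two pairs of points. -/
theorem norm_fieldDeriv_incr_sub_le (hδ₀ : 0 ≤ δ) (hδ₁ : δ ≤ 1) (hφ : C2Bound δ K φ)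
    (hφ₁ : C2Bound δ K φ₁)
    (hψ : C2Bound δ S fun x => φ x - φ₁ x) (hK : 1 ≤ K) (hr : 0 ≤ r) (hr1 : r ≤ 1)
    (hx : ‖x - x₁‖ ≤ S) (hy : ‖y - y₁‖ ≤ S)
    (hxy : ‖(y - y₁) - (x - x₁)‖ ≤ S * r) (hd : ‖y - x‖ ≤ K * r) (hd₁ : ‖y₁ - x₁‖ ≤ K * r) :
    ‖fieldDeriv φ y - fieldDeriv φ x - (fieldDeriv φ₁ y₁ - fieldDeriv φ₁ x₁)‖
      ≤ 10 * K ^ 3 * S * r ^ δ := by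
  have hS := hψ.nonneg
  have hK0 : 0 ≤ K := by linarith
  have hrμ : r ≤ r ^ δ := by
    simpa using Real.rpow_le_rpow_of_exponent_ge_of_imp hr hr1 hδ₁ (by simp)
  have e : fieldDeriv φ y - fieldDeriv φ x - (fieldDeriv φ₁ y₁ - fieldDeriv φ₁ x₁)
      = ((fderiv ℝ φ y).comp (φ y - φ x) - (fderiv ℝ φ₁ y₁).comp (φ₁ y₁ - φ₁ x₁))
        + ((fderiv ℝ φ y - fderiv ℝ φ x).comp (φ x)
            - (fderiv ℝ φ₁ y₁ - fderiv ℝ φ₁ x₁).comp (φ₁ x₁)) := by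
    simp only [fieldDeriv, ContinuousLinearMap.comp_sub, ContinuousLinearMap.sub_comp]
    abel
  have b1 : ‖φ y - φ x‖ ≤ K * (K * r) := (hφ.sub_le x y).trans (by gcongr)
  have b2 : ‖fderiv ℝ φ₁ y₁ - fderiv ℝ φ₁ x₁‖ ≤ K * (K * r) :=
    (hφ₁.fderiv_sub_le x₁ y₁).trans (by gcongr)
  rw [e]
  calc _ ≤ ‖(fderiv ℝ φ y).comp (φ y - φ x) - (fderiv ℝ φ₁ y₁).comp (φ₁ y₁ - φ₁ x₁)‖
        + ‖(fderiv ℝ φ y - fderiv ℝ φ x).comp (φ x)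
            - (fderiv ℝ φ₁ y₁ - fderiv ℝ φ₁ x₁).comp (φ₁ x₁)‖ :=
        norm_add_le ((fderiv ℝ φ y).comp (φ y - φ x) - (fderiv ℝ φ₁ y₁).comp (φ₁ y₁ - φ₁ x₁)) _
    _ ≤ (2 * K * S * (K * (K * r)) + K * (3 * K ^ 2 * S * r))
        + (3 * K ^ 2 * S * r ^ δ * K + K * (K * r) * (2 * K * S)) := by
      refine add_le_add ((norm_comp_sub_comp_le _ _ _ _).trans ?_)
        ((norm_comp_sub_comp_le _ _ _ _).trans ?_)
      · gcongr
        exacts [norm_fderiv_field_sub_le hφ hφ₁ hψ hK hy, hφ₁.norm_fderiv_le _,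
          norm_field_incr_sub_le hφ hψ hK hr hy hxy hd hd₁]
      · gcongr
        exacts [norm_fderiv_incr_sub_le hδ₀ hδ₁ hφ hφ₁ hψ hK hr hr1 hy hxy hd hd₁, hφ.norm_le _,
          norm_field_sub_le hφ hψ hK hx]
    _ = 7 * K ^ 3 * S * r + 3 * K ^ 3 * S * r ^ δ := by ring
    _ ≤ 7 * K ^ 3 * S * r ^ δ + 3 * K ^ 3 * S * r ^ δ := by gcongr
    _ = _ := by ring

/-- Lipschitz dependence of the defect of two Euler steps on all the data. The exponent `2 + δ`
of `r` is what makes the difference of two solutions accessible to the sewing estimate. -/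
theorem norm_stepDefect_sub_le [FiniteDimensional ℝ V] (hδ₀ : 0 ≤ δ) (hδ₁ : δ ≤ 1)
    (hφ : C2Bound δ K φ)
    (hφ₁ : C2Bound δ K φ₁)
    (hψ : C2Bound δ S fun x => φ x - φ₁ x) (hK : 1 ≤ K) (hr : 0 ≤ r) (hr1 : r ≤ 1)
    (hx : ‖x - x₁‖ ≤ S) (hy : ‖y - y₁‖ ≤ S)
    (hxy : ‖(y - y₁) - (x - x₁)‖ ≤ S * r) (hd : ‖y - x‖ ≤ K * r) (hd₁ : ‖y₁ - x₁‖ ≤ K * r)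
    {v v₁ w w₁ : V} {ω ω₁ : V ⊗[ℝ] V}
    (hR : ‖y - x - φ x v‖ ≤ K * r ^ 2) (hR₁ : ‖y₁ - x₁ - φ₁ x₁ v₁‖ ≤ K * r ^ 2)
    (hRR : ‖(y - x - φ x v) - (y₁ - x₁ - φ₁ x₁ v₁)‖ ≤ S * r ^ 2)
    (hw : ‖w‖ ≤ K * r) (hww : ‖w - w₁‖ ≤ S * r)
    (hω : ‖ω‖ ≤ K * r ^ 2) (hωω : ‖ω - ω₁‖ ≤ S * r ^ 2) :
    ‖stepDefect φ x y v w ω - stepDefect φ₁ x₁ y₁ v₁ w₁ ω₁‖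
      ≤ 20 * K ^ 4 * S * (r ^ 2 * r ^ δ) := by
  have hS := hψ.nonneg
  have hK0 : 0 ≤ K := by linarith
  have hrμ : r ≤ r ^ δ := by
    simpa using Real.rpow_le_rpow_of_exponent_ge_of_imp hr hr1 hδ₁ (by simp)
  have hμ : 0 ≤ r ^ δ := by positivity
  have hKδ : K ^ δ ≤ K := by
    simpa using Real.rpow_le_rpow_of_exponent_le hK hδ₁
  have split : ∀ (f : V → V →L[ℝ] V) (x y v : V), f y - f x - fderiv ℝ f x (f x v)
        = (f y - f x - fderiv ℝ f x (y - x)) + fderiv ℝ f x (y - x - f x v) := by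
    intro f x y v
    simp only [map_sub]; abel
  set a := φ y - φ x - fderiv ℝ φ x (φ x v) with ha
  set a₁ := φ₁ y₁ - φ₁ x₁ - fderiv ℝ φ₁ x₁ (φ₁ x₁ v₁) with ha₁
  have hK1 : K ^ 2 ≤ K ^ 3 := pow_le_pow_right₀ hK (by norm_num)
  have hr2 : 0 ≤ r ^ 2 := by positivity
  have h_a₁ : ‖a₁‖ ≤ 2 * K ^ 3 * r ^ 2 := by
    rw [ha₁, split]
    calc _ ≤ _ := norm_add_le _ _
      _ ≤ K * (K * r) * (K * r) + K * (K * r ^ 2) :=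
        add_le_add ((hφ₁.taylor_le x₁ y₁).trans (by gcongr))
          ((ContinuousLinearMap.le_opNorm _ _).trans
            (mul_le_mul (hφ₁.norm_fderiv_le x₁) hR₁ (norm_nonneg _) hK0))
      _ = (K ^ 3 + K ^ 2) * r ^ 2 := by ring
      _ ≤ _ := by gcongr; linarith
  have h_aa : ‖a - a₁‖ ≤ 6 * K ^ 3 * S * (r * r ^ δ) := by
    have hT := hφ.taylor_sub_taylor_le hδ₀ hd hd₁
    have hT₁ := hψ.taylor_le x₁ y₁
    rw [hφ.fderiv_sub hφ₁] at hT₁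
    have hD := norm_apply_sub_apply_le (fderiv ℝ φ x) (fderiv ℝ φ₁ x₁) (y - x - φ x v)
      (y₁ - x₁ - φ₁ x₁ v₁)
    have e : a - a₁ = ((φ y - φ x - fderiv ℝ φ x (y - x))
          - (φ y₁ - φ x₁ - fderiv ℝ φ x₁ (y₁ - x₁)))
        + ((φ y₁ - φ₁ y₁) - (φ x₁ - φ₁ x₁) - (fderiv ℝ φ x₁ - fderiv ℝ φ₁ x₁) (y₁ - x₁))
        + (fderiv ℝ φ x (y - x - φ x v) - fderiv ℝ φ₁ x₁ (y₁ - x₁ - φ₁ x₁ v₁)) := by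
      rw [ha, ha₁, split, split, sub_apply]; abel
    rw [e]
    have hrr : r ^ 2 ≤ r * r ^ δ := by rw [sq]; gcongr
    calc _ ≤ _ := norm_add₃_le
      _ ≤ (K * (K * r ^ δ) * (K * r) * S + K * (K * r) * (S * r)) + S * (K * r) * (K * r)
          + (2 * K * S * (K * r ^ 2) + K * (S * r ^ 2)) := by
        refine add_le_add (add_le_add (hT.trans ?_) (hT₁.trans ?_)) (hD.trans ?_)
        · rw [Real.mul_rpow hK0 hr]
          gcongr
        · gcongr
        · gcongr
          exacts [norm_fderiv_field_sub_le hφ hφ₁ hψ hK hx, hφ₁.norm_fderiv_le _]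
      _ = K ^ 3 * S * (r * r ^ δ) + (4 * K ^ 2 + K) * S * r ^ 2 := by ring
      _ ≤ K ^ 3 * S * (r * r ^ δ) + (5 * K ^ 3) * S * (r * r ^ δ) := by
        gcongr
        nlinarith
      _ = _ := by ring
  set b := fieldDeriv φ y - fieldDeriv φ x with hb
  set b₁ := fieldDeriv φ₁ y₁ - fieldDeriv φ₁ x₁ with hb₁
  have h_b₁ : ‖b₁‖ ≤ 2 * K * K * (K * r) := (hφ₁.norm_fieldDeriv_sub_le x₁ y₁).trans (by gcongr)
  have h_bb : ‖b - b₁‖ ≤ 10 * K ^ 3 * S * r ^ δ :=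
    norm_fieldDeriv_incr_sub_le hδ₀ hδ₁ hφ hφ₁ hψ hK hr hr1 hx hy hxy hd hd₁
  have e : stepDefect φ x y v w ω - stepDefect φ₁ x₁ y₁ v₁ w₁ ω₁
      = (a w - a₁ w₁) + (contract b ω - contract b₁ ω₁) := by
    simp only [stepDefect, ← ha, ← ha₁, ← hb, ← hb₁]; abel
  rw [e]
  have hrr : r ^ 3 ≤ r ^ 2 * r ^ δ := by
    rw [show r ^ 3 = r ^ 2 * r by ring]; gcongr
  have hK34 : K ^ 3 ≤ K ^ 4 := pow_le_pow_right₀ hK (by norm_num)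
  calc _ ≤ _ := norm_add_le _ _
    _ ≤ (6 * K ^ 3 * S * (r * r ^ δ) * (K * r) + 2 * K ^ 3 * r ^ 2 * (S * r))
        + (10 * K ^ 3 * S * r ^ δ * (K * r ^ 2) + 2 * K * K * (K * r) * (S * r ^ 2)) := by
      refine add_le_add ((norm_apply_sub_apply_le _ _ _ _).trans ?_)
        ((norm_contract_sub_contract_le _ _ _ _).trans ?_) <;> gcongr
    _ = 16 * K ^ 4 * S * (r ^ 2 * r ^ δ) + 4 * K ^ 3 * S * r ^ 3 := by ring
    _ ≤ 16 * K ^ 4 * S * (r ^ 2 * r ^ δ) + 4 * K ^ 4 * S * (r ^ 2 * r ^ δ) := by gcongr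
    _ = _ := by ring

end Difference
end Step

/-! ### Hölder processes and the sewing lemma -/

section Powers

theorem rpow_two_mul_eq_sq {l : ℝ} (hl : 0 ≤ l) (γ : ℝ) : l ^ (2 * γ) = (l ^ γ) ^ 2 := by
  rw [mul_comm, Real.rpow_mul hl, Real.rpow_two]

theorem rpow_three_mul_eq_cube {l : ℝ} (hl : 0 ≤ l) (γ : ℝ) : l ^ (3 * γ) = (l ^ γ) ^ 3 := by
  rw [mul_comm, Real.rpow_mul hl]
  exact_mod_cast Real.rpow_natCast (l ^ γ) 3

theorem exists_pos_mul_rpow_le {c γ ε : ℝ} (hγ : 0 < γ) (hε : 0 < ε) :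
    ∃ h : ℝ, 0 < h ∧ h ≤ 1 ∧ c * h ^ γ ≤ ε := by
  have h1 : Tendsto (fun h : ℝ => c * h ^ γ) (𝓝[>] 0) (𝓝 0) := by
    have : Tendsto (fun h : ℝ => c * h ^ γ) (𝓝 0) (𝓝 (c * 0 ^ γ)) :=
      ((continuous_id.rpow_const (fun _ => Or.inr hγ.le)).tendsto 0).const_mul c
    rw [Real.zero_rpow hγ.ne', mul_zero] at this
    exact this.mono_left nhdsWithin_le_nhds
  have h2 : ∀ᶠ h : ℝ in 𝓝[>] 0, 0 < h := self_mem_nhdsWithin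
  have h3 : ∀ᶠ h : ℝ in 𝓝[>] 0, h ≤ 1 :=
    nhdsWithin_le_nhds (ge_mem_nhds one_pos)
  obtain ⟨h, h4, h5, h6⟩ := (h2.and (h3.and (h1.eventually (ge_mem_nhds hε)))).exists
  exact ⟨h, h4, h5, h6⟩

theorem rpow_le_of_le_one {γ γ' l : ℝ} (hl : 0 ≤ l) (hl1 : l ≤ 1) (hγ : 0 < γ) (h : γ ≤ γ') :
    l ^ γ' ≤ l ^ γ :=
  Real.rpow_le_rpow_of_exponent_ge_of_imp hl hl1 h (fun _ h0 => absurd h0 (hγ.trans_le h).ne')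

end Powers

section Norms
variable {E : Type*} [NormedAddCommGroup E]
variable {J : Set ℝ} {γ : ℝ} {R R₁ : ℝ → ℝ → E} {A A₁ : ℝ → E}

theorem IsHolderProcess.norm_le (h : IsHolderProcess γ J R) {s t : ℝ} (hs : s ∈ J) (ht : t ∈ J) :
    ‖R s t‖ ≤ holderNorm γ J R * |t - s| ^ γ := by
  obtain ⟨-, h0, C, hC⟩ := h
  rcases eq_or_ne s t with rfl | hst
  · rw [h0 s hs, norm_zero]
    exact mul_nonneg (Real.iSup_nonneg fun _ => by positivity) (by positivity)
  have hb : BddAbove (range fun p : J × J => ‖R p.1 p.2‖ / |(p.2 : ℝ) - p.1| ^ γ) := by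
    refine ⟨max C 0, ?_⟩
    rintro _ ⟨p, rfl⟩
    refine div_le_of_le_mul₀ (by positivity) (le_max_right _ _) ((hC _ p.1.2 _ p.2.2).trans ?_)
    gcongr
    exact le_max_left _ _
  have hpos : 0 < |t - s| ^ γ := Real.rpow_pos_of_pos (abs_pos.2 (sub_ne_zero.2 hst.symm)) _
  rw [← div_le_iff₀ hpos]
  exact le_ciSup hb (⟨s, hs⟩, ⟨t, ht⟩)

theorem holderNorm_nonneg : 0 ≤ holderNorm γ J R := Real.iSup_nonneg fun _ => by positivity

theorem holderNorm_le {c : ℝ} (hc : 0 ≤ c) (h : ∀ s ∈ J, ∀ t ∈ J, ‖R s t‖ ≤ c * |t - s| ^ γ) :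
    holderNorm γ J R ≤ c :=
  Real.iSup_le (fun p => div_le_of_le_mul₀ (by positivity) hc (h _ p.1.2 _ p.2.2)) hc

theorem supNorm_nonneg : 0 ≤ supNorm J A := Real.iSup_nonneg fun _ => norm_nonneg _

theorem supNorm_le {c : ℝ} (hc : 0 ≤ c) (h : ∀ t ∈ J, ‖A t‖ ≤ c) : supNorm J A ≤ c :=
  Real.iSup_le (fun p => h _ p.2) hc

theorem IsHolderProcess.sub (h : IsHolderProcess γ J R) (h₁ : IsHolderProcess γ J R₁) :
    IsHolderProcess γ J (fun s t => R s t - R₁ s t) := by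
  refine ⟨h.1.sub h₁.1, fun t ht => by simp [h.2.1 t ht, h₁.2.1 t ht], ?_⟩
  obtain ⟨C, hC⟩ := h.2.2
  obtain ⟨C₁, hC₁⟩ := h₁.2.2
  refine ⟨C + C₁, fun s hs t ht => ?_⟩
  rw [add_mul]
  exact (norm_sub_le _ _).trans (add_le_add (hC s hs t ht) (hC₁ s hs t ht))

theorem incr_sub (A A₁ : ℝ → E) :
    incr (fun t => A t - A₁ t) = fun s t => incr A s t - incr A₁ s t := by
  funext s t
  simp only [incr]; abel

theorem continuousOn_incr (hA : ContinuousOn A J) :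
    ContinuousOn (fun p : ℝ × ℝ => incr A p.1 p.2) (J ×ˢ J) :=
  (hA.comp continuousOn_snd fun _ hp => hp.2).sub (hA.comp continuousOn_fst fun _ hp => hp.1)

/-- Two exponents are allowed because increments arise as a step plus an error of a different
order. -/
theorem continuousOn_of_modulus {C C₁ α β h : ℝ} (hα : 0 < α) (hβ : 0 < β) (hh : 0 < h)
    (hA : ∀ s ∈ J, ∀ t ∈ J, |t - s| < h → ‖A t - A s‖ ≤ C * |t - s| ^ α + C₁ * |t - s| ^ β) :
    ContinuousOn A J := by
  intro s hs
  rw [ContinuousWithinAt, tendsto_iff_norm_sub_tendsto_zero]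
  have hc : Continuous fun t : ℝ => C * |t - s| ^ α + C₁ * |t - s| ^ β := by
    have h1 : Continuous fun t : ℝ => |t - s| := by fun_prop
    exact ((h1.rpow_const fun _ => Or.inr hα.le).const_mul C).add
      ((h1.rpow_const fun _ => Or.inr hβ.le).const_mul C₁)
  have h0 : Tendsto (fun t : ℝ => C * |t - s| ^ α + C₁ * |t - s| ^ β) (𝓝[J] s) (𝓝 0) := by
    have := (hc.tendsto s).mono_left (nhdsWithin_le_nhds (s := J))
    simpa [Real.zero_rpow hα.ne', Real.zero_rpow hβ.ne'] using this
  refine squeeze_zero' (Eventually.of_forall fun _ => norm_nonneg _) ?_ h0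
  have h1 : ∀ᶠ t in 𝓝[J] s, |t - s| < h := by
    refine nhdsWithin_le_nhds ?_
    have : Tendsto (fun t : ℝ => |t - s|) (𝓝 s) (𝓝 |s - s|) :=
      (by fun_prop : Continuous fun t : ℝ => |t - s|).tendsto s
    rw [sub_self, abs_zero] at this
    exact this.eventually (gt_mem_nhds hh)
  filter_upwards [h1, self_mem_nhdsWithin] with t ht htJ
  exact hA s hs t htJ ht

/-- On a compact interval a Hölder bound near the diagonal is a Hölder bound. -/
theorem exists_holder_of_local (hJ : IsCompact J) (hR : ContinuousOn (fun p : ℝ × ℝ => R p.1 p.2)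
    (J ×ˢ J)) {C z h : ℝ} (hz : 0 < z) (hh : 0 < h)
    (hloc : ∀ s ∈ J, ∀ t ∈ J, |t - s| < h → ‖R s t‖ ≤ C * |t - s| ^ z) :
    ∃ C', 0 ≤ C' ∧ ∀ s ∈ J, ∀ t ∈ J, ‖R s t‖ ≤ C' * |t - s| ^ z := by
  obtain ⟨B, hB⟩ := (hJ.prod hJ).exists_bound_of_continuousOn hR
  refine ⟨max (max C 0) (B / h ^ z), le_max_of_le_left (le_max_right _ _), fun s hs t ht => ?_⟩
  have hhz : 0 < h ^ z := Real.rpow_pos_of_pos hh z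
  rcases lt_or_ge |t - s| h with hst | hst
  · refine (hloc s hs t ht hst).trans ?_
    gcongr
    exact (le_max_left _ _).trans (le_max_left _ _)
  · have hB0 : 0 ≤ B := (norm_nonneg _).trans (hB (s, t) ⟨hs, ht⟩)
    calc ‖R s t‖ ≤ B := hB (s, t) ⟨hs, ht⟩
      _ = B / h ^ z * h ^ z := by field_simp
      _ ≤ B / h ^ z * |t - s| ^ z := by gcongr
      _ ≤ _ := by gcongr; exact le_max_right _ _

theorem IsHolderProcess.exists_of_le (hJ : IsCompact J) {α : ℝ} (hα : 0 < α) (hαγ : α ≤ γ)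
    (h : IsHolderProcess γ J R) :
    ∃ C, 0 ≤ C ∧ ∀ s ∈ J, ∀ t ∈ J, ‖R s t‖ ≤ C * |t - s| ^ α := by
  refine exists_holder_of_local hJ h.1 (C := holderNorm γ J R) hα one_pos fun s hs t ht hst =>
    (h.norm_le hs ht).trans ?_
  exact mul_le_mul_of_nonneg_left (rpow_le_of_le_one (abs_nonneg _) hst.le hα hαγ) holderNorm_nonneg

end Norms

section Sewing
variable {E : Type*} [NormedAddCommGroup E]

/-- Uniqueness in the sewing lemma. -/
theorem IsSewing.eqOn {a b : ℝ} {A : ℝ → ℝ → ℝ → E} {R R₁ : ℝ → ℝ → E}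
    (h : IsSewing (Icc a b) A R) (h₁ : IsSewing (Icc a b) A R₁) {s t : ℝ} (hs : s ∈ Icc a b)
    (ht : t ∈ Icc a b) : R s t = R₁ s t := by
  obtain ⟨⟨z, hz, hR⟩, hA⟩ := h
  obtain ⟨⟨z₁, hz₁, hR₁⟩, hA₁⟩ := h₁
  have := norm_le_of_midpoint (convex_Icc a b) (D := fun s t => R s t - R₁ s t) (C := 0) hz hz hz₁
    (fun s hs t ht => (norm_sub_le _ _).trans
      (add_le_add (hR.norm_le hs ht) (hR₁.norm_le hs ht))) ?_ s hs t ht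
  · rw [zero_div, zero_mul] at this
    exact sub_eq_zero.1 (norm_le_zero_iff.1 this)
  intro s hs t ht
  have hu : (s + t) / 2 ∈ Icc a b := ⟨by linarith [hs.1, ht.1], by linarith [hs.2, ht.2]⟩
  have e : R s t - R₁ s t = (R s ((s + t) / 2) - R₁ s ((s + t) / 2))
      + (R ((s + t) / 2) t - R₁ ((s + t) / 2) t) := by
    have h2 := (hA s hs _ hu t ht).trans (hA₁ s hs _ hu t ht).symm
    simp only [opN] at h2
    rw [← sub_eq_zero] at h2 ⊢
    rw [← h2]; abel
  rw [zero_mul, add_zero, e]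
  exact norm_add_le _ _

theorem IsSewing.sewing {J : Set ℝ} {A : ℝ → ℝ → ℝ → E} {R : ℝ → ℝ → E} (h : IsSewing J A R) :
    IsSewing J A (Rough.sewing J A) := by
  have hex : ∃ R, IsSewing J A R := ⟨R, h⟩
  rw [Rough.sewing, dif_pos hex]
  exact hex.choose_spec

/-- The sewing lemma. The additive part of `g` is the path produced by the almost flow whose steps
`g s t` do not depend on the point. -/
theorem exists_isSewing [NormedSpace ℝ E] [FiniteDimensional ℝ E] {a b γ z h C₀ C₁ : ℝ}
    {g : ℝ → ℝ → E}
    (hab : a ≤ b) (hγ : 0 < γ) (hz : 1 < z) (hh : 0 < h) (hC₀ : 0 ≤ C₀) (hC₁ : 0 ≤ C₁)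
    (hg : ContinuousOn (fun p : ℝ × ℝ => g p.1 p.2) (Icc a b ×ˢ Icc a b))
    (hgC : ∀ s ∈ Icc a b, ∀ t ∈ Icc a b, ‖g s t‖ ≤ C₀ * |t - s| ^ γ)
    (hN : ∀ s ∈ Icc a b, ∀ u ∈ Icc a b, ∀ t ∈ Icc a b, ∀ l, |u - s| ≤ l → |t - u| ≤ l → l ≤ h →
      ‖opN g s u t‖ ≤ C₁ * l ^ z) :
    ∃ R, IsSewing (Icc a b) (opN g) R := by
  have : ProperSpace E := FiniteDimensional.proper ℝ E
  have hq : (2 : ℝ) ^ (1 - z) < 1 := Real.rpow_lt_one_of_one_lt_of_neg (by norm_num) (by linarith)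
  have hq' : 0 < 1 - (2 : ℝ) ^ (1 - z) := by linarith
  set K := 2 * C₁ / (1 - (2 : ℝ) ^ (1 - z)) with hK
  have hflow : IsAlmostFlow (Icc a b) γ z h C₀ C₁ (2 * K) (fun s t (_ : E) => g s t) :=
    { continuousOn := hg.comp (f := fun p : ℝ × ℝ × E => (p.1, p.2.1)) (by fun_prop)
        fun p hp => ⟨hp.1, hp.2.1⟩
      norm_le := fun s hs t ht _ => hgC s hs t ht
      defect_le := fun s hs u hu t ht l h1 h2 h3 _ _ _ => by
        have e : g s u + g u t - g s t = -opN g s u t := by simp only [opN]; abel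
        rw [e, norm_neg]
        exact hN s hs u hu t ht l h1 h2 h3 }
  obtain ⟨A, -, hA⟩ := hflow.exists_path (t₀ := a) ⟨le_rfl, hab⟩ hγ hz hh hC₀ hC₁ (by positivity)
    (by rw [hK]; field_simp; rfl) 0
  have hAc : ContinuousOn A (Icc a b) := by
    refine continuousOn_of_modulus (α := z) (β := γ) (C := 5 * K) (C₁ := C₀) (by linarith) hγ hh ?_
    intro s hs t ht hst
    have e : A t - A s = (A t - A s - g s t) + g s t := by abel
    rw [e]
    exact (norm_add_le _ _).trans (add_le_add (hA s hs t ht hst) (hgC s hs t ht))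
  have hcont : ContinuousOn (fun p : ℝ × ℝ => g p.1 p.2 - incr A p.1 p.2) (Icc a b ×ˢ Icc a b) :=
    hg.sub (continuousOn_incr hAc)
  obtain ⟨C, -, hC⟩ := exists_holder_of_local (R := fun s t => g s t - incr A s t) isCompact_Icc
    hcont (C := 5 * K) (z := z) (by linarith) hh (fun s hs t ht hst => by
      rw [norm_sub_rev]; exact hA s hs t ht hst)
  refine ⟨fun s t => g s t - incr A s t, ⟨z, hz, hcont, fun t ht => ?_, C, hC⟩,
    fun s _ u _ t _ => ?_⟩
  · have := hgC t ht t ht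
    simp only [sub_self, abs_zero, Real.zero_rpow hγ.ne', mul_zero, norm_le_zero_iff] at this
    simp [this, incr]
  · simp only [opN, incr]; abel

end Sewing

/-! ### Solutions and Euler steps, existence -/

section Solutions
variable {V : Type*} [NormedAddCommGroup V] [NormedSpace ℝ V]
variable {a b t₀ γ δ K : ℝ} {y : V} {φ : V → V →L[ℝ] V} {X : ℝ → V} {XX : ℝ → ℝ → V ⊗[ℝ] V}
  {Y : ℝ → V} {Y' : ℝ → V →L[ℝ] V} {J : Set ℝ}

theorem germ_eq_eulerStep {s : ℝ} (h : Y' s = φ (Y s)) (t : ℝ) :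
    germ X XX (fun r => φ (Y r)) (fun r => (fderiv ℝ φ (Y r)).comp (Y' r)) s t
      = eulerStep φ X XX s t (Y s) := by
  simp only [germ, eulerStep, fieldDeriv, h]

variable [FiniteDimensional ℝ V]

theorem IsRoughPath.exists_bound (hX : IsRoughPath γ J X XX) :
    ∃ A : ℝ, 0 ≤ A ∧ (∀ s ∈ J, ∀ t ∈ J, ‖incr X s t‖ ≤ A * |t - s| ^ γ) ∧
      ∀ s ∈ J, ∀ t ∈ J, ‖XX s t‖ ≤ A * |t - s| ^ (2 * γ) := by
  have h1 := holderNorm_nonneg (γ := γ) (J := J) (R := incr X)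
  have h2 := holderNorm_nonneg (γ := 2 * γ) (J := J) (R := XX)
  refine ⟨holderNorm γ J (incr X) + holderNorm (2 * γ) J XX, by positivity,
    fun s hs t ht => (hX.1.2.norm_le hs ht).trans ?_,
    fun s hs t ht => (hX.2.1.norm_le hs ht).trans ?_⟩
  · gcongr; linarith
  · gcongr; linarith

theorem continuousOn_eulerStep (hφ : C2Bound δ K φ) (hX : IsRoughPath γ J X XX) :
    ContinuousOn (fun p : ℝ × ℝ × V => eulerStep φ X XX p.1 p.2.1 p.2.2) (J ×ˢ J ×ˢ univ) := by
  have h1 : ContinuousOn (fun p : ℝ × ℝ × V => incr X p.1 p.2.1) (J ×ˢ J ×ˢ univ) :=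
    hX.1.2.1.comp (f := fun p : ℝ × ℝ × V => (p.1, p.2.1)) (by fun_prop) fun p hp => ⟨hp.1, hp.2.1⟩
  have h2 : ContinuousOn (fun p : ℝ × ℝ × V => XX p.1 p.2.1) (J ×ˢ J ×ˢ univ) :=
    hX.2.1.1.comp (f := fun p : ℝ × ℝ × V => (p.1, p.2.1)) (by fun_prop) fun p hp => ⟨hp.1, hp.2.1⟩
  have h3 : Continuous fun p : ℝ × ℝ × V => φ p.2.2 :=
    hφ.differentiable.continuous.comp (by fun_prop)
  have h4 : Continuous fun p : ℝ × ℝ × V => fieldDeriv φ p.2.2 :=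
    (hφ.differentiable_fderiv.continuous.comp (by fun_prop)).clm_comp h3
  have h5 : ContinuousOn (fun p : ℝ × ℝ × V => contractL (fieldDeriv φ p.2.2) (XX p.1 p.2.1))
      (J ×ˢ J ×ˢ univ) := (contractL.continuous.comp h4).continuousOn.clm_apply h2
  exact (h3.continuousOn.clm_apply h1).add h5

/-- A path given by Euler steps up to second order has a remainder `δY - φ(Y) δX` of second order. -/
theorem norm_eulerStep_sub_increment_le (hφ : C2Bound δ K φ) {A C r : ℝ} {s t : ℝ} {x y : V}
    (hXX : ‖XX s t‖ ≤ A * r ^ 2) (h : ‖y - x - eulerStep φ X XX s t x‖ ≤ C * r ^ 2) :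
    ‖y - x - φ x (incr X s t)‖ ≤ (K * K * A + C) * r ^ 2 := by
  have e : y - x - φ x (incr X s t)
      = contract (fieldDeriv φ x) (XX s t) + (y - x - eulerStep φ X XX s t x) := by
    simp only [eulerStep]; abel
  have hK := hφ.nonneg
  rw [e]
  calc _ ≤ _ := norm_add_le _ _
    _ ≤ K * K * (A * r ^ 2) + C * r ^ 2 := by
      refine add_le_add ((norm_contract_le _ _).trans ?_) h
      gcongr
      exact hφ.norm_fieldDeriv_le x
    _ = _ := by ring

/-- The Euler step is of order `γ` in the length of the time step. -/
theorem exists_norm_eulerStep_le (hγ : 0 < γ) (hφ : C2Bound δ K φ)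
    (hX : IsRoughPath γ (Icc a b) X XX) :
    ∃ C, 0 ≤ C ∧ ∀ s ∈ Icc a b, ∀ t ∈ Icc a b, ∀ y, ‖eulerStep φ X XX s t y‖ ≤ C * |t - s| ^ γ := by
  obtain ⟨A, hA0, hA⟩ := hX.1.2.exists_of_le isCompact_Icc hγ le_rfl
  obtain ⟨A₁, hA₁0, hA₁⟩ := hX.2.1.exists_of_le isCompact_Icc hγ (by linarith)
  have hK := hφ.nonneg
  refine ⟨K * A + K * K * A₁, by positivity, fun s hs t ht y => ?_⟩
  refine (hφ.norm_eulerStep_le X XX s t y).trans ?_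
  calc _ ≤ K * (A * |t - s| ^ γ) + K * K * (A₁ * |t - s| ^ γ) := by
        gcongr
        exacts [hA s hs t ht, hA₁ s hs t ht]
    _ = _ := by ring

/-- The germ of the integral of `φ(Y)` can be sewn when `(Y, φ(Y))` is controlled by `X`. -/
theorem exists_isSewing_germ (hγ : 1 / 3 < γ) (hab : a ≤ b) (hφ : C2Bound δ K φ)
    (hX : IsRoughPath γ (Icc a b) X XX) (hY : IsControlled γ (2 * γ) (Icc a b) X Y Y')
    (hY' : ∀ t ∈ Icc a b, Y' t = φ (Y t)) :
    ∃ R, IsSewing (Icc a b)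
      (opN (germ X XX (fun r => φ (Y r)) (fun r => (fderiv ℝ φ (Y r)).comp (Y' r)))) R := by
  have hγ0 : 0 < γ := by linarith
  obtain ⟨A, hA0, hA, hA2⟩ := hX.exists_bound
  obtain ⟨C₀, hC₀, hC⟩ := exists_norm_eulerStep_le hγ0 hφ hX
  set B := holderNorm (2 * γ) (Icc a b) (remainder X Y Y') with hB
  have hB0 : 0 ≤ B := holderNorm_nonneg
  have hK := hφ.nonneg
  have hcont : ContinuousOn (fun p : ℝ × ℝ => eulerStep φ X XX p.1 p.2 (Y p.1))
      (Icc a b ×ˢ Icc a b) := by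
    refine (continuousOn_eulerStep hφ hX).comp (f := fun p : ℝ × ℝ => (p.1, p.2, Y p.1)) ?_
      fun p hp => ⟨hp.1, hp.2, trivial⟩
    exact continuousOn_fst.prodMk (continuousOn_snd.prodMk
      (hY.1.1.comp continuousOn_fst fun p hp => hp.1))
  refine exists_isSewing (γ := γ) (z := 3 * γ) (h := 1) (C₀ := C₀)
    (C₁ := (K * (K * A + B) ^ 2 + K * B) * A + 2 * K * K * (K * A + B) * A) hab hγ0
    (by linarith) one_pos hC₀ (by positivity)
    (hcont.congr fun p hp => germ_eq_eulerStep (hY' _ hp.1) _) ?_ ?_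
  · intro s hs t ht
    rw [germ_eq_eulerStep (hY' s hs)]
    exact hC s hs t ht _
  · intro s hs u hu t ht l h1 h2 h3
    have hl : 0 ≤ l := (abs_nonneg _).trans h1
    have e := eulerStep_add_eulerStep_sub (φ := φ) (hX.2.2 s hs u hu t ht) (Y s) (Y u)
    rw [← norm_neg]
    have e2 : -opN (germ X XX (fun r => φ (Y r)) (fun r => (fderiv ℝ φ (Y r)).comp (Y' r))) s u t
        = stepDefect φ (Y s) (Y u) (incr X s u) (incr X u t) (XX u t) := by
      rw [← e]
      simp only [opN, germ_eq_eulerStep (hY' s hs), germ_eq_eulerStep (hY' u hu)]; abel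
    rw [e2, rpow_three_mul_eq_cube hl]
    have r1 : |u - s| ^ γ ≤ l ^ γ := by gcongr
    have r2 : |t - u| ^ γ ≤ l ^ γ := by gcongr
    refine hφ.norm_stepDefect_le hA0 (by positivity) (Real.rpow_le_one hl h3 hγ0.le) hB0
      ((hA s hs u hu).trans (by gcongr)) ((hA u hu t ht).trans (by gcongr)) ?_ ?_
    · refine (hA2 u hu t ht).trans ?_
      rw [rpow_two_mul_eq_sq (abs_nonneg _)]
      gcongr
    · have := hY.2.2.norm_le hs hu
      simp only [remainder, hY' s hs] at this
      refine this.trans ?_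
      rw [rpow_two_mul_eq_sq (abs_nonneg _)]
      simp only [hB]
      gcongr

/-- The increments of a solution are those of the second order Euler step, up to a superlinear
error. -/
theorem IsSolution.exists_bound (hγ : 1 / 3 < γ) (ht₀ : t₀ ∈ Icc a b) (hφ : C2Bound δ K φ)
    (hX : IsRoughPath γ (Icc a b) X XX) (hY : IsSolution γ (Icc a b) t₀ y φ X XX Y Y') :
    ∃ C z : ℝ, 1 < z ∧ ∀ s ∈ Icc a b, ∀ t ∈ Icc a b,
      ‖Y t - Y s - eulerStep φ X XX s t (Y s)‖ ≤ C * |t - s| ^ z := by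
  obtain ⟨hc, hY', hint⟩ := hY
  obtain ⟨R, hR⟩ := exists_isSewing_germ hγ (ht₀.1.trans ht₀.2) hφ hX hc hY'
  have hS := hR.sewing
  obtain ⟨⟨z, hz, hH⟩, hN⟩ := hS
  refine ⟨holderNorm z (Icc a b) (sewing (Icc a b) (opN (germ X XX (fun r => φ (Y r))
    (fun r => (fderiv ℝ φ (Y r)).comp (Y' r))))), z, hz, fun s hs t ht => ?_⟩
  have e : Y t - Y s - eulerStep φ X XX s t (Y s) = -sewing (Icc a b)
      (opN (germ X XX (fun r => φ (Y r)) (fun r => (fderiv ℝ φ (Y r)).comp (Y' r)))) s t := by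
    have h := hN t₀ ht₀ s hs t ht
    have h1 := hint t ht
    have h2 := hint s hs
    simp only [roughIntegral] at h1 h2
    have h3 := congrArg₂ (· - ·) h1 h2
    rw [h3, ← germ_eq_eulerStep (X := X) (XX := XX) (hY' s hs)]
    simp only [opN] at h ⊢
    rw [← sub_eq_zero] at h ⊢
    rw [← neg_eq_zero, ← h]
    abel
  rw [e, norm_neg]
  exact hH.norm_le hs ht

/-- The integral from `t₀` to `t₀` vanishes, because `N (Λ N G) = N G` at `(t₀, t₀, t₀)` reads
`(Λ N G)_{t₀ t₀} = G_{t₀ t₀}`. -/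
theorem IsSolution.initial (hγ : 1 / 3 < γ) (ht₀ : t₀ ∈ Icc a b) (hφ : C2Bound δ K φ)
    (hX : IsRoughPath γ (Icc a b) X XX) (hY : IsSolution γ (Icc a b) t₀ y φ X XX Y Y') :
    Y t₀ = y := by
  obtain ⟨hc, hY', hint⟩ := hY
  obtain ⟨R, hR⟩ := exists_isSewing_germ hγ (ht₀.1.trans ht₀.2) hφ hX hc hY'
  have h := hR.sewing.2 t₀ ht₀ t₀ ht₀ t₀ ht₀
  rw [hint t₀ ht₀, roughIntegral]
  simp only [opN, sub_self, zero_sub, neg_inj] at h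
  rw [h, sub_self, add_zero]

/-- Conversely, a path whose increments are those of the Euler step up to an error of order
`3 * γ` solves the equation. -/
theorem isSolution_of_bound (hγ : 1 / 3 < γ) (ht₀ : t₀ ∈ Icc a b) (hφ : C2Bound δ K φ)
    (hX : IsRoughPath γ (Icc a b) X XX) {C h : ℝ} (hh : 0 < h) (hC : 0 ≤ C) (hY₀ : Y t₀ = y)
    (hY : ∀ s ∈ Icc a b, ∀ t ∈ Icc a b, |t - s| < h →
      ‖Y t - Y s - eulerStep φ X XX s t (Y s)‖ ≤ C * |t - s| ^ (3 * γ)) :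
    IsSolution γ (Icc a b) t₀ y φ X XX Y (fun t => φ (Y t)) := by
  have hγ0 : 0 < γ := by linarith
  have hK := hφ.nonneg
  obtain ⟨A, hA0, hA, hA2⟩ := hX.exists_bound
  obtain ⟨C₀, hC₀, hC₀'⟩ := exists_norm_eulerStep_le hγ0 hφ hX
  have hYsub : ∀ s ∈ Icc a b, ∀ t ∈ Icc a b, |t - s| < h →
      ‖Y t - Y s‖ ≤ C * |t - s| ^ (3 * γ) + C₀ * |t - s| ^ γ := by
    intro s hs t ht hst
    have e : Y t - Y s = (Y t - Y s - eulerStep φ X XX s t (Y s)) + eulerStep φ X XX s t (Y s) := by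
      abel
    rw [e]
    exact (norm_add_le _ _).trans (add_le_add (hY s hs t ht hst) (hC₀' s hs t ht _))
  have hYc : ContinuousOn Y (Icc a b) :=
    continuousOn_of_modulus (by linarith) hγ0 hh hYsub
  have hφY : ContinuousOn (fun t => φ (Y t)) (Icc a b) :=
    hφ.differentiable.continuous.comp_continuousOn hYc
  have hh' : 0 < min h 1 := by positivity
  obtain ⟨H, hH0, hH⟩ := exists_holder_of_local (R := incr Y) isCompact_Icc (continuousOn_incr hYc)
    (C := C + C₀) (z := γ) hγ0 hh' (fun s hs t ht hst => by
      refine (hYsub s hs t ht (hst.trans_le (min_le_left _ _))).trans ?_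
      have := rpow_le_of_le_one (abs_nonneg (t - s)) (hst.trans_le (min_le_right _ _)).le hγ0
        (by linarith : γ ≤ 3 * γ)
      rw [add_mul]
      gcongr)
  have hrem : ContinuousOn (fun p : ℝ × ℝ => remainder X Y (fun t => φ (Y t)) p.1 p.2)
      (Icc a b ×ˢ Icc a b) :=
    (continuousOn_incr hYc).sub
      ((hφY.comp continuousOn_fst fun p hp => hp.1).clm_apply hX.1.2.1)
  have hstep : ContinuousOn (fun p : ℝ × ℝ => eulerStep φ X XX p.1 p.2 (Y p.1) - incr Y p.1 p.2)
      (Icc a b ×ˢ Icc a b) := by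
    refine ContinuousOn.sub ?_ (continuousOn_incr hYc)
    refine (continuousOn_eulerStep hφ hX).comp (f := fun p : ℝ × ℝ => (p.1, p.2, Y p.1)) ?_
      fun p hp => ⟨hp.1, hp.2, trivial⟩
    exact continuousOn_fst.prodMk (continuousOn_snd.prodMk
      (hYc.comp continuousOn_fst fun p hp => hp.1))
  have hcontr : IsControlled γ (2 * γ) (Icc a b) X Y (fun t => φ (Y t)) := by
    refine ⟨⟨hYc, continuousOn_incr hYc, fun t _ => by simp [incr], H, hH⟩,
      ⟨hφY, continuousOn_incr hφY, fun t _ => by simp [incr], K * H, fun s hs t ht => ?_⟩,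
      hrem, fun t _ => by simp [remainder, incr], ?_⟩
    · rw [show 2 * γ - γ = γ by ring, mul_assoc]
      exact (hφ.sub_le _ _).trans (by gcongr; exact hH s hs t ht)
    · obtain ⟨C', -, hC'⟩ := exists_holder_of_local isCompact_Icc hrem
        (C := K * K * A + C) (z := 2 * γ) (by linarith) hh' (fun s hs t ht hst => by
          have hst1 := (hst.trans_le (min_le_right _ _)).le
          rw [rpow_two_mul_eq_sq (abs_nonneg _)]
          refine norm_eulerStep_sub_increment_le (XX := XX) hφ ?_ ?_
          · rw [← rpow_two_mul_eq_sq (abs_nonneg _)]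
            exact hA2 s hs t ht
          · rw [← rpow_two_mul_eq_sq (abs_nonneg _)]
            refine (hY s hs t ht (hst.trans_le (min_le_left _ _))).trans ?_
            exact mul_le_mul_of_nonneg_left
              (rpow_le_of_le_one (abs_nonneg _) hst1 (by linarith) (by linarith)) hC)
      exact ⟨C', hC'⟩
  have hgerm : ∀ s t, germ X XX (fun r => φ (Y r)) (fun r => (fderiv ℝ φ (Y r)).comp (φ (Y r))) s t
      = eulerStep φ X XX s t (Y s) := fun s t => germ_eq_eulerStep rfl t
  have hsew : IsSewing (Icc a b)
      (opN (germ X XX (fun r => φ (Y r)) (fun r => (fderiv ℝ φ (Y r)).comp (φ (Y r)))))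
      (fun s t => eulerStep φ X XX s t (Y s) - incr Y s t) := by
    obtain ⟨C', -, hC'⟩ := exists_holder_of_local isCompact_Icc
      (R := fun s t => eulerStep φ X XX s t (Y s) - incr Y s t) hstep
      (C := C) (z := 3 * γ) (by linarith) hh (fun s hs t ht hst => by
        rw [norm_sub_rev]
        exact hY s hs t ht hst)
    refine ⟨⟨3 * γ, by linarith, hstep, fun t ht => ?_, C', hC'⟩, fun s _ u _ t _ => ?_⟩
    · have := hC₀' t ht t ht (Y t)
      simp only [sub_self, abs_zero, Real.zero_rpow hγ0.ne', mul_zero, norm_le_zero_iff] at this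
      simp [this, incr]
    · simp only [opN, hgerm, incr]; abel
  refine ⟨hcontr, fun _ _ => rfl, fun t ht => ?_⟩
  rw [roughIntegral, hsew.sewing.eqOn hsew ht₀ ht, hgerm, ← hY₀]
  simp only [incr]; abel

/-- Existence: the Euler steps form an almost flow, and the path it produces solves the equation. -/
theorem exists_isSolution (hγ : 1 / 3 < γ) (ht₀ : t₀ ∈ Icc a b) (hφ : C2Bound δ K φ)
    (hX : IsRoughPath γ (Icc a b) X XX) (y : V) :
    ∃ Y Y', IsSolution γ (Icc a b) t₀ y φ X XX Y Y' := by
  have : ProperSpace V := FiniteDimensional.proper ℝ V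
  have hγ0 : 0 < γ := by linarith
  have hK := hφ.nonneg
  obtain ⟨A, hA0, hA, hA2⟩ := hX.exists_bound
  obtain ⟨C₀, hC₀, hC₀'⟩ := exists_norm_eulerStep_le hγ0 hφ hX
  have hq : (2 : ℝ) ^ (1 - 3 * γ) < 1 :=
    Real.rpow_lt_one_of_one_lt_of_neg (by norm_num) (by linarith)
  have hq' : 0 < 1 - (2 : ℝ) ^ (1 - 3 * γ) := by linarith
  set B := K * K * A + 1 with hB
  set C₁ := (K * (K * A + B) ^ 2 + K * B) * A + 2 * K * K * (K * A + B) * A with hC₁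
  have hC₁0 : 0 ≤ C₁ := by positivity
  set M := 2 * C₁ / (1 - (2 : ℝ) ^ (1 - 3 * γ)) with hM
  have hM0 : 0 ≤ M := by positivity
  obtain ⟨h, hh, hh1, hhM⟩ := exists_pos_mul_rpow_le (c := 2 * M) hγ0 one_pos
  have hflow : IsAlmostFlow (Icc a b) γ (3 * γ) h C₀ C₁ (2 * M) (eulerStep φ X XX) :=
    { continuousOn := continuousOn_eulerStep hφ hX
      norm_le := hC₀'
      defect_le := fun s hs u hu t ht l h1 h2 h3 x x' hx => by
        have hl : 0 ≤ l := (abs_nonneg _).trans h1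
        have r1 : |u - s| ^ γ ≤ l ^ γ := by gcongr
        have r2 : |t - u| ^ γ ≤ l ^ γ := by gcongr
        rw [eulerStep_add_eulerStep_sub (hX.2.2 s hs u hu t ht), rpow_three_mul_eq_cube hl]
        refine hφ.norm_stepDefect_le hA0 (by positivity)
          (Real.rpow_le_one hl (h3.trans hh1) hγ0.le) (by positivity)
          ((hA s hs u hu).trans (by gcongr)) ((hA u hu t ht).trans (by gcongr)) ?_ ?_
        · refine (hA2 u hu t ht).trans ?_
          rw [rpow_two_mul_eq_sq (abs_nonneg _)]
          gcongr
        · refine norm_eulerStep_sub_increment_le (XX := XX) hφ ?_ ?_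
          · refine (hA2 s hs u hu).trans ?_
            rw [rpow_two_mul_eq_sq (abs_nonneg _)]
            gcongr
          · -- The smallness of `h` absorbs the constant `M`, so that `C₁` does not depend on it.
            refine hx.trans ?_
            rw [rpow_three_mul_eq_cube hl, show 2 * M * (l ^ γ) ^ 3 = (2 * M * l ^ γ) * (l ^ γ) ^ 2
              by ring]
            gcongr
            refine le_trans ?_ hhM
            gcongr }
  obtain ⟨Y, hY₀, hY⟩ := hflow.exists_path ht₀ hγ0 (by linarith) hh hC₀ hC₁0 hM0
    (by rw [hM]; field_simp; rfl) y
  exact ⟨Y, _, isSolution_of_bound hγ ht₀ hφ hX hh (by positivity) hY₀ hY⟩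

end Solutions

/-! ### Stability of solutions -/

section Stability
variable {V : Type*} [NormedAddCommGroup V] [NormedSpace ℝ V]

/-- Two solutions on `J`, in the form in which they are compared: all the norms which enter are at
most `K`, and the data of the two equations other than the initial values differ by at most `ρ`. -/
structure SolutionPair [FiniteDimensional ℝ V] (γ δ K ρ : ℝ) (J : Set ℝ)
    (φ φ₁ : V → V →L[ℝ] V) (X X₁ : ℝ → V) (XX XX₁ : ℝ → ℝ → V ⊗[ℝ] V) (Y Y₁ : ℝ → V) : Prop where
  field : C2Bound δ K φ
  field₁ : C2Bound δ K φ₁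
  field_sub : C2Bound δ ρ fun x => φ x - φ₁ x
  chen : ∀ s ∈ J, ∀ u ∈ J, ∀ t ∈ J, opN XX s u t = incr X s u ⊗ₜ[ℝ] incr X u t
  chen₁ : ∀ s ∈ J, ∀ u ∈ J, ∀ t ∈ J, opN XX₁ s u t = incr X₁ s u ⊗ₜ[ℝ] incr X₁ u t
  driver : ∀ s ∈ J, ∀ t ∈ J, ‖incr X s t‖ ≤ K * |t - s| ^ γ
  driver_sub : ∀ s ∈ J, ∀ t ∈ J, ‖incr X s t - incr X₁ s t‖ ≤ ρ * |t - s| ^ γ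
  area : ∀ s ∈ J, ∀ t ∈ J, ‖XX s t‖ ≤ K * |t - s| ^ (2 * γ)
  area_sub : ∀ s ∈ J, ∀ t ∈ J, ‖XX s t - XX₁ s t‖ ≤ ρ * |t - s| ^ (2 * γ)
  path : ∀ s ∈ J, ∀ t ∈ J, ‖Y t - Y s‖ ≤ K * |t - s| ^ γ
  path₁ : ∀ s ∈ J, ∀ t ∈ J, ‖Y₁ t - Y₁ s‖ ≤ K * |t - s| ^ γ
  rem : ∀ s ∈ J, ∀ t ∈ J, ‖Y t - Y s - φ (Y s) (incr X s t)‖ ≤ K * |t - s| ^ (2 * γ)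
  rem₁ : ∀ s ∈ J, ∀ t ∈ J, ‖Y₁ t - Y₁ s - φ₁ (Y₁ s) (incr X₁ s t)‖ ≤ K * |t - s| ^ (2 * γ)
  step : ∃ C z : ℝ, 1 < z ∧ ∀ s ∈ J, ∀ t ∈ J,
    ‖Y t - Y s - eulerStep φ X XX s t (Y s)‖ ≤ C * |t - s| ^ z
  step₁ : ∃ C z : ℝ, 1 < z ∧ ∀ s ∈ J, ∀ t ∈ J,
    ‖Y₁ t - Y₁ s - eulerStep φ₁ X₁ XX₁ s t (Y₁ s)‖ ≤ C * |t - s| ^ z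

/-- The distance of two paths on `I`, as paths controlled by `X` and `X₁` with derivatives `φ(Y)`
and `φ₁(Y₁)`, is at most `S`. -/
structure PairBound (γ S : ℝ) (I : Set ℝ) (φ φ₁ : V → V →L[ℝ] V) (X X₁ : ℝ → V)
    (Y Y₁ : ℝ → V) : Prop where
  sup : ∀ s ∈ I, ‖Y s - Y₁ s‖ ≤ S
  incr : ∀ s ∈ I, ∀ t ∈ I, ‖(Y t - Y₁ t) - (Y s - Y₁ s)‖ ≤ S * |t - s| ^ γ
  rem : ∀ s ∈ I, ∀ t ∈ I, ‖(Y t - Y s - φ (Y s) (Rough.incr X s t))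
    - (Y₁ t - Y₁ s - φ₁ (Y₁ s) (Rough.incr X₁ s t))‖ ≤ S * |t - s| ^ (2 * γ)

variable {γ δ K ρ S h : ℝ} {J I : Set ℝ} {φ φ₁ : V → V →L[ℝ] V} {X X₁ : ℝ → V}
  {XX XX₁ : ℝ → ℝ → V ⊗[ℝ] V} {Y Y₁ : ℝ → V}

theorem PairBound.mono {S' : ℝ} (hP : PairBound γ S I φ φ₁ X X₁ Y Y₁) (hS : S ≤ S') :
    PairBound γ S' I φ φ₁ X X₁ Y Y₁ where
  sup s hs := (hP.sup s hs).trans hS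
  incr s hs t ht := (hP.incr s hs t ht).trans (by gcongr)
  rem s hs t ht := (hP.rem s hs t ht).trans (by gcongr)

variable [FiniteDimensional ℝ V]

/-- The difference of the errors of the two Euler steps, estimated by sewing. -/
theorem SolutionPair.norm_step_sub_le (hγ : 0 < γ) (hδ₀ : 0 < δ) (hδ₁ : δ < 1)
    (hγδ : 1 < (2 + δ) * γ) (hK : 1 ≤ K)
    (hp : SolutionPair γ δ K ρ J φ φ₁ X X₁ XX XX₁ Y Y₁) (hI : Convex ℝ I) (hIJ : I ⊆ J)
    (hlen : ∀ s ∈ I, ∀ t ∈ I, |t - s| ≤ 1) (hρS : ρ ≤ S)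
    (hP : PairBound γ S I φ φ₁ X X₁ Y Y₁) :
    ∀ s ∈ I, ∀ t ∈ I, ‖(Y t - Y s - eulerStep φ X XX s t (Y s))
      - (Y₁ t - Y₁ s - eulerStep φ₁ X₁ XX₁ s t (Y₁ s))‖
      ≤ 20 * K ^ 4 * S / (1 - 2 ^ (1 - (2 + δ) * γ)) * |t - s| ^ ((2 + δ) * γ) := by
  obtain ⟨C, z, hz, hC⟩ := hp.step
  obtain ⟨C₁, z₁, hz₁, hC₁⟩ := hp.step₁
  have hρ := hp.field_sub.nonneg
  refine norm_le_of_midpoint hI (D := fun s t => (Y t - Y s - eulerStep φ X XX s t (Y s))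
      - (Y₁ t - Y₁ s - eulerStep φ₁ X₁ XX₁ s t (Y₁ s))) hγδ hz hz₁ (fun s hs t ht =>
    (norm_sub_le _ _).trans (add_le_add (hC s (hIJ hs) t (hIJ ht)) (hC₁ s (hIJ hs) t (hIJ ht)))) ?_
  intro s hs t ht
  have hu : (s + t) / 2 ∈ I := by
    have := hI hs ht (a := 1 / 2) (b := 1 / 2) (by norm_num) (by norm_num) (by norm_num)
    simpa [smul_eq_mul, add_div, div_eq_inv_mul, mul_add] using this
  have a0 := abs_nonneg (t - s)
  have a1 : |(s + t) / 2 - s| ≤ |t - s| := by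
    rw [show (s + t) / 2 - s = (t - s) / 2 by ring, abs_div, abs_two]; linarith
  have a2 : |t - (s + t) / 2| ≤ |t - s| := by
    rw [show t - (s + t) / 2 = (t - s) / 2 by ring, abs_div, abs_two]; linarith
  set u := (s + t) / 2
  set l := |t - s|
  have r1 : |u - s| ^ γ ≤ l ^ γ := by gcongr
  have r2 : |t - u| ^ γ ≤ l ^ γ := by gcongr
  have q1 : |u - s| ^ (2 * γ) ≤ (l ^ γ) ^ 2 := by rw [← rpow_two_mul_eq_sq a0]; gcongr
  have q2 : |t - u| ^ (2 * γ) ≤ (l ^ γ) ^ 2 := by rw [← rpow_two_mul_eq_sq a0]; gcongr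
  have hS : 0 ≤ S := hρ.trans hρS
  have sJ := hIJ hs
  have uJ := hIJ hu
  have tJ := hIJ ht
  have key := norm_stepDefect_sub_le (r := l ^ γ) hδ₀.le hδ₁.le hp.field hp.field₁
    (hp.field_sub.mono hρS) hK (by positivity) (Real.rpow_le_one a0 (hlen s hs t ht) hγ.le)
    (hP.sup s hs) (hP.sup u hu) ((hP.incr s hs u hu).trans (by gcongr))
    ((hp.path s sJ u uJ).trans (by gcongr)) ((hp.path₁ s sJ u uJ).trans (by gcongr))
    ((hp.rem s sJ u uJ).trans (by gcongr)) ((hp.rem₁ s sJ u uJ).trans (by gcongr))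
    ((hP.rem s hs u hu).trans (by gcongr)) ((hp.driver u uJ t tJ).trans (by gcongr))
    ((hp.driver_sub u uJ t tJ).trans (by gcongr)) ((hp.area u uJ t tJ).trans (by gcongr))
    ((hp.area_sub u uJ t tJ).trans (by gcongr))
  rw [← eulerStep_add_eulerStep_sub (hp.chen s sJ u uJ t tJ),
    ← eulerStep_add_eulerStep_sub (hp.chen₁ s sJ u uJ t tJ)] at key
  have el : (l ^ γ) ^ 2 * (l ^ γ) ^ δ = l ^ ((2 + δ) * γ) := by
    rw [← rpow_two_mul_eq_sq a0, ← Real.rpow_mul a0, ← Real.rpow_add_of_nonneg a0 (by positivity)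
      (by positivity)]
    ring_nf
  rw [el] at key
  have e : (Y t - Y s - eulerStep φ X XX s t (Y s))
      - (Y₁ t - Y₁ s - eulerStep φ₁ X₁ XX₁ s t (Y₁ s))
      = ((Y u - Y s - eulerStep φ X XX s u (Y s))
          - (Y₁ u - Y₁ s - eulerStep φ₁ X₁ XX₁ s u (Y₁ s)))
        + ((Y t - Y u - eulerStep φ X XX u t (Y u))
          - (Y₁ t - Y₁ u - eulerStep φ₁ X₁ XX₁ u t (Y₁ u)))
        + (eulerStep φ X XX s u (Y s) + eulerStep φ X XX u t (Y u) - eulerStep φ X XX s t (Y s)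
          - (eulerStep φ₁ X₁ XX₁ s u (Y₁ s) + eulerStep φ₁ X₁ XX₁ u t (Y₁ u)
            - eulerStep φ₁ X₁ XX₁ s t (Y₁ s))) := by abel
  rw [e]
  exact norm_add₃_le.trans (by gcongr)

/-- On a short interval the a priori distance `S` of the two solutions enters the estimate of
their distance with a small coefficient only. -/
theorem SolutionPair.pairBound_improve (hγ : 0 < γ) (hδ₀ : 0 < δ) (hδ₁ : δ < 1)
    (hγδ : 1 < (2 + δ) * γ) (hK : 1 ≤ K)
    (hp : SolutionPair γ δ K ρ J φ φ₁ X X₁ XX XX₁ Y Y₁) (hI : Convex ℝ I) (hIJ : I ⊆ J)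
    (hh1 : h ≤ 1) (hlen : ∀ s ∈ I, ∀ t ∈ I, |t - s| ≤ h) (hρS : ρ ≤ S)
    (hP : PairBound γ S I φ φ₁ X X₁ Y Y₁) {s₀ : ℝ} (hs₀ : s₀ ∈ I) :
    PairBound γ (8 * K ^ 3 * (‖Y s₀ - Y₁ s₀‖ + ρ)
      + 28 * K ^ 4 / (1 - 2 ^ (1 - (2 + δ) * γ)) * h ^ (δ * γ) * S) I φ φ₁ X X₁ Y Y₁ := by
  have hq : (2 : ℝ) ^ (1 - (2 + δ) * γ) < 1 :=
    Real.rpow_lt_one_of_one_lt_of_neg (by norm_num) (by linarith)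
  have hq0 : 0 ≤ (2 : ℝ) ^ (1 - (2 + δ) * γ) := by positivity
  set q := (2 : ℝ) ^ (1 - (2 + δ) * γ)
  set κ := 1 / (1 - q) with hκ
  have hκ1 : 1 ≤ κ := by rw [hκ, le_div_iff₀ (by linarith)]; linarith
  have hρ := hp.field_sub.nonneg
  have hS : 0 ≤ S := hρ.trans hρS
  have hh0 : 0 ≤ h := (abs_nonneg _).trans (hlen s₀ hs₀ s₀ hs₀)
  set η := h ^ (δ * γ) with hη
  have hη0 : 0 ≤ η := by positivity
  have hγη : h ^ γ ≤ η := rpow_le_of_le_one hh0 hh1 (by positivity) (by nlinarith)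
  have hK0 : 0 ≤ K := by linarith
  set p := ‖Y s₀ - Y₁ s₀‖ + ρ with hpdef
  have hp0 : 0 ≤ p := by positivity
  set S' := p + η * S with hS'
  have hS'0 : 0 ≤ S' := by positivity
  have hρS' : ρ ≤ S' := by
    have : 0 ≤ η * S := by positivity
    have := norm_nonneg (Y s₀ - Y₁ s₀)
    linarith
  have hsup : ∀ s ∈ I, ‖Y s - Y₁ s‖ ≤ S' := by
    intro s hs
    have h1 := hP.incr s₀ hs₀ s hs
    have h2 : |s - s₀| ^ γ ≤ η :=
      (Real.rpow_le_rpow (abs_nonneg _) (hlen s₀ hs₀ s hs) hγ.le).trans hγη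
    have h3 : S * |s - s₀| ^ γ ≤ η * S := by rw [mul_comm η]; gcongr
    have h4 := norm_add_le ((Y s - Y₁ s) - (Y s₀ - Y₁ s₀)) (Y s₀ - Y₁ s₀)
    rw [sub_add_cancel] at h4
    linarith
  have hsew := hp.norm_step_sub_le hγ hδ₀ hδ₁ hγδ hK hI hIJ
    (fun s hs t ht => (hlen s hs t ht).trans hh1) hρS hP
  have hrem : ∀ s ∈ I, ∀ t ∈ I, ‖(Y t - Y s - φ (Y s) (Rough.incr X s t))
      - (Y₁ t - Y₁ s - φ₁ (Y₁ s) (Rough.incr X₁ s t))‖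
      ≤ (5 * K ^ 3 * S' + 20 * K ^ 4 * κ * η * S) * |t - s| ^ (2 * γ) := by
    intro s hs t ht
    have a0 := abs_nonneg (t - s)
    have h1 := hsew s hs t ht
    have el : |t - s| ^ ((2 + δ) * γ) ≤ |t - s| ^ (2 * γ) * η := by
      rw [show (2 + δ) * γ = 2 * γ + δ * γ by ring,
        Real.rpow_add_of_nonneg a0 (by positivity) (by positivity)]
      exact mul_le_mul_of_nonneg_left
        (Real.rpow_le_rpow a0 (hlen s hs t ht) (by positivity)) (by positivity)
    have h2 := norm_contract_sub_contract_le (fieldDeriv φ (Y s)) (fieldDeriv φ₁ (Y₁ s)) (XX s t)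
      (XX₁ s t)
    have e : (Y t - Y s - φ (Y s) (Rough.incr X s t))
        - (Y₁ t - Y₁ s - φ₁ (Y₁ s) (Rough.incr X₁ s t))
        = (contract (fieldDeriv φ (Y s)) (XX s t) - contract (fieldDeriv φ₁ (Y₁ s)) (XX₁ s t))
          + ((Y t - Y s - eulerStep φ X XX s t (Y s))
            - (Y₁ t - Y₁ s - eulerStep φ₁ X₁ XX₁ s t (Y₁ s))) := by
      simp only [eulerStep]; abel
    rw [e]
    calc _ ≤ _ := norm_add_le _ _
      _ ≤ (4 * K ^ 2 * S' * (K * |t - s| ^ (2 * γ)) + K * K * (S' * |t - s| ^ (2 * γ)))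
          + 20 * K ^ 4 * S / (1 - q) * (|t - s| ^ (2 * γ) * η) := by
        refine add_le_add (h2.trans ?_) (h1.trans ?_)
        · gcongr
          exacts [norm_fieldDeriv_field_sub_le hp.field hp.field₁ (hp.field_sub.mono hρS') hK
            (hsup s hs), hp.area s (hIJ hs) t (hIJ ht), hp.field₁.norm_fieldDeriv_le _,
            (hp.area_sub s (hIJ hs) t (hIJ ht)).trans (by gcongr)]
        · have : 0 < 1 - q := by linarith
          gcongr
      _ = ((4 * K ^ 3 + K ^ 2) * S' + 20 * K ^ 4 * κ * η * S) * |t - s| ^ (2 * γ) := by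
        rw [hκ]; ring
      _ ≤ _ := by
        have : K ^ 2 ≤ K ^ 3 := pow_le_pow_right₀ hK (by norm_num)
        gcongr
        linarith
  have hK34 : K ^ 3 ≤ K ^ 4 := pow_le_pow_right₀ hK (by norm_num)
  have hK23 : K ^ 2 ≤ K ^ 3 := pow_le_pow_right₀ hK (by norm_num)
  have hK3 : 1 ≤ K ^ 3 := one_le_pow₀ hK
  have hηS : 0 ≤ η * S := by positivity
  have hKκ : K ^ 3 ≤ K ^ 4 * κ := by nlinarith [show (0 : ℝ) ≤ K ^ 4 by positivity]
  have t1 : K ^ 3 * (η * S) ≤ K ^ 4 * κ * (η * S) := by gcongr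
  have t2 : K ^ 2 * S' ≤ K ^ 3 * S' := by gcongr
  have t3 : 1 * S' ≤ K ^ 3 * S' := by gcongr
  have t4 : 0 ≤ K ^ 3 * S' := by positivity
  have t5 : 0 ≤ K ^ 4 * κ * (η * S) := by positivity
  have tot : 8 * K ^ 3 * S' + 20 * K ^ 4 * κ * η * S
      ≤ 8 * K ^ 3 * p + 28 * K ^ 4 / (1 - q) * η * S := by
    have : 28 * K ^ 4 / (1 - q) = 28 * K ^ 4 * κ := by rw [hκ]; ring
    rw [this]
    have : 8 * K ^ 3 * S' = 8 * K ^ 3 * p + 8 * (K ^ 3 * (η * S)) := by rw [hS']; ring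
    linarith
  refine PairBound.mono ⟨fun s hs => (hsup s hs).trans ?_, fun s hs t ht => ?_,
    fun s hs t ht => (hrem s hs t ht).trans ?_⟩ tot
  · linarith
  · have e : (Y t - Y₁ t) - (Y s - Y₁ s)
        = (φ (Y s) (Rough.incr X s t) - φ₁ (Y₁ s) (Rough.incr X₁ s t))
          + ((Y t - Y s - φ (Y s) (Rough.incr X s t))
            - (Y₁ t - Y₁ s - φ₁ (Y₁ s) (Rough.incr X₁ s t))) := by abel
    have a0 := abs_nonneg (t - s)
    have hle : |t - s| ^ (2 * γ) ≤ |t - s| ^ γ :=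
      rpow_le_of_le_one a0 ((hlen s hs t ht).trans hh1) hγ (by linarith)
    rw [e]
    calc _ ≤ _ := norm_add_le _ _
      _ ≤ (2 * K * S' * (K * |t - s| ^ γ) + K * (S' * |t - s| ^ γ))
          + (5 * K ^ 3 * S' + 20 * K ^ 4 * κ * η * S) * |t - s| ^ γ := by
        refine add_le_add ((norm_apply_sub_apply_le _ _ _ _).trans ?_)
          ((hrem s hs t ht).trans (by gcongr))
        gcongr
        exacts [norm_field_sub_le hp.field (hp.field_sub.mono hρS') hK (hsup s hs),
          hp.driver s (hIJ hs) t (hIJ ht), hp.field₁.norm_le _,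
          (hp.driver_sub s (hIJ hs) t (hIJ ht)).trans (by gcongr)]
      _ = ((2 * K ^ 2 + K + 5 * K ^ 3) * S' + 20 * K ^ 4 * κ * η * S) * |t - s| ^ γ := by ring
      _ ≤ _ := by
        have : K ≤ K ^ 3 := by nlinarith
        gcongr
        linarith
  · gcongr
    linarith

/-- On a short interval, the distance of two solutions is controlled by the distance of their
values at one point and the distance of the data. -/
theorem SolutionPair.pairBound_local (hγ : 0 < γ) (hδ₀ : 0 < δ) (hδ₁ : δ < 1)
    (hγδ : 1 < (2 + δ) * γ) (hK : 1 ≤ K)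
    (hp : SolutionPair γ δ K ρ J φ φ₁ X X₁ XX XX₁ Y Y₁) (hI : Convex ℝ I) (hIJ : I ⊆ J)
    (hh1 : h ≤ 1) (hlen : ∀ s ∈ I, ∀ t ∈ I, |t - s| ≤ h)
    (hsmall : 28 * K ^ 4 / (1 - 2 ^ (1 - (2 + δ) * γ)) * h ^ (δ * γ) ≤ 1 / 2)
    {s₀ : ℝ} (hs₀ : s₀ ∈ I) :
    PairBound γ (16 * K ^ 3 * (‖Y s₀ - Y₁ s₀‖ + ρ)) I φ φ₁ X X₁ Y Y₁ := by
  have hρ := hp.field_sub.nonneg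
  have hK0 : 0 ≤ K := by linarith
  have hK3 : 1 ≤ K ^ 3 := one_le_pow₀ hK
  set c := 8 * K ^ 3 * (‖Y s₀ - Y₁ s₀‖ + ρ) with hc
  have hc0 : 0 ≤ c := by positivity
  have hcρ : ρ ≤ c := by
    have h1 : 1 * (‖Y s₀ - Y₁ s₀‖ + ρ) ≤ 8 * K ^ 3 * (‖Y s₀ - Y₁ s₀‖ + ρ) := by
      gcongr
      linarith
    linarith [norm_nonneg (Y s₀ - Y₁ s₀)]
  set S₀ := ‖Y s₀ - Y₁ s₀‖ + 2 * K with hS₀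
  have hS₀0 : 0 ≤ S₀ := by positivity
  have base : PairBound γ S₀ I φ φ₁ X X₁ Y Y₁ := by
    have hd : ∀ s ∈ I, ∀ t ∈ I, ‖(Y t - Y₁ t) - (Y s - Y₁ s)‖ ≤ 2 * K * |t - s| ^ γ := by
      intro s hs t ht
      have e : (Y t - Y₁ t) - (Y s - Y₁ s) = (Y t - Y s) - (Y₁ t - Y₁ s) := by abel
      rw [e]
      have h1 := hp.path s (hIJ hs) t (hIJ ht)
      have h2 := hp.path₁ s (hIJ hs) t (hIJ ht)
      have h3 := norm_sub_le (Y t - Y s) (Y₁ t - Y₁ s)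
      linarith
    have hle : 2 * K ≤ S₀ := by rw [hS₀]; linarith [norm_nonneg (Y s₀ - Y₁ s₀)]
    refine ⟨fun s hs => ?_, fun s hs t ht => (hd s hs t ht).trans (by gcongr), fun s hs t ht => ?_⟩
    · have h1 := hd s₀ hs₀ s hs
      have h2 : |s - s₀| ^ γ ≤ 1 :=
        Real.rpow_le_one (abs_nonneg _) ((hlen s₀ hs₀ s hs).trans hh1) hγ.le
      have h3 : 2 * K * |s - s₀| ^ γ ≤ 2 * K * 1 := by gcongr
      have h4 := norm_add_le ((Y s - Y₁ s) - (Y s₀ - Y₁ s₀)) (Y s₀ - Y₁ s₀)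
      rw [sub_add_cancel] at h4
      linarith
    · have h1 := hp.rem s (hIJ hs) t (hIJ ht)
      have h2 := hp.rem₁ s (hIJ hs) t (hIJ ht)
      have h3 : 2 * K * |t - s| ^ (2 * γ) ≤ S₀ * |t - s| ^ (2 * γ) := by gcongr
      refine (norm_sub_le _ _).trans ?_
      linarith
  -- `S ↦ c + S / 2` is iterated starting from the a priori bound; its fixed point is `2 c`.
  have iter : ∀ n : ℕ, PairBound γ (2 * c + (1 / 2) ^ n * S₀) I φ φ₁ X X₁ Y Y₁ := by
    intro n
    induction n with
    | zero => exact base.mono (by simp; linarith)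
    | succ n ih =>
      have hpos : 0 ≤ (1 / 2 : ℝ) ^ n * S₀ := by positivity
      refine (hp.pairBound_improve hγ hδ₀ hδ₁ hγδ hK hI hIJ hh1 hlen (by linarith) ih hs₀).mono ?_
      have : 28 * K ^ 4 / (1 - 2 ^ (1 - (2 + δ) * γ)) * h ^ (δ * γ) * (2 * c + (1 / 2) ^ n * S₀)
          ≤ 1 / 2 * (2 * c + (1 / 2) ^ n * S₀) := by gcongr
      rw [pow_succ (1 / 2 : ℝ) n]
      linarith
  have lim : Tendsto (fun n : ℕ => 2 * c + (1 / 2 : ℝ) ^ n * S₀) atTop (𝓝 (2 * c)) := by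
    have := ((tendsto_pow_atTop_nhds_zero_of_lt_one (by norm_num : (0 : ℝ) ≤ 1 / 2)
      (by norm_num)).mul_const S₀).const_add (2 * c)
    simpa using this
  have e : 16 * K ^ 3 * (‖Y s₀ - Y₁ s₀‖ + ρ) = 2 * c := by rw [hc]; ring
  rw [e]
  exact ⟨fun s hs => ge_of_tendsto' lim fun n => (iter n).sup s hs,
    fun s hs t ht => ge_of_tendsto' (lim.mul_const _) fun n => (iter n).incr s hs t ht,
    fun s hs t ht => ge_of_tendsto' (lim.mul_const _) fun n => (iter n).rem s hs t ht⟩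

/-- Stability of solutions on the whole interval: the local estimate is chained along intervals of
length `h`, whose number depends on `K` and the length of the interval only, and for distant times
the Hölder bounds follow from the uniform bound. -/
theorem exists_pairBound {a b : ℝ} (V : Type*) [NormedAddCommGroup V] [NormedSpace ℝ V]
    [FiniteDimensional ℝ V] (hγ : 0 < γ) (hδ₀ : 0 < δ) (hδ₁ : δ < 1)
    (hγδ : 1 < (2 + δ) * γ) (hK : 1 ≤ K) :
    ∃ M : ℝ, 1 ≤ M ∧ ∀ t₀ ∈ Icc a b, ∀ (ρ : ℝ) (φ φ₁ : V → V →L[ℝ] V) (X X₁ : ℝ → V)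
      (XX XX₁ : ℝ → ℝ → V ⊗[ℝ] V) (Y Y₁ : ℝ → V),
      SolutionPair γ δ K ρ (Icc a b) φ φ₁ X X₁ XX XX₁ Y Y₁ → ‖Y t₀ - Y₁ t₀‖ ≤ ρ →
      PairBound γ (M * ρ) (Icc a b) φ φ₁ X X₁ Y Y₁ := by
  obtain ⟨h, hh, hh1, hsmall⟩ := exists_pos_mul_rpow_le
    (c := 28 * K ^ 4 / (1 - 2 ^ (1 - (2 + δ) * γ))) (mul_pos hδ₀ hγ) one_half_pos
  obtain ⟨n, hn⟩ : ∃ n : ℕ, b - a ≤ n * h := by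
    obtain ⟨n, hn⟩ := exists_nat_ge ((b - a) / h)
    exact ⟨n, by rwa [div_le_iff₀ hh] at hn⟩
  have hK0 : 0 ≤ K := by linarith
  have hK3 : 1 ≤ K ^ 3 := one_le_pow₀ hK
  set c := 16 * K ^ 3 with hc
  set m := (2 * c) ^ n with hm
  have hm1 : 1 ≤ m := one_le_pow₀ (by linarith)
  set T := (n * h) ^ γ with hT
  have hhγ : 0 < h ^ γ := Real.rpow_pos_of_pos hh _
  have hhγ2 : 0 < h ^ (2 * γ) := Real.rpow_pos_of_pos hh _
  have hT0 : 0 ≤ T := by positivity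
  set M₁ := c * (m + 1) with hM₁
  set M₂ := 2 * m / h ^ γ with hM₂
  set M₃ := (2 * m + 3 * K ^ 2 * m * T) / h ^ (2 * γ) with hM₃
  have h1 : 0 ≤ M₁ := by positivity
  have h2 : 0 ≤ M₂ := by positivity
  have h3 : 0 ≤ M₃ := by positivity
  refine ⟨m + M₁ + M₂ + M₃, by linarith, ?_⟩
  intro t₀ ht₀ ρ φ φ₁ X X₁ XX XX₁ Y Y₁ hp hρ₀
  have hρ := hp.field_sub.nonneg
  have loc : ∀ s ∈ Icc a b, ∀ t ∈ Icc a b, |t - s| ≤ h →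
      PairBound γ (c * (‖Y s - Y₁ s‖ + ρ)) (uIcc s t) φ φ₁ X X₁ Y Y₁ := by
    intro s hs t ht hst
    refine hp.pairBound_local hγ hδ₀ hδ₁ hγδ hK (convex_uIcc s t) (ordConnected_Icc.uIcc_subset hs ht)
      hh1 (fun x hx y hy => (abs_sub_le_of_uIcc_subset_uIcc (uIcc_subset_uIcc hx hy)).trans hst)
      hsmall left_mem_uIcc
  have chain : ∀ k : ℕ, ∀ t ∈ Icc a b, |t - t₀| ≤ k * h → ‖Y t - Y₁ t‖ ≤ (2 * c) ^ k * ρ := by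
    intro k
    induction k with
    | zero =>
      intro t ht h0
      have : t = t₀ := by
        rw [Nat.cast_zero, zero_mul] at h0
        exact sub_eq_zero.1 (abs_nonpos_iff.1 h0)
      simpa [this] using hρ₀
    | succ k ih =>
      intro t ht hk
      have hk1 : (0 : ℝ) < k + 1 := by positivity
      push_cast at hk
      -- The point at `k / (k + 1)` of the way from `t₀` to `t`; this works on either side of `t₀`.
      set s := t₀ + (k / (k + 1) : ℝ) * (t - t₀) with hs
      have hs1 : |s - t₀| ≤ k * h := by
        rw [hs, add_sub_cancel_left, abs_mul, abs_of_nonneg (by positivity)]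
        calc (k / (k + 1) : ℝ) * |t - t₀| ≤ k / (k + 1) * ((k + 1) * h) := by gcongr
          _ = _ := by field_simp
      have hs2 : |t - s| ≤ h := by
        have : t - s = (1 / (k + 1) : ℝ) * (t - t₀) := by rw [hs]; field_simp; ring
        rw [this, abs_mul, abs_of_nonneg (by positivity)]
        calc (1 / (k + 1) : ℝ) * |t - t₀| ≤ 1 / (k + 1) * ((k + 1) * h) := by gcongr
          _ = _ := by field_simp
      have hsJ : s ∈ Icc a b := by
        have := (convex_Icc a b).add_smul_sub_mem ht₀ ht (t := (k / (k + 1) : ℝ))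
          ⟨by positivity, by rw [div_le_one hk1]; linarith⟩
        simpa [hs, smul_eq_mul] using this
      have i1 := ih s hsJ hs1
      have i2 := (loc s hsJ t ht hs2).sup t right_mem_uIcc
      have hL : 1 ≤ (2 * c) ^ k := one_le_pow₀ (by linarith)
      have i3 : 1 * ρ ≤ (2 * c) ^ k * ρ := by gcongr
      calc ‖Y t - Y₁ t‖ ≤ c * (‖Y s - Y₁ s‖ + ρ) := i2
        _ ≤ c * ((2 * c) ^ k * ρ + (2 * c) ^ k * ρ) := by gcongr; linarith
        _ = _ := by ring
  have hsup : ∀ t ∈ Icc a b, ‖Y t - Y₁ t‖ ≤ m * ρ := fun t ht => chain n t ht (by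
    refine le_trans ?_ hn
    rw [abs_le]
    exact ⟨by linarith [ht.1, ht₀.2], by linarith [ht.2, ht₀.1]⟩)
  have near : ∀ s ∈ Icc a b, c * (‖Y s - Y₁ s‖ + ρ) ≤ M₁ * ρ := by
    intro s hs
    have := hsup s hs
    calc c * (‖Y s - Y₁ s‖ + ρ) ≤ c * (m * ρ + ρ) := by gcongr
      _ = _ := by rw [hM₁]; ring
  have hsum1 : 0 ≤ M₁ * ρ := by positivity
  have hsum2 : 0 ≤ M₂ * ρ := by positivity
  have hsum3 : 0 ≤ M₃ * ρ := by positivity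
  have hsum0 : 0 ≤ m * ρ := by positivity
  have hdelta : ∀ s ∈ Icc a b, ∀ t ∈ Icc a b, ‖(Y t - Y₁ t) - (Y s - Y₁ s)‖ ≤ 2 * m * ρ := by
    intro s hs t ht
    have := norm_sub_le (Y t - Y₁ t) (Y s - Y₁ s)
    linarith [hsup s hs, hsup t ht]
  refine ⟨fun t ht => (hsup t ht).trans (by linarith), fun s hs t ht => ?_, fun s hs t ht => ?_⟩
  · rcases le_total |t - s| h with hst | hst
    · refine ((loc s hs t ht hst).incr s left_mem_uIcc t right_mem_uIcc).trans ?_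
      exact mul_le_mul_of_nonneg_right (by linarith [near s hs]) (by positivity)
    · calc _ ≤ 2 * m * ρ := hdelta s hs t ht
        _ = M₂ * ρ * h ^ γ := by rw [hM₂]; field_simp
        _ ≤ _ := by gcongr; linarith
  · rcases le_total |t - s| h with hst | hst
    · refine ((loc s hs t ht hst).rem s left_mem_uIcc t right_mem_uIcc).trans ?_
      exact mul_le_mul_of_nonneg_right (by linarith [near s hs]) (by positivity)
    · have e : (Y t - Y s - φ (Y s) (Rough.incr X s t))
            - (Y₁ t - Y₁ s - φ₁ (Y₁ s) (Rough.incr X₁ s t))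
          = ((Y t - Y₁ t) - (Y s - Y₁ s))
            - (φ (Y s) (Rough.incr X s t) - φ₁ (Y₁ s) (Rough.incr X₁ s t)) := by abel
      have hts : |t - s| ^ γ ≤ T := by
        rw [hT]
        gcongr
        refine le_trans ?_ hn
        rw [abs_le]
        exact ⟨by linarith [ht.1, hs.2], by linarith [ht.2, hs.1]⟩
      have hρm : ρ ≤ m * ρ := by nlinarith
      rw [e]
      calc _ ≤ _ := norm_sub_le _ _
        _ ≤ 2 * m * ρ + (2 * K * (m * ρ) * (K * T) + K * (m * ρ * T)) := by
          refine add_le_add (hdelta s hs t ht) ((norm_apply_sub_apply_le _ _ _ _).trans ?_)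
          gcongr
          exacts [norm_field_sub_le hp.field (hp.field_sub.mono hρm) hK (hsup s hs),
            (hp.driver s hs t ht).trans (by gcongr), hp.field₁.norm_le _,
            (hp.driver_sub s hs t ht).trans (by gcongr)]
        _ = (2 * m + (2 * K ^ 2 + K) * m * T) * ρ := by ring
        _ ≤ (2 * m + (3 * K ^ 2) * m * T) * ρ := by
          gcongr
          nlinarith
        _ = M₃ * ρ * h ^ (2 * γ) := by rw [hM₃]; field_simp
        _ ≤ _ := by gcongr; linarith

end Stability

/-! ### Uniqueness and Lipschitz dependence on the data -/

section Assembly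
variable {V : Type*} [NormedAddCommGroup V] [NormedSpace ℝ V]
variable {γ δ K ρ a b t₀ : ℝ} {y y₁ : V} {φ φ₁ : V → V →L[ℝ] V} {X X₁ : ℝ → V}
  {XX XX₁ : ℝ → ℝ → V ⊗[ℝ] V} {Y Y₁ : ℝ → V} {Y' Y₁' : ℝ → V →L[ℝ] V}

theorem IsControlled.norm_rem_le {J : Set ℝ} (h : IsControlled γ (2 * γ) J X Y Y')
    (hY' : ∀ t ∈ J, Y' t = φ (Y t)) (hK : holderNorm (2 * γ) J (remainder X Y Y') ≤ K)
    {s t : ℝ} (hs : s ∈ J) (ht : t ∈ J) :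
    ‖Y t - Y s - φ (Y s) (incr X s t)‖ ≤ K * |t - s| ^ (2 * γ) := by
  have h1 := h.2.2.norm_le hs ht
  simp only [remainder, hY' s hs] at h1
  exact h1.trans (by gcongr)

variable [FiniteDimensional ℝ V]

theorem SolutionPair.of_isSolution (hγ : 1 / 3 < γ) (ht₀ : t₀ ∈ Icc a b)
    (hφ : C2Bound δ K φ) (hφ₁ : C2Bound δ K φ₁) (hψ : C2Bound δ ρ fun x => φ x - φ₁ x)
    (hX : IsRoughPath γ (Icc a b) X XX) (hX₁ : IsRoughPath γ (Icc a b) X₁ XX₁)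
    (hY : IsSolution γ (Icc a b) t₀ y φ X XX Y Y')
    (hY₁ : IsSolution γ (Icc a b) t₀ y₁ φ₁ X₁ XX₁ Y₁ Y₁')
    (bX : holderNorm γ (Icc a b) (incr X) ≤ K) (bXX : holderNorm (2 * γ) (Icc a b) XX ≤ K)
    (bY : holderNorm γ (Icc a b) (incr Y) ≤ K) (bY₁ : holderNorm γ (Icc a b) (incr Y₁) ≤ K)
    (bR : holderNorm (2 * γ) (Icc a b) (remainder X Y Y') ≤ K)
    (bR₁ : holderNorm (2 * γ) (Icc a b) (remainder X₁ Y₁ Y₁') ≤ K)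
    (dX : holderNorm γ (Icc a b) (incr fun t => X t - X₁ t) ≤ ρ)
    (dXX : holderNorm (2 * γ) (Icc a b) (fun s t => XX s t - XX₁ s t) ≤ ρ) :
    SolutionPair γ δ K ρ (Icc a b) φ φ₁ X X₁ XX XX₁ Y Y₁ where
  field := hφ
  field₁ := hφ₁
  field_sub := hψ
  chen := hX.2.2
  chen₁ := hX₁.2.2
  driver s hs t ht := (hX.1.2.norm_le hs ht).trans (by gcongr)
  driver_sub s hs t ht := by
    rw [incr_sub] at dX
    exact ((hX.1.2.sub hX₁.1.2).norm_le hs ht).trans (by gcongr)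
  area s hs t ht := (hX.2.1.norm_le hs ht).trans (by gcongr)
  area_sub s hs t ht := ((hX.2.1.sub hX₁.2.1).norm_le hs ht).trans (by gcongr)
  path s hs t ht := (hY.1.1.2.norm_le hs ht).trans (by gcongr)
  path₁ s hs t ht := (hY₁.1.1.2.norm_le hs ht).trans (by gcongr)
  rem s hs t ht := hY.1.norm_rem_le hY.2.1 bR hs ht
  rem₁ s hs t ht := hY₁.1.norm_rem_le hY₁.2.1 bR₁ hs ht
  step := hY.exists_bound hγ ht₀ hφ hX
  step₁ := hY₁.exists_bound hγ ht₀ hφ₁ hX₁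

/-- Uniqueness is the stability estimate for equal data, where `ρ = 0`. -/
theorem IsSolution.eqOn (hγ : 1 / 3 < γ) (hδ₀ : 0 < δ) (hδ₁ : δ < 1) (hγδ : 1 < (2 + δ) * γ)
    (ht₀ : t₀ ∈ Icc a b) (hφ : C2Bound δ K φ) (hX : IsRoughPath γ (Icc a b) X XX)
    (hY : IsSolution γ (Icc a b) t₀ y φ X XX Y Y')
    (hY₁ : IsSolution γ (Icc a b) t₀ y φ X XX Y₁ Y₁') :
    EqOn Y Y₁ (Icc a b) ∧ EqOn Y' Y₁' (Icc a b) := by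
  set b₁ := holderNorm γ (Icc a b) (incr X)
  set b₂ := holderNorm (2 * γ) (Icc a b) XX
  set b₃ := holderNorm γ (Icc a b) (incr Y)
  set b₄ := holderNorm γ (Icc a b) (incr Y₁)
  set b₅ := holderNorm (2 * γ) (Icc a b) (remainder X Y Y')
  set b₆ := holderNorm (2 * γ) (Icc a b) (remainder X Y₁ Y₁')
  have h₁ : 0 ≤ b₁ := holderNorm_nonneg
  have h₂ : 0 ≤ b₂ := holderNorm_nonneg
  have h₃ : 0 ≤ b₃ := holderNorm_nonneg
  have h₄ : 0 ≤ b₄ := holderNorm_nonneg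
  have h₅ : 0 ≤ b₅ := holderNorm_nonneg
  have h₆ : 0 ≤ b₆ := holderNorm_nonneg
  have hK := hφ.nonneg
  obtain ⟨M, -, hM⟩ := exists_pairBound (K := 1 + K + b₁ + b₂ + b₃ + b₄ + b₅ + b₆) (a := a) (b := b)
    V (by linarith) hδ₀ hδ₁ hγδ (by linarith)
  have hφ' : C2Bound δ (1 + K + b₁ + b₂ + b₃ + b₄ + b₅ + b₆) φ := hφ.mono (by linarith)
  have hzero : C2Bound δ 0 fun x => φ x - φ x := by
    simp only [sub_self]
    exact C2Bound.zero
  have hp : SolutionPair γ δ (1 + K + b₁ + b₂ + b₃ + b₄ + b₅ + b₆) 0 (Icc a b) φ φ X X XX XX Y Y₁ :=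
    .of_isSolution hγ ht₀ hφ' hφ' hzero hX hX hY hY₁
      (by linarith) (by linarith) (by linarith) (by linarith) (by linarith) (by linarith)
      (holderNorm_le le_rfl fun s _ t _ => by simp [incr])
      (holderNorm_le le_rfl fun s _ t _ => by simp)
  have hB := hM t₀ ht₀ 0 φ φ X X XX XX Y Y₁ hp (by
    rw [hY.initial hγ ht₀ hφ hX, hY₁.initial hγ ht₀ hφ hX, sub_self, norm_zero])
  have hEq : EqOn Y Y₁ (Icc a b) := fun t ht => by
    have := hB.sup t ht
    rw [mul_zero] at this
    exact sub_eq_zero.1 (norm_le_zero_iff.1 this)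
  exact ⟨hEq, fun t ht => by rw [hY.2.1 t ht, hY₁.2.1 t ht, hEq ht]⟩

/-- The distance of two solutions as controlled paths, in terms of the estimates of `PairBound`. -/
theorem SolutionPair.norm_add_norm_add_norm_le (hK : 1 ≤ K)
    (hp : SolutionPair γ δ K ρ (Icc a b) φ φ₁ X X₁ XX XX₁ Y Y₁) {M : ℝ} (hM : 1 ≤ M)
    (hB : PairBound γ (M * ρ) (Icc a b) φ φ₁ X X₁ Y Y₁)
    (hY' : ∀ t ∈ Icc a b, Y' t = φ (Y t)) (hY₁' : ∀ t ∈ Icc a b, Y₁' t = φ₁ (Y₁ t)) :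
    supNorm (Icc a b) (fun t => Y' t - Y₁' t)
      + holderNorm γ (Icc a b) (incr fun t => Y' t - Y₁' t)
      + holderNorm (2 * γ) (Icc a b)
          (fun s t => remainder X Y Y' s t - remainder X₁ Y₁ Y₁' s t)
      ≤ (2 * K + 3 * K ^ 2 + 1) * M * ρ := by
  have hρ := hp.field_sub.nonneg
  have hρM : ρ ≤ M * ρ := by nlinarith
  have hψ := hp.field_sub.mono hρM
  have hMρ : 0 ≤ M * ρ := by positivity
  have h1 : supNorm (Icc a b) (fun t => Y' t - Y₁' t) ≤ 2 * K * (M * ρ) := by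
    refine supNorm_le (by positivity) fun t ht => ?_
    rw [hY' t ht, hY₁' t ht]
    exact norm_field_sub_le hp.field hψ hK (hB.sup t ht)
  have h2 : holderNorm γ (Icc a b) (incr fun t => Y' t - Y₁' t) ≤ 3 * K ^ 2 * (M * ρ) := by
    refine holderNorm_le (by positivity) fun s hs t ht => ?_
    have e : incr (fun t => Y' t - Y₁' t) s t
        = φ (Y t) - φ (Y s) - (φ₁ (Y₁ t) - φ₁ (Y₁ s)) := by
      simp only [incr, hY' s hs, hY' t ht, hY₁' s hs, hY₁' t ht]; abel
    rw [e]
    exact norm_field_incr_sub_le hp.field hψ hK (by positivity) (hB.sup t ht) (hB.incr s hs t ht)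
      (hp.path s hs t ht) (hp.path₁ s hs t ht)
  have h3 : holderNorm (2 * γ) (Icc a b)
      (fun s t => remainder X Y Y' s t - remainder X₁ Y₁ Y₁' s t) ≤ M * ρ := by
    refine holderNorm_le hMρ fun s hs t ht => ?_
    have := hB.rem s hs t ht
    simpa only [remainder, incr, hY' s hs, hY₁' s hs] using this
  linarith

end Assembly
end Rough

theorem mainTheorem9 {V : Type*} [NormedAddCommGroup V] [NormedSpace ℝ V] [FiniteDimensional ℝ V]
    (γ δ a b : ℝ) (hγ : 1 / 3 < γ) (hδ₀ : 0 < δ) (hδ₁ : δ < 1) (hγδ : 1 < (2 + δ) * γ) :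
    -- existence and uniqueness
    (∀ t₀ ∈ Set.Icc a b, ∀ (y : V) (φ : V → V →L[ℝ] V) (X : ℝ → V) (XX : ℝ → ℝ → V ⊗[ℝ] V),
      Rough.IsC2Holder δ φ → Rough.IsRoughPath γ (Set.Icc a b) X XX →
      ∃ (Y : ℝ → V) (Y' : ℝ → V →L[ℝ] V),
        Rough.IsSolution γ (Set.Icc a b) t₀ y φ X XX Y Y' ∧
        ∀ (Z : ℝ → V) (Z' : ℝ → V →L[ℝ] V),
          Rough.IsSolution γ (Set.Icc a b) t₀ y φ X XX Z Z' →
          Set.EqOn Z Y (Set.Icc a b) ∧ Set.EqOn Z' Y' (Set.Icc a b)) ∧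
    -- Lipschitz continuity of the solution map
    (∃ M : ℝ → ℝ → ℝ → ℝ → ℝ,
      ∀ t₀ ∈ Set.Icc a b, ∀ (y y₁ : V) (φ φ₁ : V → V →L[ℝ] V) (X X₁ : ℝ → V)
        (XX XX₁ : ℝ → ℝ → V ⊗[ℝ] V) (Y Y₁ : ℝ → V) (Y' Y₁' : ℝ → V →L[ℝ] V),
      Rough.IsC2Holder δ φ → Rough.IsC2Holder δ φ₁ →
      Rough.IsRoughPath γ (Set.Icc a b) X XX → Rough.IsRoughPath γ (Set.Icc a b) X₁ XX₁ →
      Rough.IsSolution γ (Set.Icc a b) t₀ y φ X XX Y Y' →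
      Rough.IsSolution γ (Set.Icc a b) t₀ y₁ φ₁ X₁ XX₁ Y₁ Y₁' →
      Rough.supNorm (Set.Icc a b) (fun t => Y' t - Y₁' t)
        + Rough.holderNorm γ (Set.Icc a b) (Rough.incr (fun t => Y' t - Y₁' t))
        + Rough.holderNorm (2 * γ) (Set.Icc a b)
            (fun s t => Rough.remainder X Y Y' s t - Rough.remainder X₁ Y₁ Y₁' s t)
      ≤ M (1 + Rough.holderNorm γ (Set.Icc a b) (Rough.incr X)
              + Rough.holderNorm γ (Set.Icc a b) (Rough.incr X₁)
              + Rough.holderNorm (2 * γ) (Set.Icc a b) XX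
              + Rough.holderNorm (2 * γ) (Set.Icc a b) XX₁)
          (1 + Rough.controlledNorm γ (2 * γ) (Set.Icc a b) X Y Y'
              + Rough.controlledNorm γ (2 * γ) (Set.Icc a b) X₁ Y₁ Y₁')
          (Rough.c2HolderNorm δ φ) (Rough.c2HolderNorm δ φ₁)
        * (‖y - y₁‖ + Rough.c2HolderNorm δ (fun x => φ x - φ₁ x)
            + Rough.holderNorm γ (Set.Icc a b) (Rough.incr (fun t => X t - X₁ t))
            + Rough.holderNorm (2 * γ) (Set.Icc a b) (fun s t => XX s t - XX₁ s t))) := by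
  open Rough in
  constructor
  · intro t₀ ht₀ y φ X XX hφ hX
    have hφ' := hφ.c2Bound hδ₀
    obtain ⟨Y, Y', hY⟩ := exists_isSolution hγ ht₀ hφ' hX y
    exact ⟨Y, Y', hY, fun Z Z' hZ => hZ.eqOn hγ hδ₀ hδ₁ hγδ ht₀ hφ' hX hY⟩
  · have hγ0 : 0 < γ := by linarith
    have main : ∀ K : ℝ, ∃ M : ℝ, 1 ≤ K → 1 ≤ M ∧ ∀ t₀ ∈ Icc a b, ∀ (ρ : ℝ)
        (φ φ₁ : V → V →L[ℝ] V) (X X₁ : ℝ → V) (XX XX₁ : ℝ → ℝ → V ⊗[ℝ] V) (Y Y₁ : ℝ → V),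
        SolutionPair γ δ K ρ (Icc a b) φ φ₁ X X₁ XX XX₁ Y Y₁ → ‖Y t₀ - Y₁ t₀‖ ≤ ρ →
        PairBound γ (M * ρ) (Icc a b) φ φ₁ X X₁ Y Y₁ := by
      intro K
      by_cases hK : 1 ≤ K
      · obtain ⟨M, hM⟩ := exists_pairBound (a := a) (b := b) V hγ0 hδ₀ hδ₁ hγδ hK
        exact ⟨M, fun _ => hM⟩
      · exact ⟨0, fun h => absurd h hK⟩
    choose M hM using main
    -- The sum of the four arguments bounds every norm which enters, and is at least `1`.
    refine ⟨fun cX cY n n₁ => (2 * (cX + cY + n + n₁) + 3 * (cX + cY + n + n₁) ^ 2 + 1)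
      * M (cX + cY + n + n₁), ?_⟩
    intro t₀ ht₀ y y₁ φ φ₁ X X₁ XX XX₁ Y Y₁ Y' Y₁' hφ hφ₁ hX hX₁ hY hY₁
    have bφ := hφ.c2Bound hδ₀
    have bφ₁ := hφ₁.c2Bound hδ₀
    have bψ := (hφ.sub hδ₀ hφ₁).c2Bound hδ₀
    have n1 := bφ.nonneg
    have n2 := bφ₁.nonneg
    have n3 := bψ.nonneg
    have n4 := holderNorm_nonneg (γ := γ) (J := Icc a b) (R := incr X)
    have n5 := holderNorm_nonneg (γ := γ) (J := Icc a b) (R := incr X₁)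
    have n6 := holderNorm_nonneg (γ := 2 * γ) (J := Icc a b) (R := XX)
    have n7 := holderNorm_nonneg (γ := 2 * γ) (J := Icc a b) (R := XX₁)
    have n8 := holderNorm_nonneg (γ := γ) (J := Icc a b) (R := incr Y)
    have n9 := holderNorm_nonneg (γ := γ) (J := Icc a b) (R := incr Y₁)
    have n10 := holderNorm_nonneg (γ := 2 * γ) (J := Icc a b) (R := remainder X Y Y')
    have n11 := holderNorm_nonneg (γ := 2 * γ) (J := Icc a b) (R := remainder X₁ Y₁ Y₁')
    have n12 := holderNorm_nonneg (γ := 2 * γ - γ) (J := Icc a b) (R := incr Y')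
    have n13 := holderNorm_nonneg (γ := 2 * γ - γ) (J := Icc a b) (R := incr Y₁')
    have n14 := supNorm_nonneg (J := Icc a b) (A := Y')
    have n15 := supNorm_nonneg (J := Icc a b) (A := Y₁')
    have n16 := holderNorm_nonneg (γ := γ) (J := Icc a b) (R := incr fun t => X t - X₁ t)
    have n17 := holderNorm_nonneg (γ := 2 * γ) (J := Icc a b) (R := fun s t => XX s t - XX₁ s t)
    have n18 := norm_nonneg (y - y₁)
    set cX := 1 + holderNorm γ (Icc a b) (incr X) + holderNorm γ (Icc a b) (incr X₁)
      + holderNorm (2 * γ) (Icc a b) XX + holderNorm (2 * γ) (Icc a b) XX₁ with hcX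
    set cY := 1 + controlledNorm γ (2 * γ) (Icc a b) X Y Y'
      + controlledNorm γ (2 * γ) (Icc a b) X₁ Y₁ Y₁' with hcY
    simp only [controlledNorm] at hcY
    set K := cX + cY + c2HolderNorm δ φ + c2HolderNorm δ φ₁ with hK
    set ρ := ‖y - y₁‖ + c2HolderNorm δ (fun x => φ x - φ₁ x)
      + holderNorm γ (Icc a b) (incr fun t => X t - X₁ t)
      + holderNorm (2 * γ) (Icc a b) (fun s t => XX s t - XX₁ s t) with hρ
    have hK1 : 1 ≤ K := by linarith
    have hp : SolutionPair γ δ K ρ (Icc a b) φ φ₁ X X₁ XX XX₁ Y Y₁ :=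
      .of_isSolution hγ ht₀ (bφ.mono (by linarith)) (bφ₁.mono (by linarith))
        (bψ.mono (by linarith)) hX hX₁ hY hY₁ (by linarith) (by linarith) (by linarith)
        (by linarith) (by linarith) (by linarith) (by linarith) (by linarith)
    have hB := (hM K hK1).2 t₀ ht₀ ρ φ φ₁ X X₁ XX XX₁ Y Y₁ hp (by
      rw [hY.initial hγ ht₀ bφ hX, hY₁.initial hγ ht₀ bφ₁ hX₁]; linarith)
    exact hp.norm_add_norm_add_norm_le hK1 (hM K hK1).1 hB hY.2.1 hY₁.2.1
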